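/- Let $\xi$ be an ordinal, let $1\le p,q\le\infty$ with $1<p$ and $\frac1p+\frac1q=1$, let $X$ be a (real or complex) Banach space with scalar field $\mathbb K$ and closed unit ball $B_X$, and let $K\subset X^*$ be weak$^*$-compact. Then (i) $\displaystyle \inf_{n\ge 1}\theta_{\xi,n}(K)=\limsup_{n\to\infty}\frac{\alpha_{\xi,p,n}(K)}{n^{1/q}}$; (ii) $Sz(K)\le\omega^{\xi+1}$ if and only if $\inf_{n\ge1}\theta_{\xi,n}(K)=0$, if and only if $\limsup_{n}\alpha_{\xi,p,n}(K)/n^{1/q}=0$. Here the notation is as follows. *Szlenk index.* For $\varepsilon>0$ and $L\subset X^*$, $s_\varepsilon(L)$ is the set of $x^*\in L$ such that $\operatorname{diam}(V\cap L)>\varepsilon$ for every weak$^*$-neighbourhood $V$ of $x^*$; $s^0_\varepsilon(K)=K$, $s^{\zeta+1}_\varepsilon(K)=s_\varepsilon(s^\zeta_\varepsilon(K))$, and $s^\zeta_\varepsilon(K)=\bigcap_{\eta<\zeta}s^\eta_\varepsilon(K)$ for limit $\zeta$. $Sz(K,\varepsilon)$ is the least $\zeta$ with $s^\zeta_\varepsilon(K)=\varnothing$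 ($\infty$ if there is none), and $Sz(K)=\sup_{\varepsilon>0}Sz(K,\varepsilon)$. *Trees and weights.* Finite sequences are ordered by the initial segment relation, $MAX(T)$ is the set of maximal members of $T$, and $\zeta+(\zeta_1,\dots,\zeta_k)=(\zeta+\zeta_1,\dots,\zeta+\zeta_k)$. Trees $\Gamma_{\xi,n}$ ($n\ge1$) of finite non-empty sequences of ordinals and functions $\mathbb P_{\xi,n}:\Gamma_{\xi,n}\to[0,1]$ are defined recursively: $\Gamma_{0,1}=\{(0)\}$ and $\mathbb P_{0,1}((0))=1$; $\Gamma_{\xi,n}=\bigcup_{i=1}^n\Lambda_{\xi,n,i}$, where $\Lambda_{\xi,n,i}$ is the set of all $(\omega^\xi(n-1)+t_1)^\frown\cdots^\frown(\omega^\xi(n-i)+t_i)$ with $t_1,\dots,t_i\in\Gamma_{\xi,1}$ and $t_1,\dots,t_{i-1}\in MAX(\Gamma_{\xi,1})$, and $\mathbb P_{\xi,n}$ has the value $\mathbb P_{\xi,1}(t_i)$ at this sequence; $\Gamma_{\xi+1,1}=\bigcup_{n\ge1}\Gamma_{\xi,n}$, with $\mathbb P_{\xi+1,1}=\frac1n\mathbb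 P_{\xi,n}$ on $\Gamma_{\xi,n}$; and for a limit $\xi$, $\Gamma_{\xi,1}=\bigcup_{\zeta<\xi}(\omega^\zeta+\Gamma_{\zeta+1,1})$, with $\mathbb P_{\xi,1}(\omega^\zeta+t)=\mathbb P_{\zeta+1,1}(t)$. For a (non-empty) directed set $D$ and a set $T$ of sequences, $T.D$ is the set of all $((\zeta_1,u_1),\dots,(\zeta_k,u_k))$ with $(\zeta_1,\dots,\zeta_k)\in T$ and $u_1,\dots,u_k\in D$; for $s\in \Gamma_{\xi,n}.D$, $\mathbb P_{\xi,n}(s)$ denotes the value of $\mathbb P_{\xi,n}$ at the underlying sequence of ordinals. A collection $(x_t)_{t\in\Gamma_{\xi,n}.D}\subset X$ is weakly null if, for every $t\in\{\varnothing\}\cup\Gamma_{\xi,n}.D$ and every ordinal $\zeta$ such that $t^\frown(\zeta,u)\in\Gamma_{\xi,n}.D$ for $u\in D$, the net $(x_{t^\frown(\zeta,u)})_{u\in D}$ is weakly null. For $t\in MAX(\Gamma_{\xi,n}.D)$ and $1\le i\le n$ put $z_i^t=\sum_{s\le t,\ s\in\Lambda_{\xi,n,i}.D}\mathbb P_{\xi,n}(s)\,x_s$.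 *The quantities.* Let $r_K(x)=\max_{x^*\in K}\operatorname{Re}x^*(x)$, and $r_K=0$ if $K=\varnothing$. Then $\alpha_{\xi,p,n}(K)$ is the infimum of all $\alpha>0$ such that $$\inf_{t\in MAX(\Gamma_{\xi,n}.D)} r_K\Bigl(\sum_{i=1}^n a_iz_i^t\Bigr)\le\alpha\,\|(a_i)_{i=1}^n\|_{\ell_p^n}$$ for every directed set $D$, all $(a_i)_{i=1}^n\in\mathbb K^n$ and every weakly null $(x_t)_{t\in\Gamma_{\xi,n}.D}\subset B_X$; and $\theta_{\xi,n}(K)$ is the infimum of all $\theta>0$ such that $\inf_{t\in MAX(\Gamma_{\xi,n}.D)} r_K\bigl(\sum_{i=1}^n\frac1n z_i^t\bigr)\le\theta$ for every directed set $D$ and every weakly null $(x_t)_{t\in\Gamma_{\xi,n}.D}\subset B_X$. -/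

import Mathlib

open scoped ENNReal Topology Ordinal

universe u v w

noncomputable section

namespace SzlenkSum

/-! ### Trees of finite sequences -/

/-- The maximal members of a set of finite sequences, ordered by the initial segment relation. -/
def maxNodes {β : Type*} (T : Set (List β)) : Set (List β) :=
  {t | t ∈ T ∧ ∀ s ∈ T, t <+: s → s = t}

/-- `ζ + (ζ₁, …, ζₖ) = (ζ + ζ₁, …, ζ + ζₖ)`. -/
def shift (ζ : Ordinal.{v}) (t : List Ordinal.{v}) : List Ordinal.{v} :=
  t.map fun η => ζ + η

/-- For `G = Γ_{ξ,1}`, the `i`-th level `Λ_{ξ,n,i}` (`1 ≤ i ≤ n`) of `Γ_{ξ,n}`: the sequences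
`(ω ^ ξ (n - 1) + t₁) ⌢ … ⌢ (ω ^ ξ (n - i) + tᵢ)` where `t₁, …, tᵢ ∈ G` and `t₁, …, tᵢ₋₁` are
maximal in `G`. It is empty for all other pairs `(n, i)`. -/
def stackLevel (G : Set (List Ordinal.{v})) (ξ : Ordinal.{v}) : ℕ → ℕ → Set (List Ordinal.{v})
  | n + 1, 1 => {r | ∃ t ∈ G, r = shift (ω ^ ξ * (n : Ordinal.{v})) t}
  | n + 1, i + 2 => {r | ∃ t ∈ maxNodes G, ∃ s ∈ stackLevel G ξ n (i + 1),
      r = shift (ω ^ ξ * (n : Ordinal.{v})) t ++ s}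
  | _, _ => ∅

/-- The union of the levels: `Γ_{ξ,n}` for `G = Γ_{ξ,1}`. -/
def stackTree (G : Set (List Ordinal.{v})) (ξ : Ordinal.{v}) (n : ℕ) : Set (List Ordinal.{v}) :=
  ⋃ i : ℕ, stackLevel G ξ n i

/-- The tree `Γ_{ξ,1}`. -/
def GammaOne (ξ : Ordinal.{v}) : Set (List Ordinal.{v}) :=
  Ordinal.limitRecOn (motive := fun _ => Set (List Ordinal.{v})) ξ
    {[0]}
    (fun η G => ⋃ n : ℕ, stackTree G η n)
    (fun _ hη ih => {r | ∃ ζ, ∃ h : ζ < _, ∃ t ∈ ih (ζ + 1) (hη.add_one_lt h),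
      r = shift (ω ^ ζ) t})

/-- The level `Λ_{ξ,n,i}`, for `1 ≤ i ≤ n`. -/
def Lam (ξ : Ordinal.{v}) (n i : ℕ) : Set (List Ordinal.{v}) :=
  stackLevel (GammaOne ξ) ξ n i

/-- The tree `Γ_{ξ,n}`, for `n ≥ 1`. -/
def Gam (ξ : Ordinal.{v}) (n : ℕ) : Set (List Ordinal.{v}) :=
  stackTree (GammaOne ξ) ξ n

/-- The graph of the weight functions: `HasWeight ξ n t c` means that `t ∈ Γ_{ξ,n}` and
`ℙ_{ξ,n}(t) = c`. -/
inductive HasWeight : Ordinal.{v} → ℕ → List Ordinal.{v} → ℝ → Prop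
  /-- `ℙ_{0,1}((0)) = 1`. -/
  | zero : HasWeight 0 1 [0] 1
  /-- `ℙ_{ξ,1}(ω ^ ζ + t) = ℙ_{ζ+1,1}(t)` for a limit `ξ`, `ζ < ξ` and `t ∈ Γ_{ζ+1,1}`. -/
  | limit {ξ ζ : Ordinal.{v}} {t : List Ordinal.{v}} {c : ℝ} :
      Order.IsSuccLimit ξ → ζ < ξ → HasWeight (ζ + 1) 1 t c → HasWeight ξ 1 (shift (ω ^ ζ) t) c
  /-- `ℙ_{ξ+1,1}(t) = ℙ_{ξ,n}(t) / n` for `t ∈ Γ_{ξ,n}`. -/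
  | succ {ξ : Ordinal.{v}} {n : ℕ} {t : List Ordinal.{v}} {c : ℝ} :
      HasWeight ξ n t c → HasWeight (ξ + 1) 1 t (c / n)
  /-- On its first level, `ℙ_{ξ,n+1}` is `ℙ_{ξ,1}`. -/
  | head {ξ : Ordinal.{v}} {n : ℕ} {t : List Ordinal.{v}} {c : ℝ} :
      1 ≤ n → HasWeight ξ 1 t c → HasWeight ξ (n + 1) (shift (ω ^ ξ * (n : Ordinal.{v})) t) c
  /-- Above a maximal member of the first level of `Γ_{ξ,n+1}`, the function `ℙ_{ξ,n+1}`
  is `ℙ_{ξ,n}`. -/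
  | tail {ξ : Ordinal.{v}} {n : ℕ} {t s : List Ordinal.{v}} {c : ℝ} :
      1 ≤ n → t ∈ maxNodes (GammaOne ξ) → HasWeight ξ n s c →
        HasWeight ξ (n + 1) (shift (ω ^ ξ * (n : Ordinal.{v})) t ++ s) c

/-! ### The weight functions are well defined on the trees -/

theorem shift_inj {ζ : Ordinal.{v}} {t s : List Ordinal.{v}} (h : shift ζ t = shift ζ s) :
    t = s := by
  refine List.map_injective_iff.2 ?_ h
  intro a b hab
  simpa using hab

theorem GammaOne_zero : GammaOne (0 : Ordinal.{v}) = {[0]} := by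
  simp [GammaOne]

theorem GammaOne_add_one (ξ : Ordinal.{v}) : GammaOne (ξ + 1) = ⋃ n : ℕ, Gam ξ n := by
  simp [GammaOne, Gam]

theorem GammaOne_limit {ξ : Ordinal.{v}} (hξ : Order.IsSuccLimit ξ) :
    GammaOne ξ = {r | ∃ ζ < ξ, ∃ t ∈ GammaOne (ζ + 1), r = shift (ω ^ ζ) t} := by
  rw [GammaOne, Ordinal.limitRecOn_limit _ _ _ _ hξ]
  simp [GammaOne]

theorem stackLevel_lt {G : Set (List Ordinal.{v})} {ξ : Ordinal.{v}}
    (hG : ∀ t ∈ G, ∀ η ∈ t, η < ω ^ ξ) (n i : ℕ) :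
    ∀ t ∈ stackLevel G ξ n i, ∀ η ∈ t, η < ω ^ ξ * (n : Ordinal.{v}) := by
  have key : ∀ (n : ℕ) (t : List Ordinal.{v}), t ∈ G →
      ∀ η ∈ shift (ω ^ ξ * (n : Ordinal.{v})) t, η < ω ^ ξ * ((n + 1 : ℕ) : Ordinal.{v}) := by
    intro n t ht η hη
    obtain ⟨η', h', rfl⟩ := List.mem_map.1 hη
    rw [Nat.cast_add, Nat.cast_one, mul_add, mul_one]
    exact (add_lt_add_iff_left _).2 (hG t ht η' h')
  fun_induction stackLevel G ξ n i with
  | case1 n =>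
    rintro r ⟨t, ht, rfl⟩
    exact key n t ht
  | case2 n i ih =>
    rintro r ⟨t, ht, s, hs, rfl⟩ η hη
    rcases List.mem_append.1 hη with h | h
    · exact key n t ht.1 η h
    · refine (ih s hs η h).trans_le (mul_le_mul_right ?_ _)
      exact_mod_cast Nat.le_succ n
  | case3 => simp

theorem GammaOne_lt (ξ : Ordinal.{v}) : ∀ t ∈ GammaOne ξ, ∀ η ∈ t, η < ω ^ ξ := by
  induction ξ using Ordinal.limitRecOn with
  | zero => simp [GammaOne_zero]
  | add_one ξ ih =>
    rw [GammaOne_add_one]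
    intro t ht η hη
    obtain ⟨n, hn⟩ := Set.mem_iUnion.1 ht
    obtain ⟨i, hi⟩ := Set.mem_iUnion.1 hn
    refine (stackLevel_lt ih n i t hi η hη).trans ?_
    rw [Ordinal.opow_add, Ordinal.opow_one]
    exact (mul_lt_mul_iff_right₀ (Ordinal.opow_pos _ Ordinal.omega0_pos)).2
      (Ordinal.natCast_lt_omega0 n)
  | limit ξ hξ ih =>
    rw [GammaOne_limit hξ]
    rintro r ⟨ζ, hζ, t, ht, rfl⟩ η hη
    obtain ⟨η', h', rfl⟩ := List.mem_map.1 hη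
    refine Ordinal.isPrincipal_add_omega0_opow ξ ?_ ?_
    · exact (Ordinal.opow_lt_opow_iff_right Ordinal.one_lt_omega0).2 hζ
    · refine (ih _ (hξ.add_one_lt hζ) t ht η' h').trans ?_
      exact (Ordinal.opow_lt_opow_iff_right Ordinal.one_lt_omega0).2 (hξ.add_one_lt hζ)

theorem HasWeight.one_le {ξ : Ordinal.{v}} {n : ℕ} {t : List Ordinal.{v}} {c : ℝ}
    (h : HasWeight ξ n t c) : 1 ≤ n := by
  cases h <;> omega

theorem HasWeight.mem {ξ : Ordinal.{v}} {n : ℕ} {t : List Ordinal.{v}} {c : ℝ}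
    (h : HasWeight ξ n t c) : t ∈ Gam ξ n := by
  have one : ∀ {ξ : Ordinal.{v}} {t : List Ordinal.{v}}, t ∈ Gam ξ 1 ↔ t ∈ GammaOne ξ := by
    intro ξ t
    constructor
    · intro h
      obtain ⟨i, hi⟩ := Set.mem_iUnion.1 h
      match i, hi with
      | 1, ⟨s, hs, e⟩ => simpa [shift, e] using hs
      | i + 2, ⟨s, _, r, hr, _⟩ => exact absurd hr (by simp [stackLevel])
    · intro h
      exact Set.mem_iUnion.2 ⟨1, t, h, by simp [shift]⟩
  induction h with
  | zero => exact one.2 (by simp [GammaOne_zero])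
  | limit hξ hζ _ ih => exact one.2 (GammaOne_limit hξ ▸ ⟨_, hζ, _, one.1 ih, rfl⟩)
  | @succ ξ n t c _ ih => exact one.2 (GammaOne_add_one ξ ▸ Set.mem_iUnion.2 ⟨n, ih⟩)
  | head _ _ ih => exact Set.mem_iUnion.2 ⟨1, _, one.1 ih, rfl⟩
  | tail _ ht _ ih =>
    obtain ⟨i, hi⟩ := Set.mem_iUnion.1 ih
    match i, hi with
    | 0, hi => simp [stackLevel] at hi
    | i + 1, hi => exact Set.mem_iUnion.2 ⟨i + 2, _, ht, _, hi, rfl⟩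

theorem HasWeight.lt {ξ : Ordinal.{v}} {n : ℕ} {t : List Ordinal.{v}} {c : ℝ}
    (h : HasWeight ξ n t c) : ∀ η ∈ t, η < ω ^ ξ * (n : Ordinal.{v}) := by
  obtain ⟨i, hi⟩ := Set.mem_iUnion.1 h.mem
  exact stackLevel_lt (GammaOne_lt ξ) n i t hi

theorem HasWeight.ne_nil {ξ : Ordinal.{v}} {n : ℕ} {t : List Ordinal.{v}} {c : ℝ}
    (h : HasWeight ξ n t c) : t ≠ [] := by
  induction h with
  | zero => simp
  | limit _ _ _ ih => simpa [shift] using ih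
  | succ _ ih => exact ih
  | head _ _ ih => simpa [shift] using ih
  | tail _ _ _ ih => simp [ih]

theorem exists_weight_of_stackLevel {ξ : Ordinal.{v}}
    (hG : ∀ t ∈ GammaOne ξ, ∃ c, HasWeight ξ 1 t c) (n i : ℕ) :
    ∀ t ∈ stackLevel (GammaOne ξ) ξ n i, ∃ c, HasWeight ξ n t c := by
  have zero : ∀ t : List Ordinal.{v}, shift (ω ^ ξ * ((0 : ℕ) : Ordinal.{v})) t = t := by
    simp [shift]
  generalize hG' : GammaOne ξ = G
  fun_induction stackLevel G ξ n i with
  | case1 n =>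
    subst hG'
    rintro r ⟨t, ht, rfl⟩
    obtain ⟨c, hc⟩ := hG t ht
    rcases Nat.eq_zero_or_pos n with rfl | hn
    · exact ⟨c, by rw [zero]; exact hc⟩
    · exact ⟨c, .head hn hc⟩
  | case2 n i ih =>
    subst hG'
    rintro r ⟨t, ht, s, hs, rfl⟩
    obtain ⟨c, hc⟩ := ih s hs
    exact ⟨c, .tail hc.one_le ht hc⟩
  | case3 => simp

theorem exists_weight_of_GammaOne (ξ : Ordinal.{v}) :
    ∀ t ∈ GammaOne ξ, ∃ c, HasWeight ξ 1 t c := by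
  induction ξ using Ordinal.limitRecOn with
  | zero =>
    rw [GammaOne_zero]
    rintro _ rfl
    exact ⟨1, .zero⟩
  | add_one ξ ih =>
    rw [GammaOne_add_one]
    intro t ht
    obtain ⟨n, hn⟩ := Set.mem_iUnion.1 ht
    obtain ⟨i, hi⟩ := Set.mem_iUnion.1 hn
    obtain ⟨c, hc⟩ := exists_weight_of_stackLevel ih n i t hi
    exact ⟨_, .succ hc⟩
  | limit ξ hξ ih =>
    rw [GammaOne_limit hξ]
    rintro r ⟨ζ, hζ, t, ht, rfl⟩
    obtain ⟨c, hc⟩ := ih _ (hξ.add_one_lt hζ) t ht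
    exact ⟨c, .limit hξ hζ hc⟩

/-- The domain of `ℙ_{ξ,n}` is `Γ_{ξ,n}`. -/
theorem exists_hasWeight_iff {ξ : Ordinal.{v}} {n : ℕ} {t : List Ordinal.{v}} :
    (∃ c, HasWeight ξ n t c) ↔ t ∈ Gam ξ n := by
  constructor
  · rintro ⟨c, hc⟩
    exact hc.mem
  · intro h
    obtain ⟨i, hi⟩ := Set.mem_iUnion.1 h
    exact exists_weight_of_stackLevel (exists_weight_of_GammaOne ξ) n i t hi

theorem HasWeight.le_head {ξ : Ordinal.{v}} {n : ℕ} {t : List Ordinal.{v}} {c : ℝ}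
    (h : HasWeight ξ n t c) : ∃ η ∈ t.head?, ∀ m : ℕ, m < n → ω ^ ξ * (m : Ordinal.{v}) ≤ η := by
  have aux : ∀ {ξ : Ordinal.{v}} {n : ℕ} {t : List Ordinal.{v}} (s : List Ordinal.{v}), t ≠ [] →
      ∃ η ∈ (shift (ω ^ ξ * (n : Ordinal.{v})) t ++ s).head?,
        ∀ m : ℕ, m < n + 1 → ω ^ ξ * (m : Ordinal.{v}) ≤ η := by
    intro ξ n t s ht
    obtain ⟨a, l, rfl⟩ := List.exists_cons_of_ne_nil ht
    refine ⟨_, by simp [shift]; rfl, fun m hm => le_trans (mul_le_mul_right ?_ _) le_self_add⟩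
    exact_mod_cast Nat.lt_succ_iff.1 hm
  have triv : ∀ {ξ : Ordinal.{v}} {t : List Ordinal.{v}}, t ≠ [] →
      ∃ η ∈ t.head?, ∀ m : ℕ, m < 1 → ω ^ ξ * (m : Ordinal.{v}) ≤ η := by
    intro ξ t ht
    obtain ⟨a, l, rfl⟩ := List.exists_cons_of_ne_nil ht
    refine ⟨a, rfl, fun m hm => ?_⟩
    obtain rfl : m = 0 := by omega
    simp
  cases h with
  | zero => exact triv (by simp)
  | limit h1 h2 h3 => exact triv (HasWeight.limit h1 h2 h3).ne_nil
  | succ h => exact triv h.ne_nil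
  | head _ h => simpa using aux [] h.ne_nil
  | @tail _ n t s _ hn ht h =>
    obtain ⟨c, hc⟩ := exists_weight_of_GammaOne _ t ht.1
    exact aux s hc.ne_nil

/-- `ℙ_{ξ,n}` is single-valued. -/
theorem HasWeight.unique {ξ : Ordinal.{v}} {n : ℕ} {t : List Ordinal.{v}} {c c' : ℝ}
    (h : HasWeight ξ n t c) (h' : HasWeight ξ n t c') : c = c' := by
  have filt : ∀ {β : Ordinal.{v}} {t s : List Ordinal.{v}}, (∀ η ∈ s, η < β) →
      (shift β t ++ s).filter (fun η => decide (β ≤ η)) = shift β t ∧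
      (shift β t ++ s).filter (fun η => decide (¬ β ≤ η)) = s := by
    intro β t s hs
    constructor
    · rw [List.filter_append, List.filter_eq_self.2, List.filter_eq_nil_iff.2, List.append_nil]
      · simpa using hs
      · simp [shift]
    · rw [List.filter_append, List.filter_eq_nil_iff.2, List.filter_eq_self.2, List.nil_append]
      · simpa using hs
      · simp [shift]
  induction h generalizing c' with
  | zero =>
    generalize hz : (0 : Ordinal.{v}) = z at h'
    generalize hl : [z] = l at h'
    generalize hk : (1 : ℕ) = k at h'
    cases h' with
    | zero => rfl
    | limit h1 h2 _ => subst hz; exact absurd h2 not_lt_zero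
    | succ _ => exact absurd hz.symm (add_pos_of_nonneg_of_pos zero_le one_pos).ne'
    | head h1 _ => omega
    | tail h1 _ _ => omega
  | @limit ξ ζ t c hξ hζ h ih =>
    generalize hl : shift (ω ^ ζ) t = l at h'
    generalize hk : (1 : ℕ) = k at h'
    cases h' with
    | zero => simp at hζ
    | @limit _ ζ' t' _ _ hζ' h2 =>
      have bd : ∀ {α β : Ordinal.{v}} {a b : List Ordinal.{v}} {x y : ℝ},
          HasWeight (α + 1) 1 a x → HasWeight (β + 1) 1 b y →
          shift (ω ^ α) a = shift (ω ^ β) b → α ≤ β := by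
        intro α β a b x y ha hb hab
        by_contra! hlt
        obtain ⟨η, l, rfl⟩ := List.exists_cons_of_ne_nil ha.ne_nil
        obtain ⟨η', l', rfl⟩ := List.exists_cons_of_ne_nil hb.ne_nil
        have e : ω ^ α + η = ω ^ β + η' := by
          have := congrArg List.head? hab
          simpa [shift] using this
        have h1 : η' < ω ^ (β + 1) := by simpa using hb.lt η' (by simp)
        have h2 : ω ^ β + η' < ω ^ (β + 1) := Ordinal.isPrincipal_add_omega0_opow _
          ((Ordinal.opow_lt_opow_iff_right Ordinal.one_lt_omega0).2 (by simp)) h1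
        have h3 : ω ^ (β + 1) ≤ ω ^ α :=
          Ordinal.opow_le_opow_right Ordinal.omega0_pos (Order.add_one_le_of_lt hlt)
        exact absurd (e ▸ h2) (not_lt.2 (h3.trans le_self_add))
      obtain rfl : ζ = ζ' := le_antisymm (bd h h2 hl) (bd h2 h hl.symm)
      obtain rfl := shift_inj hl
      exact ih h2
    | succ _ => exact absurd hξ (by simp)
    | head h1 _ => omega
    | tail h1 _ _ => omega
  | @succ ξ n t c h ih =>
    generalize hz : ξ + 1 = z at h'
    generalize hk : (1 : ℕ) = k at h'
    cases h' with
    | zero => simp at hz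
    | limit h1 _ _ => subst hz; exact absurd h1 (by simp)
    | @succ ξ' n' _ c' h2 =>
      obtain rfl : ξ = ξ' := by simpa using hz
      have bd : ∀ {a b : ℕ} {x y : ℝ}, HasWeight ξ a t x → HasWeight ξ b t y → a ≤ b := by
        intro a b x y ha hb
        by_contra! hlt
        obtain ⟨η, hη, hm⟩ := ha.le_head
        exact absurd (hb.lt η (List.mem_of_mem_head? hη)) (not_lt.2 (hm b hlt))
      obtain rfl : n = n' := le_antisymm (bd h h2) (bd h2 h)
      rw [ih h2]
    | head h1 _ => omega
    | tail h1 _ _ => omega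
  | @head ξ n t c hn h ih =>
    generalize hl : shift (ω ^ ξ * (n : Ordinal.{v})) t = l at h'
    generalize hk : n + 1 = k at h'
    cases h' with
    | zero => omega
    | limit _ _ _ => omega
    | succ _ => omega
    | @head _ n' t' _ _ h2 =>
      obtain rfl : n = n' := by omega
      obtain rfl := shift_inj hl
      exact ih h2
    | @tail _ n' t' s' _ _ ht h2 =>
      obtain rfl : n = n' := by omega
      have f1 := (filt (t := t) (s := []) (β := ω ^ ξ * (n : Ordinal.{v})) (by simp)).2
      have f2 := (filt (t := t') h2.lt).2
      rw [List.append_nil, hl, f2] at f1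
      exact absurd f1 h2.ne_nil
  | @tail ξ n t s c hn ht h ih =>
    generalize hl : shift (ω ^ ξ * (n : Ordinal.{v})) t ++ s = l at h'
    generalize hk : n + 1 = k at h'
    cases h' with
    | zero => omega
    | limit _ _ _ => omega
    | succ _ => omega
    | @head _ n' t' _ _ h2 =>
      obtain rfl : n = n' := by omega
      have f1 := (filt (t := t') (s := []) (β := ω ^ ξ * (n : Ordinal.{v})) (by simp)).2
      have f2 := (filt (t := t) h.lt).2
      rw [List.append_nil, ← hl, f2] at f1
      exact absurd f1 h.ne_nil
    | @tail _ n' t' s' _ _ _ h2 =>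
      obtain rfl : n = n' := by omega
      have f2 := (filt (t := t) h.lt).2
      rw [hl, (filt (t := t') h2.lt).2] at f2
      subst f2
      exact ih h2

open Classical in
/-- The weight `ℙ_{ξ,n}(t)` of `t ∈ Γ_{ξ,n}` (and `0` for all other `t`). -/
def weight (ξ : Ordinal.{v}) (n : ℕ) (t : List Ordinal.{v}) : ℝ :=
  if h : ∃ c, HasWeight ξ n t c then h.choose else 0

/-- For a tree `T` and a set `D`, the tree `T.D` of all sequences `((ζ₁, u₁), …, (ζₖ, uₖ))` with
`(ζ₁, …, ζₖ) ∈ T` and `u₁, …, uₖ ∈ D`. -/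
def prodTree (T : Set (List Ordinal.{v})) (D : Type u) : Set (List (Ordinal.{v} × D)) :=
  {t | t.map Prod.fst ∈ T}

/-! ### Weakly null collections, and the quantities `θ` and `α` -/

/-- A collection `(x_t)_{t ∈ T.D}` is weakly null if for every `t ∈ {∅} ∪ T.D` and every ordinal `ζ`
such that `t ⌢ (ζ, u) ∈ T.D` for (all) `u ∈ D`, the net `(x_{t ⌢ (ζ, u)})_{u ∈ D}` is weakly
null. -/
def IsWeaklyNull (𝕜 : Type w) [RCLike 𝕜] {X : Type u} [NormedAddCommGroup X] [NormedSpace 𝕜 X]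
    (T : Set (List Ordinal.{v})) {D : Type u} [Preorder D] (x : List (Ordinal.{v} × D) → X) :
    Prop :=
  ∀ (t : List (Ordinal.{v} × D)) (ζ : Ordinal.{v}), t.map Prod.fst ++ [ζ] ∈ T →
    ∀ f : StrongDual 𝕜 X, Filter.Tendsto (fun d : D => f (x (t ++ [(ζ, d)]))) Filter.atTop (𝓝 0)

open Classical in
/-- `z_i^t`, for `t ∈ MAX(Γ_{ξ,n}.D)` and `1 ≤ i ≤ n`: the sum of `ℙ_{ξ,n}(s) x_s` over all
`s ≤ t` in the level `Λ_{ξ,n,i}.D`. -/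
def blockSum (𝕜 : Type w) [RCLike 𝕜] {X : Type u} [NormedAddCommGroup X] [NormedSpace 𝕜 X]
    (ξ : Ordinal.{v}) (n : ℕ) {D : Type u} (x : List (Ordinal.{v} × D) → X)
    (t : List (Ordinal.{v} × D)) (i : ℕ) : X :=
  ∑ s ∈ t.inits.toFinset with s ∈ prodTree (Lam ξ n i) D,
    ((weight ξ n (s.map Prod.fst) : ℝ) : 𝕜) • x s

section

variable {𝕜 : Type w} [RCLike 𝕜] {X : Type u} [NormedAddCommGroup X] [NormedSpace 𝕜 X]

/-- `r_K(x) = max_{f ∈ K} Re f(x)`, and `r_K(x) = 0` if `K` is empty. -/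
def supportFun (K : Set (WeakDual 𝕜 X)) (x : X) : ℝ :=
  sSup ((fun f : WeakDual 𝕜 X => RCLike.re (f x)) '' K)

/-- `inf_{t ∈ MAX(Γ_{ξ,n}.D)} r_K(∑_{i=1}^n a_i z_i^t)`. -/
def treeInf (K : Set (WeakDual 𝕜 X)) (ξ : Ordinal.{v}) (n : ℕ) {D : Type u}
    (x : List (Ordinal.{v} × D) → X) (a : Fin n → 𝕜) : ℝ :=
  ⨅ t : maxNodes (prodTree (Gam ξ n) D),
    supportFun K (∑ i : Fin n, a i • blockSum 𝕜 ξ n x t.1 (i + 1))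

/-- `α_{ξ,p,n}(K)`, for `n ≥ 1`. -/
def alpha (ξ : Ordinal.{v}) (p : ℝ≥0∞) (n : ℕ) (K : Set (WeakDual 𝕜 X)) : ℝ :=
  sInf {α : ℝ | 0 < α ∧
    ∀ (D : Type u) [Preorder D] [IsDirectedOrder D] [Nonempty D] (a : Fin n → 𝕜)
      (x : List (Ordinal.{v} × D) → X),
      (∀ t ∈ prodTree (Gam ξ n) D, ‖x t‖ ≤ 1) → IsWeaklyNull 𝕜 (Gam ξ n) x →
        treeInf K ξ n x a ≤ α * ‖(WithLp.toLp p a : PiLp p fun _ : Fin n => 𝕜)‖}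

/-- `θ_{ξ,n}(K)`, for `n ≥ 1`. -/
def theta (ξ : Ordinal.{v}) (n : ℕ) (K : Set (WeakDual 𝕜 X)) : ℝ :=
  sInf {θ : ℝ | 0 < θ ∧
    ∀ (D : Type u) [Preorder D] [IsDirectedOrder D] [Nonempty D]
      (x : List (Ordinal.{v} × D) → X),
      (∀ t ∈ prodTree (Gam ξ n) D, ‖x t‖ ≤ 1) → IsWeaklyNull 𝕜 (Gam ξ n) x →
        treeInf K ξ n x (fun _ => (1 / n : 𝕜)) ≤ θ}

/-! ### The Szlenk index -/

/-- `s_ε(K)`: the set of those `f ∈ K` such that `diam (V ∩ K) > ε` (in the norm of the dual)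
for every weak* neighbourhood `V` of `f`. -/
def szDeriv (ε : ℝ) (K : Set (WeakDual 𝕜 X)) : Set (WeakDual 𝕜 X) :=
  {f | f ∈ K ∧ ∀ V ∈ 𝓝 f,
    ENNReal.ofReal ε < Metric.ediam (WeakDual.toStrongDual '' (V ∩ K) : Set (StrongDual 𝕜 X))}

/-- The transfinite derivations `s_ε^ξ(K)`. -/
def szDerivIter (ε : ℝ) (K : Set (WeakDual 𝕜 X)) (ξ : Ordinal.{v}) : Set (WeakDual 𝕜 X) :=
  Ordinal.limitRecOn (motive := fun _ => Set (WeakDual 𝕜 X)) ξ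
    K
    (fun _ L => szDeriv ε L)
    (fun η _ ih => ⋂ (ζ : Ordinal.{v}) (h : ζ < η), ih ζ h)

open Classical in
/-- `Sz(K, ε)`: the least `ξ` such that `s_ε^ξ(K) = ∅`, and `∞` if there is no such ordinal. -/
def szEps (K : Set (WeakDual 𝕜 X)) (ε : ℝ) : WithTop Ordinal.{v} :=
  if ∃ ξ : Ordinal.{v}, szDerivIter ε K ξ = ∅ then
    ((sInf {ξ : Ordinal.{v} | szDerivIter ε K ξ = ∅} : Ordinal.{v}) : WithTop Ordinal.{v})
  else ⊤

/-- The Szlenk index `Sz(K) = sup_{ε > 0} Sz(K, ε)`. -/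
def Sz (K : Set (WeakDual 𝕜 X)) : WithTop Ordinal.{v} :=
  ⨆ (ε : ℝ) (_ : 0 < ε), szEps K ε

end

end SzlenkSum

end

/-!
For coefficients `a₁, …, aₙ`, the infimum over the maximal branches of `r_K(∑ aᵢ zᵢ)`, optimised
over all weakly null collections in the ball, is the value of an infinite game, and this value can
be written as `S_{|a₁|} ⋯ S_{|aₙ|} r_K (0)` for operators `S_a = op ξ a` on Lipschitz functions. The
operator `op 0 a` sends `g` to the upper limit of `g (x + a y)` as the vector `y` of the ball tends
weakly to `0`; at a successor one takes the infimum over all subdivisions of `a` into equal parts,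
and at a limit the infimum over the smaller ordinals.

These operators satisfy `S_a S_b ≤ S_{a + b}`. Grouping consecutive coefficients whose size is at
most `η` therefore compares an arbitrary combination with one whose `m + 1` coefficients are equal,
up to an error of order `η m`. Together with Hölder's inequality this bounds `α_{ξ,p,n}(K)` by
`n^{1/q} θ_{ξ,m}(K) + O(m)`, and dividing by `n^{1/q}` gives the formula for the infimum of the
`θ_{ξ,n}(K)`.

For the Szlenk index, a functional in the derived set of order `ω^ξ` gains at least `a ε / 4` under
`S_a`, since two functionals near it that are far apart are separated by a weakly null half
difference. Conversely each application of `S_a` costs at most `a ε`, unless one passes to the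
derived set of order `ω^ξ`, when it costs `a R`; if finitely many such derivations exhaust `K`, the
cost of `N` equal steps of total length `1` is `ε + O(1 / N)`.
-/

noncomputable section

namespace SzlenkSum

open Filter
open scoped NNReal

/-! ### Step operators on Lipschitz functions -/

section StepOperators

variable {X : Type u} [PseudoMetricSpace X] {R : ℝ≥0} {S : ℝ≥0 → (X → ℝ) → X → ℝ}

/-- The properties shared by the operators `S a` which turn the payoff `g` of a game into the value
of the game in which a position is first moved by a distance at most `a`. -/
structure IsStepOperator (R : ℝ≥0) (S : ℝ≥0 → (X → ℝ) → X → ℝ) : Prop where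
  lipschitz : ∀ (a : ℝ≥0) {g : X → ℝ}, LipschitzWith R g → LipschitzWith R (S a g)
  self_le : ∀ (a : ℝ≥0) {g : X → ℝ}, LipschitzWith R g → ∀ x, g x ≤ S a g x
  mono_add : ∀ (a : ℝ≥0) {g h : X → ℝ} {c : ℝ}, LipschitzWith R g → LipschitzWith R h →
    (∀ x, g x ≤ h x + c) → ∀ x, S a g x ≤ S a h x + c
  le_add_dist : ∀ (a b : ℝ≥0) {g : X → ℝ}, LipschitzWith R g → ∀ x,
    S a g x ≤ S b g x + R * dist a b

/-- A step operator for which two successive steps are worth at most one step of the total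
length. -/
structure IsSubadditiveStepOperator (R : ℝ≥0) (S : ℝ≥0 → (X → ℝ) → X → ℝ) : Prop
    extends IsStepOperator R S where
  comp_le : ∀ (a b : ℝ≥0) {g : X → ℝ}, LipschitzWith R g → ∀ x, S a (S b g) x ≤ S (a + b) g x

/-- The game of `n + 1` successive steps of the same length, of total length `a`. -/
def subdivide (S : ℝ≥0 → (X → ℝ) → X → ℝ) (n : ℕ) (a : ℝ≥0) (g : X → ℝ) : X → ℝ :=
  (List.replicate (n + 1) (a / (n + 1))).foldr S g

/-- The game in which the number of steps of a subdivision is chosen first; it leads from the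
operator of a tree `Γ_{ξ,1}` to that of `Γ_{ξ+1,1}`. -/
def succOp (S : ℝ≥0 → (X → ℝ) → X → ℝ) (a : ℝ≥0) (g : X → ℝ) (x : X) : ℝ :=
  ⨅ n : ℕ, subdivide S n a g x

namespace IsStepOperator

theorem mono (hS : IsStepOperator R S) (a : ℝ≥0) {g h : X → ℝ} (hg : LipschitzWith R g)
    (hh : LipschitzWith R h) (H : ∀ x, g x ≤ h x) (x : X) : S a g x ≤ S a h x := by
  simpa using hS.mono_add a (c := 0) hg hh (by simpa using H) x

theorem le_add_of_dist_le (hS : IsStepOperator R S) {a b η : ℝ≥0} (hab : dist a b ≤ η)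
    {g : X → ℝ} (hg : LipschitzWith R g) (x : X) : S a g x ≤ S b g x + R * η :=
  (hS.le_add_dist a b hg x).trans (by gcongr)

theorem lipschitz_foldr (hS : IsStepOperator R S) (l : List ℝ≥0) {g : X → ℝ}
    (hg : LipschitzWith R g) : LipschitzWith R (l.foldr S g) := by
  induction l with
  | nil => exact hg
  | cons a l ih => exact hS.lipschitz a ih

theorem self_le_foldr (hS : IsStepOperator R S) (l : List ℝ≥0) {g : X → ℝ}
    (hg : LipschitzWith R g) (x : X) : g x ≤ l.foldr S g x := by
  induction l generalizing x with
  | nil => exact le_rfl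
  | cons a l ih => exact (ih x).trans (hS.self_le a (hS.lipschitz_foldr l hg) x)

theorem foldr_mono_add (hS : IsStepOperator R S) (l : List ℝ≥0) {g h : X → ℝ} {c : ℝ}
    (hg : LipschitzWith R g) (hh : LipschitzWith R h) (H : ∀ x, g x ≤ h x + c) (x : X) :
    l.foldr S g x ≤ l.foldr S h x + c := by
  induction l generalizing x with
  | nil => exact H x
  | cons a l ih => exact hS.mono_add a (hS.lipschitz_foldr l hg) (hS.lipschitz_foldr l hh) ih x

theorem foldr_replicate_le_add_dist (hS : IsStepOperator R S) (n : ℕ) (a b : ℝ≥0) {g : X → ℝ}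
    (hg : LipschitzWith R g) (x : X) :
    (List.replicate n a).foldr S g x ≤
      (List.replicate n b).foldr S g x + n * (R * dist a b) := by
  induction n generalizing x with
  | zero => simp
  | succ n ih =>
    have rest := hS.mono_add a (hS.lipschitz_foldr _ hg) (hS.lipschitz_foldr _ hg) ih x
    have first := hS.le_add_dist a b (hS.lipschitz_foldr (List.replicate n b) hg) x
    simp only [List.replicate_succ, List.foldr_cons]
    push_cast
    linarith

theorem subdivide (hS : IsStepOperator R S) (n : ℕ) : IsStepOperator R (subdivide S n) where
  lipschitz _ _ hg := hS.lipschitz_foldr _ hg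
  self_le _ _ hg := hS.self_le_foldr _ hg
  mono_add _ _ _ _ hg hh := hS.foldr_mono_add _ hg hh
  le_add_dist a b g hg x := by
    refine (hS.foldr_replicate_le_add_dist (n + 1) _ (b / (n + 1)) hg x).trans_eq ?_
    have dist_div : dist (a / (n + 1)) (b / (n + 1)) = dist a b / (n + 1) := by
      simp only [NNReal.dist_eq, NNReal.coe_div, NNReal.coe_add, NNReal.coe_natCast,
        NNReal.coe_one, ← sub_div, abs_div, abs_of_pos (show (0 : ℝ) < n + 1 by positivity)]
    rw [dist_div, SzlenkSum.subdivide]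
    push_cast
    field_simp

theorem iInf_le {ι : Type*} {S : ι → ℝ≥0 → (X → ℝ) → X → ℝ} (hS : ∀ i, IsStepOperator R (S i))
    (a : ℝ≥0) {g : X → ℝ} (hg : LipschitzWith R g) (x : X) (i : ι) :
    ⨅ i, S i a g x ≤ S i a g x :=
  ciInf_le ⟨g x, by rintro _ ⟨j, rfl⟩; exact (hS j).self_le a hg x⟩ i

theorem iInf {ι : Type*} [Nonempty ι] {S : ι → ℝ≥0 → (X → ℝ) → X → ℝ}
    (hS : ∀ i, IsStepOperator R (S i)) : IsStepOperator R fun a g x => ⨅ i, S i a g x where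
  lipschitz a g hg := .of_le_add_mul R fun x y => by
    refine sub_le_iff_le_add.1 (le_ciInf fun i => ?_)
    linarith [iInf_le hS a hg x i, ((hS i).lipschitz a hg).le_add_mul x y]
  self_le a g hg x := le_ciInf fun i => (hS i).self_le a hg x
  mono_add a g h c hg hh H x := by
    refine sub_le_iff_le_add.1 (le_ciInf fun i => ?_)
    linarith [iInf_le hS a hg x i, (hS i).mono_add a hg hh H x]
  le_add_dist a b g hg x := by
    refine sub_le_iff_le_add.1 (le_ciInf fun i => ?_)
    linarith [iInf_le hS a hg x i, (hS i).le_add_dist a b hg x]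

theorem succOp (hS : IsStepOperator R S) : IsStepOperator R (succOp S) :=
  iInf hS.subdivide

theorem succOp_le_subdivide (hS : IsStepOperator R S) (n : ℕ) (a : ℝ≥0) {g : X → ℝ}
    (hg : LipschitzWith R g) (x : X) : SzlenkSum.succOp S a g x ≤ SzlenkSum.subdivide S n a g x :=
  iInf_le hS.subdivide a hg x n

end IsStepOperator

theorem exists_append_sum_le_le_add {M : Type*} [AddCommMonoid M] [LinearOrder M]
    [IsOrderedCancelAddMonoid M] [CanonicallyOrderedAdd M] {η : M} {l : List M}
    (hl : ∀ a ∈ l, a ≤ η) {b : M} (hb : b ≤ l.sum) :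
    ∃ l₁ l₂ : List M, l = l₁ ++ l₂ ∧ l₁.sum ≤ b ∧ b ≤ l₁.sum + η := by
  induction l generalizing b with
  | nil => exact ⟨[], [], rfl, by simp, hb.trans le_self_add⟩
  | cons a l ih =>
    rw [List.sum_cons] at hb
    rcases le_or_gt a b with hab | hba
    · obtain ⟨c, rfl⟩ := exists_add_of_le hab
      obtain ⟨l₁, l₂, rfl, h₁, h₂⟩ := ih (fun d hd => hl d (List.mem_cons_of_mem _ hd))
        (le_of_add_le_add_left hb)
      exact ⟨a :: l₁, l₂, rfl, by simpa using h₁, by simpa [add_assoc] using h₂⟩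
    · exact ⟨[], a :: l, rfl, by simp, by simpa using hba.le.trans (hl a List.mem_cons_self)⟩

namespace IsSubadditiveStepOperator

theorem foldr_le_sum (hS : IsSubadditiveStepOperator R S) (l : List ℝ≥0) {g : X → ℝ}
    (hg : LipschitzWith R g) (x : X) : l.foldr S g x ≤ S l.sum g x := by
  induction l generalizing x with
  | nil => exact hS.self_le 0 hg x
  | cons a l ih =>
    rw [List.foldr_cons, List.sum_cons]
    exact (hS.mono a (hS.lipschitz_foldr l hg) (hS.lipschitz _ hg) ih x).trans
      (hS.comp_le a l.sum hg x)

/-- Greedily grouping short steps into steps of prescribed lengths `b :: bs`: each of the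
boundaries between two groups is missed by at most `η`, and this affects both of its sides. -/
theorem foldr_le_foldr_add (hS : IsSubadditiveStepOperator R S) {η : ℝ≥0} {g : X → ℝ}
    (hg : LipschitzWith R g) (b : ℝ≥0) (bs l : List ℝ≥0) (hl : ∀ a ∈ l, a ≤ η)
    (hsum : l.sum = (b :: bs).sum) (x : X) :
    l.foldr S g x ≤ (b :: bs).foldr S g x + 2 * R * η * bs.length := by
  induction bs generalizing b l x with
  | nil => simpa [hsum] using hS.foldr_le_sum l hg x
  | cons b' bs ih =>
    have hb : b ≤ l.sum := by simp [hsum]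
    obtain ⟨l₁, l₂, rfl, h₁, h₂⟩ := exists_append_sum_le_le_add hl hb
    obtain ⟨c, rfl⟩ := exists_add_of_le h₁
    have hc : c ≤ η := le_of_add_le_add_left h₂
    have hsum₂ : l₂.sum = ((c + b') :: bs).sum := by
      simpa [List.sum_append, add_assoc] using hsum
    have hg₂ := hS.lipschitz_foldr l₂ hg
    have hgbs := hS.lipschitz_foldr bs hg
    have tail_le (y : X) : l₂.foldr S g y ≤
        S b' (bs.foldr S g) y + (R * η + 2 * R * η * bs.length) := by
      have grouped := ih (c + b') l₂ (fun a ha => hl a (by simp [ha])) hsum₂ y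
      have moved := hS.le_add_of_dist_le (a := c + b') (b := b') (η := η)
        (by simpa [NNReal.dist_eq] using hc) hgbs y
      rw [List.foldr_cons] at grouped
      linarith
    calc (l₁ ++ l₂).foldr S g x = l₁.foldr S (l₂.foldr S g) x := by rw [List.foldr_append]
      _ ≤ S l₁.sum (l₂.foldr S g) x := hS.foldr_le_sum l₁ hg₂ x
      _ ≤ S l₁.sum (S b' (bs.foldr S g)) x + (R * η + 2 * R * η * bs.length) :=
        hS.mono_add _ hg₂ (hS.lipschitz b' hgbs) tail_le x
      _ ≤ S (l₁.sum + c) (S b' (bs.foldr S g)) x + R * η + (R * η + 2 * R * η * bs.length) := by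
        gcongr
        exact hS.le_add_of_dist_le (by simpa [NNReal.dist_eq] using hc) (hS.lipschitz b' hgbs) x
      _ = _ := by
        simp only [List.foldr_cons, List.length_cons]
        push_cast
        ring

theorem foldr_le_subdivide_add (hS : IsSubadditiveStepOperator R S) {η : ℝ≥0} {g : X → ℝ}
    (hg : LipschitzWith R g) {l : List ℝ≥0} (hl : ∀ a ∈ l, a ≤ η) (n : ℕ) (x : X) :
    l.foldr S g x ≤ subdivide S n l.sum g x + 2 * R * η * n := by
  have hsum : l.sum = (l.sum / (n + 1) :: List.replicate n (l.sum / (n + 1))).sum := by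
    rw [← List.replicate_succ, List.sum_replicate, nsmul_eq_mul, Nat.cast_succ,
      mul_div_cancel₀ _ (by positivity)]
  simpa [subdivide, List.replicate_succ] using hS.foldr_le_foldr_add hg _ _ l hl hsum x

theorem succOp_comp_le (hS : IsSubadditiveStepOperator R S) (a b : ℝ≥0) {g : X → ℝ}
    (hg : LipschitzWith R g) (x : X) :
    succOp S a (succOp S b g) x ≤ succOp S (a + b) g x := by
  refine le_ciInf fun n => ?_
  have bound (N : ℕ) : succOp S a (succOp S b g) x ≤
      subdivide S n (a + b) g x + 2 * R * (max a b / (N + 1) : ℝ≥0) * n := by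
    set l := List.replicate (N + 1) (a / (N + 1)) ++ List.replicate (N + 1) (b / (N + 1)) with hl
    have le_mesh : ∀ c ∈ l, c ≤ max a b / (N + 1) := by
      intro c hc
      rcases List.mem_append.1 hc with hc | hc <;> rw [List.eq_of_mem_replicate hc] <;> gcongr
      exacts [le_max_left _ _, le_max_right _ _]
    have hsum : l.sum = a + b := by
      simp only [hl, List.sum_append, List.sum_replicate, nsmul_eq_mul, Nat.cast_succ]
      rw [mul_div_cancel₀ _ (by positivity), mul_div_cancel₀ _ (by positivity)]
    have hSN := hS.subdivide N
    calc succOp S a (succOp S b g) x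
        ≤ subdivide S N a (succOp S b g) x :=
          hS.succOp_le_subdivide N a (hS.succOp.lipschitz b hg) x
      _ ≤ subdivide S N a (subdivide S N b g) x :=
          hSN.mono a (hS.succOp.lipschitz b hg) (hSN.lipschitz b hg)
            (hS.succOp_le_subdivide N b hg) x
      _ = l.foldr S g x := by rw [hl, List.foldr_append]; rfl
      _ ≤ _ := hsum ▸ hS.foldr_le_subdivide_add hg le_mesh n x
  have mesh_tendsto : Tendsto (fun N : ℕ => subdivide S n (a + b) g x +
      2 * R * (max a b / (N + 1) : ℝ≥0) * n) atTop (𝓝 (subdivide S n (a + b) g x)) := by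
    have := tendsto_one_div_add_atTop_nhds_zero_nat.const_mul (2 * (R : ℝ) * (max a b : ℝ≥0) * n)
    simpa [div_eq_mul_inv, mul_assoc, mul_comm, mul_left_comm] using
      this.const_add (subdivide S n (a + b) g x)
  exact ge_of_tendsto' mesh_tendsto bound

theorem succOp (hS : IsSubadditiveStepOperator R S) : IsSubadditiveStepOperator R (succOp S) where
  toIsStepOperator := hS.toIsStepOperator.succOp
  comp_le _ _ _ hg := hS.succOp_comp_le _ _ hg

theorem iInf {ι : Type*} [Nonempty ι] {S : ι → ℝ≥0 → (X → ℝ) → X → ℝ}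
    (hS : ∀ i, IsSubadditiveStepOperator R (S i)) :
    IsSubadditiveStepOperator R fun a g x => ⨅ i, S i a g x where
  toIsStepOperator := .iInf fun i => (hS i).toIsStepOperator
  comp_le a b g hg x := by
    have hS' i := (hS i).toIsStepOperator
    have hInf := (IsStepOperator.iInf hS').lipschitz b hg
    exact le_ciInf fun i =>
      calc ⨅ i, S i a (fun y => ⨅ j, S j b g y) x
          ≤ S i a (fun y => ⨅ j, S j b g y) x := IsStepOperator.iInf_le hS' a hInf x i
        _ ≤ S i a (S i b g) x := (hS i).mono a hInf ((hS i).lipschitz b hg)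
          (fun y => IsStepOperator.iInf_le hS' b hg y i) x
        _ ≤ S i (a + b) g x := (hS i).comp_le a b hg x

end IsSubadditiveStepOperator

end StepOperators

/-! ### The operators attached to the trees -/

section Game

variable (𝕜 : Type w) [RCLike 𝕜] (X : Type u) [NormedAddCommGroup X] [NormedSpace 𝕜 X]

/-- The filter of weak neighbourhoods of `0` in the unit ball: a net in the unit ball is weakly null
if and only if it converges to this filter. -/
def ballFilter : Filter X :=
  (⨅ f : StrongDual 𝕜 X, comap f (𝓝 0)) ⊓ 𝓟 (Metric.closedBall 0 1)

variable {X}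

/-- The operator attached to the game in which `y` is chosen in the unit ball and arbitrarily close
to `0` in the weak topology, and the position is moved by `a • y`. -/
def baseOp (a : ℝ≥0) (g : X → ℝ) (x : X) : ℝ :=
  limsup (fun y => g (x + ((a : ℝ) : 𝕜) • y)) (ballFilter 𝕜 X)

/-- The operator giving the value of the game on `Γ_{ξ,1}`. -/
def op (ξ : Ordinal.{v}) : ℝ≥0 → (X → ℝ) → X → ℝ :=
  Ordinal.limitRecOn (motive := fun _ => ℝ≥0 → (X → ℝ) → X → ℝ) ξ
    (baseOp 𝕜) (fun _ S => succOp S)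
    (fun ξ hξ ih a g x => ⨅ ζ : Set.Iio ξ, ih (ζ.1 + 1) (hξ.add_one_lt ζ.2) a g x)

theorem tendsto_ballFilter {ι : Type*} {l : Filter ι} {φ : ι → X} :
    Tendsto φ l (ballFilter 𝕜 X) ↔
      (∀ f : StrongDual 𝕜 X, Tendsto (fun i => f (φ i)) l (𝓝 0)) ∧ ∀ᶠ i in l, ‖φ i‖ ≤ 1 := by
  simp [ballFilter, tendsto_inf, tendsto_iInf, tendsto_comap_iff, Function.comp_def]

theorem tendsto_ballFilter_apply (f : StrongDual 𝕜 X) : Tendsto f (ballFilter 𝕜 X) (𝓝 0) :=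
  ((tendsto_ballFilter 𝕜).1 tendsto_id).1 f

theorem eventually_ballFilter_norm_le : ∀ᶠ y in ballFilter 𝕜 X, ‖y‖ ≤ 1 :=
  ((tendsto_ballFilter 𝕜).1 tendsto_id).2

theorem pure_zero_le_ballFilter : pure (0 : X) ≤ ballFilter 𝕜 X :=
  tendsto_id'.1 <| (tendsto_ballFilter 𝕜).2
    ⟨fun f => by simpa only [id, map_zero] using tendsto_pure_nhds f (0 : X), by simp⟩

instance : (ballFilter 𝕜 X).NeBot :=
  neBot_of_le (pure_zero_le_ballFilter 𝕜)

theorem tendsto_convexComb_ballFilter {a b : ℝ} (ha : 0 ≤ a) (hb : 0 ≤ b) (hab : a + b = 1) :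
    Tendsto (fun y : X × X => (a : 𝕜) • y.1 + (b : 𝕜) • y.2)
      (ballFilter 𝕜 X ×ˢ ballFilter 𝕜 X) (ballFilter 𝕜 X) := by
  refine (tendsto_ballFilter 𝕜).2 ⟨fun f => ?_, ?_⟩
  · have h₁ := ((tendsto_ballFilter_apply 𝕜 f).comp
      (tendsto_fst (g := ballFilter 𝕜 X))).const_mul (a : 𝕜)
    have h₂ := ((tendsto_ballFilter_apply 𝕜 f).comp
      (tendsto_snd (f := ballFilter 𝕜 X))).const_mul (b : 𝕜)
    simpa using h₁.add h₂
  · filter_upwards [(eventually_ballFilter_norm_le 𝕜).prod_mk (eventually_ballFilter_norm_le 𝕜)]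
      with y ⟨h₁, h₂⟩
    calc ‖(a : 𝕜) • y.1 + (b : 𝕜) • y.2‖ ≤ a * ‖y.1‖ + b * ‖y.2‖ := by
          simpa [norm_smul, abs_of_nonneg ha, abs_of_nonneg hb] using
            norm_add_le ((a : 𝕜) • y.1) ((b : 𝕜) • y.2)
      _ ≤ a * 1 + b * 1 := by gcongr
      _ = 1 := by rw [mul_one, mul_one, hab]

variable {𝕜} {R : ℝ≥0}

theorem eventually_dist_apply_add_smul_le {g : X → ℝ} (hg : LipschitzWith R g) (a : ℝ≥0) (x : X) :
    ∀ᶠ y in ballFilter 𝕜 X, dist (g (x + ((a : ℝ) : 𝕜) • y)) (g x) ≤ R * a := by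
  filter_upwards [eventually_ballFilter_norm_le 𝕜] with y hy
  refine hg.dist_le_mul_of_le ?_
  simpa [norm_smul] using mul_le_of_le_one_right a.2 hy

theorem baseOp_le_iff {g : X → ℝ} (hg : LipschitzWith R g) {a : ℝ≥0} {x : X} {c : ℝ} :
    baseOp 𝕜 a g x ≤ c ↔ ∀ c' > c, ∀ᶠ y in ballFilter 𝕜 X, g (x + ((a : ℝ) : 𝕜) • y) < c' := by
  have near := (eventually_dist_apply_add_smul_le (𝕜 := 𝕜) hg a x).mono fun y hy =>
    abs_sub_le_iff.1 (Real.dist_eq _ _ ▸ hy)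
  refine limsup_le_iff (IsCoboundedUnder.of_frequently_ge (a := g x - R * a)
    (near.mono fun y hy => ?_).frequently) (isBoundedUnder_of_eventually_le (a := g x + R * a)
    (near.mono fun y hy => ?_))
  · linarith [hy.2]
  · linarith [hy.1]

theorem eventually_lt_of_baseOp_lt {g : X → ℝ} (hg : LipschitzWith R g) {a : ℝ≥0} {x : X} {c : ℝ}
    (h : baseOp 𝕜 a g x < c) : ∀ᶠ y in ballFilter 𝕜 X, g (x + ((a : ℝ) : 𝕜) • y) < c :=
  (baseOp_le_iff hg).1 le_rfl c h

theorem frequently_lt_of_lt_baseOp {g : X → ℝ} (hg : LipschitzWith R g) {a : ℝ≥0} {x : X} {c : ℝ}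
    (h : c < baseOp 𝕜 a g x) : ∃ᶠ y in ballFilter 𝕜 X, c < g (x + ((a : ℝ) : 𝕜) • y) := by
  refine fun hle => h.not_ge ((baseOp_le_iff hg).2 fun c' hc' => hle.mono fun y hy => ?_)
  exact (not_lt.1 hy).trans_lt hc'

theorem baseOp_le_baseOp_add {g h : X → ℝ} (hg : LipschitzWith R g) (hh : LipschitzWith R h)
    {a b : ℝ≥0} {x x' : X} {c : ℝ} (H : ∀ᶠ y in ballFilter 𝕜 X,
      g (x + ((a : ℝ) : 𝕜) • y) ≤ h (x' + ((b : ℝ) : 𝕜) • y) + c) :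
    baseOp 𝕜 a g x ≤ baseOp 𝕜 b h x' + c := by
  refine (baseOp_le_iff hg).2 fun c' hc' => ?_
  filter_upwards [H, eventually_lt_of_baseOp_lt hh (lt_sub_iff_add_lt.2 hc')] with y hy hy'
  linarith

theorem isStepOperator_baseOp : IsStepOperator R (baseOp 𝕜 (X := X)) where
  lipschitz a g hg := .of_le_add_mul R fun x y => baseOp_le_baseOp_add hg hg <| .of_forall fun z =>
    by simpa using hg.le_add_mul (x + ((a : ℝ) : 𝕜) • z) (y + ((a : ℝ) : 𝕜) • z)
  self_le a g hg x := le_of_forall_gt_imp_ge_of_dense fun c hc => by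
    have at_zero : g (x + ((a : ℝ) : 𝕜) • (0 : X)) < c :=
      pure_zero_le_ballFilter 𝕜 (eventually_lt_of_baseOp_lt hg hc)
    simpa using at_zero.le
  mono_add a g h c hg hh H x := baseOp_le_baseOp_add hg hh (.of_forall fun y => H _)
  le_add_dist a b g hg x := by
    refine baseOp_le_baseOp_add hg hg ?_
    filter_upwards [eventually_ballFilter_norm_le 𝕜] with y hy
    refine (hg.le_add_mul _ (x + ((b : ℝ) : 𝕜) • y)).trans ?_
    gcongr
    rw [dist_add_left, dist_eq_norm, ← sub_smul, norm_smul, ← RCLike.ofReal_sub,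
      RCLike.norm_ofReal]
    exact mul_le_of_le_one_right (abs_nonneg _) hy

theorem baseOp_zero (g : X → ℝ) (x : X) : baseOp 𝕜 0 g x = g x := by
  simp [baseOp]

/-- Moving by `a • y` and then by `b • z` is moving by `a + b` times a convex combination of `y` and
`z`, which again is in the unit ball and close to `0`. -/
theorem isSubadditiveStepOperator_baseOp : IsSubadditiveStepOperator R (baseOp 𝕜 (X := X)) where
  toIsStepOperator := isStepOperator_baseOp
  comp_le a b g hg x := by
    have hbg := isStepOperator_baseOp.lipschitz (S := baseOp 𝕜 (X := X)) b hg
    rcases eq_or_ne (a + b) 0 with h0 | h0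
    · obtain ⟨rfl, rfl⟩ := add_eq_zero.1 h0
      rw [baseOp_zero, add_zero]
    have hpos : (0 : ℝ) < a + b := by exact_mod_cast h0.bot_lt
    refine le_of_forall_gt_imp_ge_of_dense fun c hc => (baseOp_le_iff hbg).2 fun c₂ hc₂ => ?_
    have convexComb_lt := ((tendsto_convexComb_ballFilter 𝕜 (X := X) (a := a / (a + b))
      (b := b / (a + b)) (by positivity) (by positivity) (by field_simp)).eventually
      (eventually_lt_of_baseOp_lt hg hc)).curry
    filter_upwards [convexComb_lt] with y hy
    refine ((baseOp_le_iff hg).2 fun c₁ hc₁ => ?_ : baseOp 𝕜 b g _ ≤ c).trans_lt hc₂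
    filter_upwards [hy] with z hz
    rw [smul_add, smul_smul, smul_smul, ← RCLike.ofReal_mul, ← RCLike.ofReal_mul, NNReal.coe_add,
      mul_div_cancel₀ _ hpos.ne', mul_div_cancel₀ _ hpos.ne', ← add_assoc] at hz
    exact hz.trans hc₁

variable (𝕜)

theorem op_zero : op 𝕜 (0 : Ordinal.{v}) = baseOp 𝕜 (X := X) := by
  simp [op]

theorem op_add_one (ξ : Ordinal.{v}) : op 𝕜 (ξ + 1) = succOp (op 𝕜 ξ (X := X)) := by
  simp [op]

theorem op_limit {ξ : Ordinal.{v}} (hξ : Order.IsSuccLimit ξ) :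
    op 𝕜 ξ (X := X) = fun a g x => ⨅ ζ : Set.Iio ξ, op 𝕜 (ζ.1 + 1) a g x := by
  rw [op, Ordinal.limitRecOn_limit _ _ _ _ hξ]
  rfl

theorem isSubadditiveStepOperator_op (ξ : Ordinal.{v}) :
    IsSubadditiveStepOperator R (op 𝕜 ξ (X := X)) := by
  induction ξ using Ordinal.limitRecOn with
  | zero => rw [op_zero]; exact isSubadditiveStepOperator_baseOp
  | add_one ξ ih => rw [op_add_one]; exact ih.succOp
  | limit ξ hξ ih =>
    rw [op_limit 𝕜 hξ]
    have : Nonempty (Set.Iio ξ) := ⟨⟨0, hξ.bot_lt⟩⟩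
    exact .iInf fun ζ => ih _ (hξ.add_one_lt ζ.2)

theorem isStepOperator_op (ξ : Ordinal.{v}) : IsStepOperator R (op 𝕜 ξ (X := X)) :=
  (isSubadditiveStepOperator_op 𝕜 ξ).toIsStepOperator

theorem op_limit_le {ξ ζ : Ordinal.{v}} (hξ : Order.IsSuccLimit ξ) (hζ : ζ < ξ) (a : ℝ≥0)
    {g : X → ℝ} (hg : LipschitzWith R g) (x : X) : op 𝕜 ξ a g x ≤ op 𝕜 (ζ + 1) a g x := by
  rw [op_limit 𝕜 hξ]
  exact IsStepOperator.iInf_le (fun η : Set.Iio ξ => isStepOperator_op 𝕜 (η.1 + 1)) a hg x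
    ⟨ζ, hζ⟩

end Game

/-! ### Support functions and Szlenk derivations -/

section Szlenk

variable {𝕜 : Type w} [RCLike 𝕜] {X : Type u} [NormedAddCommGroup X] [NormedSpace 𝕜 X] {R : ℝ≥0}

/-- All members of `L` have norm at most `R`. -/
def DualBdd (R : ℝ≥0) (L : Set (WeakDual 𝕜 X)) : Prop :=
  ∀ f ∈ L, ‖WeakDual.toStrongDual f‖ ≤ R

theorem exists_pos_dualBdd [CompleteSpace X] {K : Set (WeakDual 𝕜 X)} (hK : IsCompact K) :
    ∃ R : ℝ≥0, 0 < R ∧ DualBdd R K := by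
  have bounded : Bornology.IsBounded (WeakDual.toStrongDual '' K) := by
    rw [← WeakDual.isBounded_toStrongDual_preimage_iff_isBounded,
      Set.preimage_image_eq _ (LinearEquiv.injective _)]
    exact WeakDual.isBounded_iff_isVonNBounded.2 (hK.isVonNBounded 𝕜)
  obtain ⟨R, hR, hbound⟩ := bounded.exists_pos_norm_le
  exact ⟨⟨R, hR.le⟩, hR, fun f hf => hbound _ ⟨f, hf, rfl⟩⟩

namespace DualBdd

variable {L L' : Set (WeakDual 𝕜 X)}

theorem mono (h : DualBdd R L) (hL : L' ⊆ L) : DualBdd R L' :=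
  fun f hf => h f (hL hf)

theorem re_apply_le (h : DualBdd R L) {f : WeakDual 𝕜 X} (hf : f ∈ L) (x : X) :
    RCLike.re (f x) ≤ R * ‖x‖ :=
  (RCLike.re_le_norm _).trans ((WeakDual.toStrongDual f).le_of_opNorm_le (h f hf) x)

theorem re_le_supportFun (h : DualBdd R L) {f : WeakDual 𝕜 X} (hf : f ∈ L) (x : X) :
    RCLike.re (f x) ≤ supportFun L x := by
  refine le_csSup ⟨R * ‖x‖, ?_⟩ ⟨f, hf, rfl⟩
  rintro _ ⟨g, hg, rfl⟩
  exact h.re_apply_le hg x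

end DualBdd

theorem supportFun_empty (x : X) : supportFun (∅ : Set (WeakDual 𝕜 X)) x = 0 := by
  simp [supportFun]

theorem supportFun_le {L : Set (WeakDual 𝕜 X)} (hL : L.Nonempty) {x : X} {M : ℝ}
    (h : ∀ f ∈ L, RCLike.re (f x) ≤ M) : supportFun L x ≤ M :=
  csSup_le (hL.image _) (Set.forall_mem_image.2 h)

theorem DualBdd.lipschitzWith_supportFun {L : Set (WeakDual 𝕜 X)} (h : DualBdd R L) :
    LipschitzWith R (supportFun L) := by
  refine .of_le_add_mul R fun x y => ?_
  rcases L.eq_empty_or_nonempty with rfl | hL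
  · rw [supportFun_empty, supportFun_empty]
    positivity
  refine supportFun_le hL fun f hf => ?_
  have diff_le := h.re_apply_le hf (x - y)
  rw [map_sub, map_sub, ← dist_eq_norm] at diff_le
  linarith [h.re_le_supportFun hf y]

theorem supportFun_zero (L : Set (WeakDual 𝕜 X)) : supportFun L 0 = 0 := by
  rcases L.eq_empty_or_nonempty with rfl | hL
  · exact supportFun_empty _
  · simp [supportFun, hL.image_const]

theorem supportFun_nnreal_smul (L : Set (WeakDual 𝕜 X)) (a : ℝ≥0) (x : X) :
    supportFun L (((a : ℝ) : 𝕜) • x) = a * supportFun L x := by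
  rw [supportFun, supportFun, ← smul_eq_mul, ← Real.sSup_smul_of_nonneg a.coe_nonneg]
  congr 1
  ext r
  simp [Set.mem_smul_set]

theorem szDeriv_subset (ε : ℝ) (L : Set (WeakDual 𝕜 X)) : szDeriv ε L ⊆ L :=
  fun _ h => h.1

theorem isClosed_szDeriv {ε : ℝ} {L : Set (WeakDual 𝕜 X)} (hL : IsClosed L) :
    IsClosed (szDeriv ε L) := by
  rw [← isOpen_compl_iff, isOpen_iff_mem_nhds]
  intro f hf
  by_cases hfL : f ∈ L
  · simp only [szDeriv, Set.mem_compl_iff, Set.mem_ofPred_eq, hfL, true_and, not_forall] at hf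
    obtain ⟨V, hV, hd⟩ := hf
    filter_upwards [eventually_mem_nhds_iff.2 hV] with g hg hg'
    exact hd (hg'.2 V hg)
  · filter_upwards [hL.isOpen_compl.mem_nhds hfL] with g hg hg'
    exact hg hg'.1

theorem szDerivIter_zero (ε : ℝ) (K : Set (WeakDual 𝕜 X)) :
    szDerivIter ε K (0 : Ordinal.{v}) = K := by
  simp [szDerivIter]

theorem szDerivIter_add_one (ε : ℝ) (K : Set (WeakDual 𝕜 X)) (ξ : Ordinal.{v}) :
    szDerivIter ε K (ξ + 1) = szDeriv ε (szDerivIter ε K ξ) := by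
  simp [szDerivIter]

theorem szDerivIter_limit (ε : ℝ) (K : Set (WeakDual 𝕜 X)) {ξ : Ordinal.{v}}
    (hξ : Order.IsSuccLimit ξ) :
    szDerivIter ε K ξ = ⋂ (ζ : Ordinal.{v}) (_ : ζ < ξ), szDerivIter ε K ζ := by
  rw [szDerivIter, Ordinal.limitRecOn_limit _ _ _ _ hξ]
  rfl

theorem szDerivIter_anti (ε : ℝ) (K : Set (WeakDual 𝕜 X)) {η ξ : Ordinal.{v}} (h : η ≤ ξ) :
    szDerivIter ε K ξ ⊆ szDerivIter ε K η := by
  induction ξ using Ordinal.limitRecOn with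
  | zero => rw [nonpos_iff_eq_zero.1 h]
  | add_one ξ ih =>
    rcases h.lt_or_eq with h | rfl
    · rw [szDerivIter_add_one]
      exact (szDeriv_subset _ _).trans (ih (Order.lt_add_one_iff.1 h))
    · exact subset_rfl
  | limit ξ hξ _ =>
    rcases h.lt_or_eq with h | rfl
    · rw [szDerivIter_limit ε K hξ]
      exact Set.iInter₂_subset η h
    · exact subset_rfl

theorem szDerivIter_subset (ε : ℝ) (K : Set (WeakDual 𝕜 X)) (ξ : Ordinal.{v}) :
    szDerivIter ε K ξ ⊆ K := by
  simpa [szDerivIter_zero] using szDerivIter_anti ε K (zero_le (a := ξ))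

theorem isClosed_szDerivIter {ε : ℝ} {K : Set (WeakDual 𝕜 X)} (hK : IsClosed K)
    (ξ : Ordinal.{v}) : IsClosed (szDerivIter ε K ξ) := by
  induction ξ using Ordinal.limitRecOn with
  | zero => rwa [szDerivIter_zero]
  | add_one ξ ih => rw [szDerivIter_add_one]; exact isClosed_szDeriv ih
  | limit ξ hξ ih =>
    rw [szDerivIter_limit ε K hξ]
    exact isClosed_iInter fun ζ => isClosed_iInter fun hζ => ih ζ hζ

theorem isCompact_szDerivIter {ε : ℝ} {K : Set (WeakDual 𝕜 X)} (hK : IsCompact K)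
    (ξ : Ordinal.{v}) : IsCompact (szDerivIter ε K ξ) :=
  hK.of_isClosed_subset (isClosed_szDerivIter hK.isClosed ξ) (szDerivIter_subset ε K ξ)

theorem szDerivIter_add (ε : ℝ) (K : Set (WeakDual 𝕜 X)) (η ξ : Ordinal.{v}) :
    szDerivIter ε K (η + ξ) = szDerivIter ε (szDerivIter ε K η) ξ := by
  induction ξ using Ordinal.limitRecOn with
  | zero => rw [add_zero, szDerivIter_zero]
  | add_one ξ ih => rw [← add_assoc, szDerivIter_add_one, szDerivIter_add_one, ih]
  | limit ξ hξ ih =>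
    rw [szDerivIter_limit ε K (Ordinal.isSuccLimit_add η hξ), szDerivIter_limit ε _ hξ]
    apply subset_antisymm
    · refine Set.subset_iInter₂ fun ζ hζ => ?_
      rw [← ih ζ hζ]
      exact fun f hf => Set.mem_iInter₂.1 hf (η + ζ) ((add_lt_add_iff_left η).2 hζ)
    · refine Set.subset_iInter₂ fun ζ hζ => ?_
      obtain ⟨ρ, hρ, h⟩ := (Ordinal.lt_add_iff_of_isSuccLimit hξ).1 hζ
      refine (Set.iInter₂_subset ρ hρ).trans ?_
      rw [← ih ρ hρ]
      exact szDerivIter_anti ε K h.le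

theorem exists_lt_forall_szDerivIter_re_lt {ε : ℝ} {K : Set (WeakDual 𝕜 X)} (hK : IsCompact K)
    {ξ : Ordinal.{v}} (hξ : Order.IsSuccLimit ξ) {x : X} {M : ℝ}
    (h : ∀ f ∈ szDerivIter ε K ξ, RCLike.re (f x) < M) :
    ∃ η < ξ, ∀ f ∈ szDerivIter ε K η, RCLike.re (f x) < M := by
  have : Nonempty (Set.Iio ξ) := ⟨⟨0, hξ.bot_lt⟩⟩
  have isClosed_le_re : IsClosed {f : WeakDual 𝕜 X | M ≤ RCLike.re (f x)} :=
    isClosed_le continuous_const (RCLike.continuous_re.comp (WeakDual.eval_continuous x))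
  have inter_eq_empty :
      K ∩ ⋂ η : Set.Iio ξ, szDerivIter ε K η.1 ∩ {f | M ≤ RCLike.re (f x)} = ∅ := by
    refine Set.eq_empty_iff_forall_notMem.2 fun f ⟨_, hf⟩ => ?_
    rw [← Set.iInter_inter] at hf
    refine (h f ?_).not_ge hf.2
    rw [szDerivIter_limit ε K hξ]
    exact Set.mem_iInter₂.2 fun ζ hζ => Set.mem_iInter.1 hf.1 ⟨ζ, hζ⟩
  obtain ⟨η, hη⟩ := hK.elim_directed_family_closed _
    (fun η : Set.Iio ξ => (isClosed_szDerivIter hK.isClosed η.1).inter isClosed_le_re)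
    inter_eq_empty fun η₁ η₂ => ⟨max η₁ η₂,
      Set.inter_subset_inter_left _ (szDerivIter_anti ε K (le_max_left η₁ η₂)),
      Set.inter_subset_inter_left _ (szDerivIter_anti ε K (le_max_right η₁ η₂))⟩
  refine ⟨η, η.2, fun f hf => not_le.1 fun hM => ?_⟩
  exact Set.eq_empty_iff_forall_notMem.1 hη f ⟨szDerivIter_subset ε K η hf, hf, hM⟩

theorem exists_lt_szDerivIter_eq_empty {ε : ℝ} {K : Set (WeakDual 𝕜 X)} (hK : IsCompact K)
    {ξ : Ordinal.{v}} (hξ : Order.IsSuccLimit ξ) (h : szDerivIter ε K ξ = ∅) :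
    ∃ η < ξ, szDerivIter ε K η = ∅ := by
  obtain ⟨η, hη, re_lt⟩ := exists_lt_forall_szDerivIter_re_lt (ε := ε) hK hξ (x := 0) (M := 0)
    (by simp [h])
  exact ⟨η, hη, Set.eq_empty_iff_forall_notMem.2 fun f hf => by simpa using re_lt f hf⟩

theorem isSuccLimit_opow_add_one (ξ : Ordinal.{v}) : Order.IsSuccLimit (ω ^ (ξ + 1)) :=
  Ordinal.isSuccLimit_opow_left Ordinal.isSuccLimit_omega0 (by simp)

theorem exists_nat_of_lt_opow_add_one {ξ η : Ordinal.{v}} (h : η < ω ^ (ξ + 1)) :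
    ∃ n : ℕ, η < ω ^ ξ * (n : Ordinal.{v}) := by
  rw [Ordinal.opow_add, Ordinal.opow_one,
    Ordinal.lt_mul_iff_of_isSuccLimit Ordinal.isSuccLimit_omega0] at h
  obtain ⟨c, hc, h⟩ := h
  obtain ⟨n, rfl⟩ := Ordinal.lt_omega0.1 hc
  exact ⟨n, h⟩

theorem opow_mul_natCast_le (ξ : Ordinal.{v}) (n : ℕ) :
    ω ^ ξ * (n : Ordinal.{v}) ≤ ω ^ (ξ + 1) := by
  rw [Ordinal.opow_add, Ordinal.opow_one]
  exact mul_le_mul_right (Ordinal.natCast_lt_omega0 n).le _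

/-! ### The lower estimate of the operators -/

theorem exists_lt_re_apply_of_lt_norm {h : StrongDual 𝕜 X} {r : ℝ} (hr : r < ‖h‖) :
    ∃ y : X, ‖y‖ ≤ 1 ∧ r < RCLike.re (h y) := by
  obtain ⟨x, hx, hrx⟩ := h.exists_lt_apply_of_lt_opNorm hr
  obtain ⟨c, hc, hcx⟩ := RCLike.exists_norm_eq_mul_self (h x)
  refine ⟨c • x, by rw [norm_smul, hc, one_mul]; exact hx.le, ?_⟩
  rwa [map_smul, smul_eq_mul, ← hcx, RCLike.ofReal_re]

theorem tendsto_half_sub_ballFilter {ι : Type*} (U : Ultrafilter ι) {Y : ι → X}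
    (hY : ∀ i, ‖Y i‖ ≤ 1) :
    Tendsto (fun p : ι × ι => ((2⁻¹ : ℝ) : 𝕜) • (Y p.2 - Y p.1))
      ((U : Filter ι) ×ˢ (U : Filter ι)) (ballFilter 𝕜 X) := by
  refine (tendsto_ballFilter 𝕜).2 ⟨fun h => ?_, .of_forall fun p => ?_⟩
  · have mem_ball : ∀ i, h (Y i) ∈ Metric.closedBall (0 : 𝕜) ‖h‖ := fun i => by
      rw [mem_closedBall_zero_iff]
      exact (h.le_opNorm _).trans (mul_le_of_le_one_right (norm_nonneg _) (hY i))
    obtain ⟨z, -, hz⟩ := (isCompact_closedBall (0 : 𝕜) ‖h‖).ultrafilter_le_nhds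
      (U.map fun i => h (Y i)) (tendsto_principal.2 (.of_forall mem_ball))
    have tendsto_z : Tendsto (fun i => h (Y i)) (U : Filter ι) (𝓝 z) := hz
    have tendsto_sub := (tendsto_z.comp (tendsto_snd (f := (U : Filter ι)))).sub
      (tendsto_z.comp (tendsto_fst (g := (U : Filter ι))))
    simpa using tendsto_sub.const_mul ((2⁻¹ : ℝ) : 𝕜)
  · rw [norm_smul, RCLike.norm_ofReal, abs_of_pos (by norm_num)]
    linarith [norm_sub_le (Y p.2) (Y p.1), hY p.1, hY p.2]

theorem neBot_nhds_inf_principal_of_mem_szDeriv {ε : ℝ} {L : Set (WeakDual 𝕜 X)}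
    {f : WeakDual 𝕜 X} (hf : f ∈ szDeriv ε L) :
    (𝓝 f ⊓ 𝓟 {g | g ∈ L ∧ ε / 2 < ‖WeakDual.toStrongDual (g - f)‖}).NeBot := by
  rw [inf_principal_neBot_iff]
  intro V hV
  by_contra! far_empty
  have near : ∀ g ∈ V ∩ L, ‖WeakDual.toStrongDual (g - f)‖ ≤ ε / 2 := fun g hg =>
    not_lt.1 fun hlt => Set.eq_empty_iff_forall_notMem.1 far_empty g ⟨hg.1, hg.2, hlt⟩
  refine (hf.2 V hV).not_ge (Metric.ediam_le ?_)
  rintro _ ⟨g, hg, rfl⟩ _ ⟨g', hg', rfl⟩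
  rw [edist_dist, dist_eq_norm]
  refine ENNReal.ofReal_le_ofReal ?_
  calc ‖WeakDual.toStrongDual g - WeakDual.toStrongDual g'‖
      = ‖WeakDual.toStrongDual (g - f) - WeakDual.toStrongDual (g' - f)‖ := by
        rw [← map_sub, ← map_sub, sub_sub_sub_cancel_right]
    _ ≤ ε / 2 + ε / 2 := (norm_sub_le _ _).trans (add_le_add (near g hg) (near g' hg'))
    _ = ε := add_halves ε

/-- The witness is half the difference of two vectors that almost norm `g - f` and `g' - f` for
members `g` and `g'` of `L` far from `f`: along an ultrafilter converging to `f` it is weakly null,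
and if `g` is chosen after `g'` then `g` is close to `f` at the vector belonging to `g'`. -/
theorem frequently_exists_lt_re_apply {ε : ℝ} {L : Set (WeakDual 𝕜 X)} {f : WeakDual 𝕜 X}
    (hf : f ∈ szDeriv ε L) (x : X) {δ : ℝ} (hδ : 0 < δ) :
    ∃ᶠ y in ballFilter 𝕜 X, ∃ g ∈ L,
      RCLike.re (f x) - δ < RCLike.re (g x) ∧ ε / 4 - δ < RCLike.re (g y) := by
  intro none
  set A : Set (WeakDual 𝕜 X) := {g | g ∈ L ∧ ε / 2 < ‖WeakDual.toStrongDual (g - f)‖}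
  have := neBot_nhds_inf_principal_of_mem_szDeriv hf
  obtain ⟨U, hU⟩ := Ultrafilter.exists_le (𝓝 f ⊓ 𝓟 A)
  have almostNorming (g : WeakDual 𝕜 X) :
      ∃ y : X, ‖y‖ ≤ 1 ∧ (g ∈ A → ε / 2 < RCLike.re ((g - f) y)) := by
    by_cases hg : g ∈ A
    · obtain ⟨y, hy, hgy⟩ := exists_lt_re_apply_of_lt_norm hg.2
      exact ⟨y, hy, fun _ => hgy⟩
    · exact ⟨0, by simp, fun h => absurd h hg⟩
  choose Y norm_Y_le lt_re_Y using almostNorming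
  have eventually_mem : ∀ᶠ g in (U : Filter _), g ∈ A :=
    le_principal_iff.1 (hU.trans inf_le_right)
  have tendsto_re (y : X) : Tendsto (fun g : WeakDual 𝕜 X => RCLike.re (g y)) U
      (𝓝 (RCLike.re (f y))) :=
    ((RCLike.continuous_re.comp (WeakDual.eval_continuous y)).tendsto f).mono_left
      (hU.trans inf_le_left)
  have re_f_small : ∀ᶠ y in ballFilter 𝕜 X, -(δ / 2) < RCLike.re (f y) := by
    refine ((RCLike.continuous_re.tendsto _).comp
      (tendsto_ballFilter_apply 𝕜 (WeakDual.toStrongDual f))).eventually_const_lt ?_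
    simpa using hδ
  obtain ⟨g', hg'⟩ := ((tendsto_half_sub_ballFilter (𝕜 := 𝕜) U norm_Y_le).eventually
    (none.and re_f_small)).curry.exists
  obtain ⟨g, ⟨hnone, hfy⟩, hgA, hgx, hgY⟩ := (hg'.and (eventually_mem.and
    (((tendsto_re x).eventually_const_lt (sub_lt_self _ hδ)).and
      ((tendsto_re (Y g')).eventually_lt_const (lt_add_of_pos_right _ hδ))))).exists
  refine hnone ⟨g, hgA.1, hgx, ?_⟩
  have hgf := lt_re_Y g hgA
  rw [show (g - f) (Y g) = g (Y g) - f (Y g) from rfl, map_sub] at hgf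
  simp only [map_smul, map_sub, smul_eq_mul, RCLike.re_ofReal_mul] at hfy ⊢
  linarith

theorem DualBdd.re_add_le_baseOp_supportFun {L : Set (WeakDual 𝕜 X)} (hL : DualBdd R L) {ε : ℝ}
    {f : WeakDual 𝕜 X} (hf : f ∈ szDeriv ε L) (a : ℝ≥0) (x : X) :
    RCLike.re (f x) + a * (ε / 4) ≤ baseOp 𝕜 a (supportFun L) x := by
  by_contra! hlt
  obtain ⟨c, hc, hc'⟩ := exists_between hlt
  set δ := (RCLike.re (f x) + a * (ε / 4) - c) / (1 + a) with hδ
  have hδ_pos : 0 < δ := div_pos (sub_pos.2 hc') (by positivity)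
  have hδ_mul : δ * (1 + a) = RCLike.re (f x) + a * (ε / 4) - c := by
    rw [hδ, div_mul_cancel₀ _ (by positivity)]
  obtain ⟨y, ⟨g, hg, hgx, hgy⟩, hy⟩ := ((frequently_exists_lt_re_apply hf x hδ_pos).and_eventually
    (eventually_lt_of_baseOp_lt hL.lipschitzWith_supportFun hc)).exists
  have hgxy := hL.re_le_supportFun hg (x + ((a : ℝ) : 𝕜) • y)
  rw [map_add, map_smul, map_add, smul_eq_mul, RCLike.re_ofReal_mul] at hgxy
  linarith [mul_le_mul_of_nonneg_left hgy.le a.coe_nonneg]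

theorem DualBdd.re_add_le_foldr_supportFun {S : ℝ≥0 → (X → ℝ) → X → ℝ} (hS : IsStepOperator R S)
    {ε e : ℝ} {b : ℝ≥0} {ρ : Ordinal.{v}}
    (gain : ∀ L : Set (WeakDual 𝕜 X), DualBdd R L → ∀ f ∈ szDerivIter ε L ρ, ∀ x,
      RCLike.re (f x) + b * e ≤ S b (supportFun L) x) (n : ℕ)
    {L : Set (WeakDual 𝕜 X)} (hL : DualBdd R L) {f : WeakDual 𝕜 X}
    (hf : f ∈ szDerivIter ε L (ρ * (n : Ordinal.{v}))) (x : X) :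
    RCLike.re (f x) + n * (b * e) ≤ (List.replicate n b).foldr S (supportFun L) x := by
  induction n generalizing f x with
  | zero =>
    rw [Nat.cast_zero, mul_zero, szDerivIter_zero] at hf
    simpa using hL.re_le_supportFun hf x
  | succ n ih =>
    rw [Nat.cast_add, Nat.cast_one, mul_add, mul_one, szDerivIter_add] at hf
    have hL' := hL.mono (szDerivIter_subset ε L (ρ * (n : Ordinal.{v})))
    have nonempty := Set.nonempty_of_mem (szDerivIter_subset _ _ _ hf)
    have first := gain _ hL' f hf x
    have rest := hS.mono_add b hL'.lipschitzWith_supportFun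
      (hS.lipschitz_foldr (List.replicate n b) hL.lipschitzWith_supportFun) (c := -(n * (b * e)))
      (fun y => supportFun_le nonempty fun g hg => by linarith [ih hg y]) x
    rw [List.replicate_succ, List.foldr_cons]
    push_cast
    linarith

theorem DualBdd.re_add_le_op_supportFun {ε : ℝ} (ξ : Ordinal.{v})
    {L : Set (WeakDual 𝕜 X)} (hL : DualBdd R L) {f : WeakDual 𝕜 X}
    (hf : f ∈ szDerivIter ε L (ω ^ ξ)) (a : ℝ≥0) (x : X) :
    RCLike.re (f x) + a * (ε / 4) ≤ op 𝕜 ξ a (supportFun L) x := by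
  induction ξ using Ordinal.limitRecOn generalizing L f a x with
  | zero =>
    rw [Ordinal.opow_zero, ← zero_add 1, szDerivIter_add_one, szDerivIter_zero] at hf
    rw [op_zero]
    exact hL.re_add_le_baseOp_supportFun hf a x
  | add_one ξ ih =>
    rw [op_add_one]
    refine le_ciInf fun n => ?_
    refine le_trans (le_of_eq ?_) (DualBdd.re_add_le_foldr_supportFun (isStepOperator_op 𝕜 ξ)
      (b := a / (n + 1)) (fun L hL f hf x => ih hL hf _ x) (n + 1) hL
      (szDerivIter_anti ε L (opow_mul_natCast_le ξ (n + 1)) hf) x)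
    push_cast
    field_simp
  | limit ξ hξ ih =>
    rw [op_limit 𝕜 hξ]
    have : Nonempty (Set.Iio ξ) := ⟨⟨0, hξ.bot_lt⟩⟩
    refine le_ciInf fun ζ => ?_
    have hζ := hξ.add_one_lt ζ.2
    exact ih _ hζ hL (szDerivIter_anti ε L
      (Ordinal.opow_le_opow_right Ordinal.omega0_pos hζ.le) hf) a x

end Szlenk

/-! ### The upper estimate of the operators -/

section Upper

variable {𝕜 : Type w} [RCLike 𝕜] {X : Type u} [NormedAddCommGroup X] [NormedSpace 𝕜 X] {R : ℝ≥0}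

/-- A finite family of weak*-compact sets with constants, such that `g` is at most the supremum of
the functions `x ↦ Re f(x) + c`, where `f ∈ L` and `(L, c)` is in the family. -/
structure IsDominatingFamily (R : ℝ≥0) (F : Set (Set (WeakDual 𝕜 X) × ℝ)) (g : X → ℝ) : Prop where
  finite : F.Finite
  isCompact : ∀ P ∈ F, IsCompact P.1
  dualBdd : ∀ P ∈ F, DualBdd R P.1
  le : ∀ {x : X} {M : ℝ}, (∀ P ∈ F, ∀ f ∈ P.1, RCLike.re (f x) + P.2 ≤ M) → g x ≤ M

/-- The effect on a dominating family of a step of length `b`: a functional gains `b * ε` in such a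
step, and up to `b * R` if it survives the derivation of order `ρ`. -/
def stepFamily (R : ℝ≥0) (ε : ℝ) (b : ℝ≥0) (ρ : Ordinal.{v})
    (F : Set (Set (WeakDual 𝕜 X) × ℝ)) : Set (Set (WeakDual 𝕜 X) × ℝ) :=
  (fun P => (P.1, P.2 + b * ε)) '' F ∪ (fun P => (szDerivIter ε P.1 ρ, P.2 + b * R)) '' F

theorem forall_mem_stepFamily {ε : ℝ} {b : ℝ≥0} {ρ : Ordinal.{v}}
    {F : Set (Set (WeakDual 𝕜 X) × ℝ)} {p : Set (WeakDual 𝕜 X) × ℝ → Prop} :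
    (∀ Q ∈ stepFamily R ε b ρ F, p Q) ↔
      ∀ P ∈ F, p (P.1, P.2 + b * ε) ∧ p (szDerivIter ε P.1 ρ, P.2 + b * R) := by
  simp only [stepFamily, Set.mem_union, or_imp, forall_and, Set.forall_mem_image]

theorem IsDominatingFamily.stepFamily {ε : ℝ} {b : ℝ≥0} {ρ : Ordinal.{v}}
    {F : Set (Set (WeakDual 𝕜 X) × ℝ)} {g h : X → ℝ} (hF : IsDominatingFamily R F g)
    (hh : ∀ x M, (∀ P ∈ F, ∀ f ∈ P.1, RCLike.re (f x) + (P.2 + b * ε) ≤ M) →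
      (∀ P ∈ F, ∀ f ∈ szDerivIter ε P.1 ρ, RCLike.re (f x) + (P.2 + b * R) ≤ M) → h x ≤ M) :
    IsDominatingFamily R (stepFamily R ε b ρ F) h where
  finite := (hF.finite.image _).union (hF.finite.image _)
  isCompact := forall_mem_stepFamily.2 fun P hP =>
    ⟨hF.isCompact P hP, isCompact_szDerivIter (hF.isCompact P hP) ρ⟩
  dualBdd := forall_mem_stepFamily.2 fun P hP =>
    ⟨hF.dualBdd P hP, (hF.dualBdd P hP).mono (szDerivIter_subset ε P.1 ρ)⟩
  le H := hh _ _ (fun P hP => (forall_mem_stepFamily.1 H P hP).1)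
    fun P hP => (forall_mem_stepFamily.1 H P hP).2

theorem IsDominatingFamily.singleton_supportFun {K : Set (WeakDual 𝕜 X)} (hK : IsCompact K)
    (hKR : DualBdd R K) (hne : K.Nonempty) :
    IsDominatingFamily R {(K, (0 : ℝ))} (supportFun K) where
  finite := Set.finite_singleton _
  isCompact := by simpa using hK
  dualBdd := by simpa using hKR
  le H := supportFun_le hne fun f hf => by simpa using H (K, 0) rfl f hf

/-- The steps of the operator `S` are controlled by the derivation of order `ρ`. -/
def ControlledByDerivation (𝕜 : Type w) [RCLike 𝕜] {X : Type u} [NormedAddCommGroup X]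
    [NormedSpace 𝕜 X] (R : ℝ≥0) (ε : ℝ) (ρ : Ordinal.{v}) (S : ℝ≥0 → (X → ℝ) → X → ℝ) : Prop :=
  ∀ (F : Set (Set (WeakDual 𝕜 X) × ℝ)) (g : X → ℝ), LipschitzWith R g →
    IsDominatingFamily R F g → ∀ b : ℝ≥0, IsDominatingFamily R (stepFamily R ε b ρ F) (S b g)

theorem exists_nhdsWithin_eventually_re_apply_le {ε : ℝ} (hε : 0 ≤ ε) {L : Set (WeakDual 𝕜 X)}
    {f : WeakDual 𝕜 X} (hf : f ∈ L) (hfs : f ∉ szDeriv ε L) {e : ℝ} (he : ε < e) :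
    ∃ V ∈ 𝓝[L] f, ∀ᶠ y in ballFilter 𝕜 X, ∀ g ∈ V, RCLike.re (g y) ≤ e := by
  simp only [szDeriv, Set.mem_ofPred_eq, hf, true_and, not_forall, not_lt] at hfs
  obtain ⟨V, hV, ediam_le⟩ := hfs
  refine ⟨V ∩ L, inter_mem (mem_nhdsWithin_of_mem_nhds hV) self_mem_nhdsWithin, ?_⟩
  have re_f_small : ∀ᶠ y in ballFilter 𝕜 X, RCLike.re (f y) < e - ε := by
    refine ((RCLike.continuous_re.tendsto _).comp
      (tendsto_ballFilter_apply 𝕜 (WeakDual.toStrongDual f))).eventually_lt_const ?_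
    simpa using he
  filter_upwards [eventually_ballFilter_norm_le 𝕜, re_f_small] with y hy hfy g hg
  have norm_sub_le : ‖WeakDual.toStrongDual g - WeakDual.toStrongDual f‖ ≤ ε := by
    have := (Metric.edist_le_ediam_of_mem (Set.mem_image_of_mem WeakDual.toStrongDual hg)
      (Set.mem_image_of_mem WeakDual.toStrongDual ⟨mem_of_mem_nhds hV, hf⟩)).trans ediam_le
    rwa [edist_dist, dist_eq_norm, ENNReal.ofReal_le_ofReal_iff hε] at this
  have re_sub_le : RCLike.re (g y) - RCLike.re (f y) ≤ ε := by
    rw [← map_sub]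
    exact (RCLike.re_le_norm _).trans (((WeakDual.toStrongDual g -
      WeakDual.toStrongDual f).le_of_opNorm_le norm_sub_le y).trans (mul_le_of_le_one_right hε hy))
  linarith

theorem exists_nhdsWithin_eventually_re_apply_add_smul_le {L : Set (WeakDual 𝕜 X)} {b : ℝ≥0}
    {x : X} {f : WeakDual 𝕜 X} {e M : ℝ} (hM : RCLike.re (f x) + b * e < M)
    (he : ∃ V ∈ 𝓝[L] f, ∀ᶠ y in ballFilter 𝕜 X, ∀ g ∈ V, RCLike.re (g y) ≤ e) :
    ∃ V ∈ 𝓝[L] f, ∀ᶠ y in ballFilter 𝕜 X, ∀ g ∈ V,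
      RCLike.re (g (x + ((b : ℝ) : 𝕜) • y)) ≤ M := by
  obtain ⟨V, hV, hVe⟩ := he
  have near : ∀ᶠ g in 𝓝 f, RCLike.re (g x) < M - b * e :=
    ((RCLike.continuous_re.comp (WeakDual.eval_continuous x)).tendsto f).eventually_lt_const
      (lt_sub_iff_add_lt.2 hM)
  refine ⟨V ∩ {g | RCLike.re (g x) < M - b * e}, inter_mem hV (mem_nhdsWithin_of_mem_nhds near), ?_⟩
  filter_upwards [hVe] with y hy g ⟨hgV, hgx⟩
  rw [map_add, map_smul, map_add, smul_eq_mul, RCLike.re_ofReal_mul]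
  have := mul_le_mul_of_nonneg_left (hy g hgV) b.coe_nonneg
  linarith [show RCLike.re (g x) < M - b * e from hgx]

theorem DualBdd.exists_nhdsWithin_eventually_le {ε : ℝ} (hε : 0 ≤ ε) {L : Set (WeakDual 𝕜 X)}
    (hL : DualBdd R L) {b : ℝ≥0} {x : X} {M : ℝ} {f : WeakDual 𝕜 X} (hf : f ∈ L)
    (hfε : RCLike.re (f x) + b * ε < M) (hfR : f ∈ szDeriv ε L → RCLike.re (f x) + b * R < M) :
    ∃ V ∈ 𝓝[L] f, ∀ᶠ y in ballFilter 𝕜 X, ∀ g ∈ V,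
      RCLike.re (g (x + ((b : ℝ) : 𝕜) • y)) ≤ M := by
  by_cases hfs : f ∈ szDeriv ε L
  · refine exists_nhdsWithin_eventually_re_apply_add_smul_le (hfR hfs)
      ⟨L, self_mem_nhdsWithin, ?_⟩
    filter_upwards [eventually_ballFilter_norm_le 𝕜] with y hy g hg
    exact (hL.re_apply_le hg y).trans (mul_le_of_le_one_right R.coe_nonneg hy)
  · obtain ⟨e, he, hεe⟩ : ∃ e, RCLike.re (f x) + b * e < M ∧ ε < e :=
      ((Continuous.tendsto (by fun_prop) ε).mono_left nhdsWithin_le_nhds |>.eventually_lt_const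
        hfε |>.and (self_mem_nhdsWithin (s := Set.Ioi ε))).exists
    exact exists_nhdsWithin_eventually_re_apply_add_smul_le he
      (exists_nhdsWithin_eventually_re_apply_le hε hf hfs hεe)

theorem controlledByDerivation_baseOp {ε : ℝ} (hε : 0 ≤ ε) :
    ControlledByDerivation 𝕜 R ε (1 : Ordinal.{v}) (baseOp 𝕜 (X := X)) := by
  refine fun F g hg hF b => hF.stepFamily fun x M gain_ε gain_R => (baseOp_le_iff hg).2
    fun M' hM' => ?_
  obtain ⟨c, hMc, hcM'⟩ := exists_between hM'
  have eventually_le : ∀ P ∈ F, ∀ᶠ y in ballFilter 𝕜 X, ∀ f ∈ P.1,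
      RCLike.re (f (x + ((b : ℝ) : 𝕜) • y)) ≤ c - P.2 := by
    intro P hP
    refine (hF.isCompact P hP).induction_on (p := fun s => ∀ᶠ y in ballFilter 𝕜 X, ∀ f ∈ s,
      RCLike.re (f (x + ((b : ℝ) : 𝕜) • y)) ≤ c - P.2) (by simp) ?_ ?_ ?_
    · exact fun s t hst ht => ht.mono fun y hy f hf => hy f (hst hf)
    · intro s t hs ht
      filter_upwards [hs, ht] with y hys hyt f hf using hf.elim (hys f) (hyt f)
    · intro f hf
      refine (hF.dualBdd P hP).exists_nhdsWithin_eventually_le hε hf ?_ fun hfs => ?_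
      · linarith [gain_ε P hP f hf]
      · have hf_one : f ∈ szDerivIter ε P.1 (1 : Ordinal.{v}) := by
          rwa [← zero_add (1 : Ordinal.{v}), szDerivIter_add_one, szDerivIter_zero]
        linarith [gain_R P hP f hf_one]
  filter_upwards [(eventually_all_finite hF.finite).2 eventually_le] with y hy
  exact (hF.le fun P hP f hf => by linarith [hy P hP f hf]).trans_lt hcM'

theorem ControlledByDerivation.foldr_replicate_le {ε : ℝ} {ρ : Ordinal.{v}}
    {S : ℝ≥0 → (X → ℝ) → X → ℝ} (hS : IsStepOperator R S)
    (h : ControlledByDerivation 𝕜 R ε ρ S) {F : Set (Set (WeakDual 𝕜 X) × ℝ)} {g : X → ℝ}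
    (hg : LipschitzWith R g) (hF : IsDominatingFamily R F g) (b : ℝ≥0) (n : ℕ) {x : X} {M : ℝ}
    (H : ∀ P ∈ F, ∀ k ≤ n, ∀ f ∈ szDerivIter ε P.1 (ρ * (k : Ordinal.{v})),
      RCLike.re (f x) + (P.2 + k * (b * R) + (n - k) * (b * ε)) ≤ M) :
    (List.replicate n b).foldr S g x ≤ M := by
  induction n generalizing F g with
  | zero =>
    refine hF.le fun P hP f hf => ?_
    simpa using H P hP 0 le_rfl f (by simpa [szDerivIter_zero] using hf)
  | succ n ih =>
    rw [List.replicate_succ', List.foldr_append]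
    refine ih (hS.lipschitz b hg) (h F g hg hF b)
      (forall_mem_stepFamily.2 fun P hP => ⟨fun k hk f hf => ?_, fun k hk f hf => ?_⟩)
    · have := H P hP k (by lia) f hf
      push_cast at this
      linarith
    · rw [← szDerivIter_add, ← mul_one_add, ← Nat.cast_one, ← Nat.cast_add, add_comm] at hf
      have := H P hP (k + 1) (by lia) f hf
      push_cast at this
      linarith

theorem IsDominatingFamily.exists_lt_forall_szDerivIter_re_add_le {ε c : ℝ}
    {F : Set (Set (WeakDual 𝕜 X) × ℝ)} {g : X → ℝ} (hF : IsDominatingFamily R F g)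
    {ξ : Ordinal.{v}} (hξ : Order.IsSuccLimit ξ) {x : X} {M M' : ℝ} (hM : M < M')
    (H : ∀ P ∈ F, ∀ f ∈ szDerivIter ε P.1 ξ, RCLike.re (f x) + (P.2 + c) ≤ M) :
    ∃ η < ξ, ∀ P ∈ F, ∀ f ∈ szDerivIter ε P.1 η, RCLike.re (f x) + (P.2 + c) ≤ M' := by
  have each : ∀ P ∈ F, ∃ η < ξ, ∀ f ∈ szDerivIter ε P.1 η, RCLike.re (f x) < M' - (P.2 + c) :=
    fun P hP => exists_lt_forall_szDerivIter_re_lt (hF.isCompact P hP) hξ fun f hf => by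
      linarith [H P hP f hf]
  choose! η η_lt re_lt using each
  obtain ⟨ζ, hζ, η_le⟩ : ∃ ζ < ξ, ∀ P ∈ F, η P ≤ ζ := by
    refine ⟨hF.finite.toFinset.sup η, (Finset.sup_lt_iff hξ.bot_lt).2 fun P hP => η_lt P (by
      simpa using hP), fun P hP => Finset.le_sup (by simpa using hP)⟩
  exact ⟨ζ, hζ, fun P hP f hf => by
    linarith [re_lt P hP f (szDerivIter_anti ε P.1 (η_le P hP) hf)]⟩

/-- In a fine subdivision only boundedly many of the steps are followed by a derivation of order
`ω ^ ξ` before the functional is close to surviving the derivation of order `ω ^ (ξ + 1)`. -/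
theorem ControlledByDerivation.op_add_one {ε : ℝ} (hε : 0 ≤ ε) (hεR : ε ≤ R) {ξ : Ordinal.{v}}
    (h : ControlledByDerivation 𝕜 R ε (ω ^ ξ) (op 𝕜 ξ (X := X))) :
    ControlledByDerivation 𝕜 R ε (ω ^ (ξ + 1)) (op 𝕜 (ξ + 1) (X := X)) := by
  refine fun F g hg hF b => hF.stepFamily fun x M gain_ε gain_R =>
    le_of_forall_pos_le_add fun δ hδ => ?_
  rw [SzlenkSum.op_add_one]
  obtain ⟨η, hη, gain_η⟩ := hF.exists_lt_forall_szDerivIter_re_add_le (isSuccLimit_opow_add_one ξ)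
    (lt_add_of_pos_right M hδ) gain_R
  obtain ⟨m, hm⟩ := exists_nat_of_lt_opow_add_one hη
  obtain ⟨N, hN⟩ := exists_nat_gt (m * (b * R) / δ)
  have N_pos : (0 : ℝ) < N + 1 := by positivity
  have step_le : m * (b * (R : ℝ)) / (N + 1) ≤ δ := by
    rw [div_lt_iff₀ hδ] at hN
    rw [div_le_iff₀ N_pos]
    linarith
  refine ((isStepOperator_op 𝕜 ξ).succOp_le_subdivide N b hg x).trans
    (h.foldr_replicate_le (isStepOperator_op 𝕜 ξ) hg hF _ (N + 1) fun P hP k hk f hf => ?_)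
  have hkN : (k : ℝ) ≤ N + 1 := by exact_mod_cast hk
  have total_gain : P.2 + k * ((b / (N + 1) : ℝ≥0) * (R : ℝ)) +
      ((N + 1 : ℕ) - k) * ((b / (N + 1) : ℝ≥0) * ε) = P.2 + b * ε + k * b / (N + 1) * (R - ε) := by
    push_cast
    field_simp
    ring
  rw [total_gain]
  rcases le_or_gt m k with hmk | hkm
  · have all_steps : k * b / (N + 1) ≤ (b : ℝ) := by
      rw [div_le_iff₀ N_pos, mul_comm]
      gcongr
    linarith [mul_le_mul_of_nonneg_right all_steps (sub_nonneg.2 hεR),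
      gain_η P hP f (szDerivIter_anti ε P.1 (hm.le.trans (by gcongr)) hf)]
  · have few_steps : k * b / (N + 1) * (R - ε) ≤ m * (b * (R : ℝ)) / (N + 1) := by
      rw [div_mul_eq_mul_div, mul_assoc]
      gcongr
      linarith
    linarith [gain_ε P hP f (szDerivIter_subset _ _ _ hf)]

theorem controlledByDerivation_op {ε : ℝ} (hε : 0 ≤ ε) (hεR : ε ≤ R) (ξ : Ordinal.{v}) :
    ControlledByDerivation 𝕜 R ε (ω ^ ξ) (op 𝕜 ξ (X := X)) := by
  induction ξ using Ordinal.limitRecOn with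
  | zero => simpa [op_zero] using controlledByDerivation_baseOp hε
  | add_one ξ ih => exact ih.op_add_one hε hεR
  | limit ξ hξ ih =>
    refine fun F g hg hF b => hF.stepFamily fun x M gain_ε gain_R =>
      le_of_forall_gt_imp_ge_of_dense fun M' hM' => ?_
    obtain ⟨η, hη, gain_η⟩ := hF.exists_lt_forall_szDerivIter_re_add_le
      (Ordinal.isSuccLimit_opow Ordinal.one_lt_omega0 hξ) hM' gain_R
    obtain ⟨ζ, hζ, hηζ⟩ := (Ordinal.lt_opow_of_isSuccLimit Ordinal.omega0_ne_zero hξ).1 hη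
    have hη_le : η ≤ ω ^ (ζ + 1) := hηζ.le.trans
      (Ordinal.opow_le_opow_right Ordinal.omega0_pos (le_add_of_nonneg_right zero_le))
    exact (op_limit_le 𝕜 hξ hζ b hg x).trans <| (ih _ (hξ.add_one_lt hζ) F g hg hF b).le <|
      forall_mem_stepFamily.2 fun P hP => ⟨fun f hf => (gain_ε P hP f hf).trans hM'.le,
        fun f hf => gain_η P hP f (szDerivIter_anti ε P.1 hη_le hf)⟩

theorem subdivide_op_supportFun_le {ε : ℝ} (hε : 0 ≤ ε) (hεR : ε ≤ R) (ξ : Ordinal.{v})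
    {K : Set (WeakDual 𝕜 X)} (hK : IsCompact K) (hKR : DualBdd R K) (hne : K.Nonempty) {n : ℕ}
    (hn : szDerivIter ε K (ω ^ ξ * (n : Ordinal.{v})) = ∅) (N : ℕ) :
    subdivide (op 𝕜 ξ) N 1 (supportFun K) 0 ≤ ε + n * R / (N + 1) := by
  refine (controlledByDerivation_op hε hεR ξ).foldr_replicate_le (isStepOperator_op 𝕜 ξ)
    hKR.lipschitzWith_supportFun (.singleton_supportFun hK hKR hne) _ (N + 1) ?_
  rintro _ rfl k - f hf
  have hkn : k < n := by
    by_contra! hnk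
    exact (hn ▸ szDerivIter_anti ε K (show ω ^ ξ * (n : Ordinal.{v}) ≤ ω ^ ξ * k by gcongr) hf :)
  have total_gain : (0 : ℝ) + k * ((1 / (N + 1) : ℝ≥0) * (R : ℝ)) +
      ((N + 1 : ℕ) - k) * ((1 / (N + 1) : ℝ≥0) * ε) = ε + k * (R - ε) / (N + 1) := by
    push_cast
    field_simp
    ring
  rw [map_zero, map_zero, zero_add, total_gain]
  gcongr
  linarith

end Upper
/-! ### The trees `Γ_{ξ,n}` and their weights -/

section Trees

theorem mem_Gam_one {ξ : Ordinal.{v}} {t : List Ordinal.{v}} : t ∈ Gam ξ 1 ↔ t ∈ GammaOne ξ := by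
  constructor
  · intro h
    obtain ⟨i, hi⟩ := Set.mem_iUnion.1 h
    match i, hi with
    | 1, ⟨s, hs, h_eq⟩ => simpa [shift, h_eq] using hs
    | i + 2, ⟨_, _, _, hr, _⟩ => exact absurd hr (by simp [stackLevel])
  · intro h
    exact Set.mem_iUnion.2 ⟨1, t, h, by simp [shift]⟩

theorem Gam_one (ξ : Ordinal.{v}) : Gam ξ 1 = GammaOne ξ :=
  Set.ext fun _ => mem_Gam_one

theorem Gam_zero (ξ : Ordinal.{v}) : Gam ξ 0 = ∅ := by
  simp [Gam, stackTree, stackLevel]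

theorem ne_nil_of_mem_Gam {ξ : Ordinal.{v}} {n : ℕ} {t : List Ordinal.{v}} (h : t ∈ Gam ξ n) :
    t ≠ [] := by
  obtain ⟨c, hc⟩ := exists_hasWeight_iff.2 h
  exact hc.ne_nil

theorem ne_nil_of_mem_GammaOne {ξ : Ordinal.{v}} {t : List Ordinal.{v}} (h : t ∈ GammaOne ξ) :
    t ≠ [] :=
  ne_nil_of_mem_Gam (mem_Gam_one.2 h)

theorem lt_of_mem_Gam {ξ : Ordinal.{v}} {n : ℕ} {t : List Ordinal.{v}} (h : t ∈ Gam ξ n) :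
    ∀ η ∈ t, η < ω ^ ξ * (n : Ordinal.{v}) := by
  obtain ⟨c, hc⟩ := exists_hasWeight_iff.2 h
  exact hc.lt

theorem mem_Gam_add_one {ξ : Ordinal.{v}} {n : ℕ} {r : List Ordinal.{v}} :
    r ∈ Gam ξ (n + 1) ↔ (∃ t ∈ GammaOne ξ, r = shift (ω ^ ξ * (n : Ordinal.{v})) t) ∨
      ∃ t ∈ maxNodes (GammaOne ξ), ∃ s ∈ Gam ξ n,
        r = shift (ω ^ ξ * (n : Ordinal.{v})) t ++ s := by
  constructor
  · intro h
    obtain ⟨i, hi⟩ := Set.mem_iUnion.1 h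
    match i, hi with
    | 1, ⟨t, ht, h_eq⟩ => exact Or.inl ⟨t, ht, h_eq⟩
    | i + 2, ⟨t, ht, s, hs, h_eq⟩ => exact Or.inr ⟨t, ht, s, Set.mem_iUnion.2 ⟨i + 1, hs⟩, h_eq⟩
  · rintro (⟨t, ht, h_eq⟩ | ⟨t, ht, s, hs, h_eq⟩)
    · exact Set.mem_iUnion.2 ⟨1, t, ht, h_eq⟩
    · obtain ⟨i, hi⟩ := Set.mem_iUnion.1 hs
      match i, hi with
      | 0, hi => simp [stackLevel] at hi
      | i + 1, hi => exact Set.mem_iUnion.2 ⟨i + 2, t, ht, s, hi, h_eq⟩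

theorem filter_shift_append {β : Ordinal.{v}} (t : List Ordinal.{v}) {s : List Ordinal.{v}}
    (hs : ∀ η ∈ s, η < β) :
    (shift β t ++ s).filter (fun η => decide (β ≤ η)) = shift β t ∧
      (shift β t ++ s).filter (fun η => decide (¬ β ≤ η)) = s := by
  constructor
  · rw [List.filter_append, List.filter_eq_self.2, List.filter_eq_nil_iff.2, List.append_nil]
    · simpa using hs
    · simp [shift]
  · rw [List.filter_append, List.filter_eq_nil_iff.2, List.filter_eq_self.2, List.nil_append]
    · simpa using hs
    · simp [shift]

theorem shift_prefix_iff {β : Ordinal.{v}} {t t' : List Ordinal.{v}} :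
    shift β t <+: shift β t' ↔ t <+: t' :=
  List.prefix_map_iff_of_injective fun a b hab => by simpa using hab

theorem prefix_of_shift_append_prefix {β : Ordinal.{v}} {t t' s s' : List Ordinal.{v}}
    (hs : ∀ η ∈ s, η < β) (hs' : ∀ η ∈ s', η < β)
    (h : shift β t ++ s <+: shift β t' ++ s') : t <+: t' ∧ s <+: s' := by
  have large := h.filter (fun η => decide (β ≤ η))
  have small := h.filter (fun η => decide (¬ β ≤ η))
  rw [(filter_shift_append t hs).1, (filter_shift_append t' hs').1] at large
  rw [(filter_shift_append t hs).2, (filter_shift_append t' hs').2] at small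
  exact ⟨shift_prefix_iff.1 large, small⟩

theorem shift_append_inj {β : Ordinal.{v}} {t t' s s' : List Ordinal.{v}}
    (hs : ∀ η ∈ s, η < β) (hs' : ∀ η ∈ s', η < β)
    (h : shift β t ++ s = shift β t' ++ s') : t = t' ∧ s = s' := by
  obtain ⟨ht, hss'⟩ := prefix_of_shift_append_prefix hs hs' ⟨[], by rw [List.append_nil, h]⟩
  obtain ⟨ht', hs's⟩ := prefix_of_shift_append_prefix hs' hs ⟨[], by rw [List.append_nil, h]⟩
  exact ⟨ht.eq_of_length_le ht'.length_le, hss'.eq_of_length_le hs's.length_le⟩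

theorem le_of_mem_Gam_of_head?_eq {ξ : Ordinal.{v}} {n m : ℕ} {t s : List Ordinal.{v}}
    (ht : t ∈ Gam ξ n) (hs : s ∈ Gam ξ m) (h : s.head? = t.head?) : n ≤ m := by
  by_contra! hlt
  obtain ⟨c, hc⟩ := exists_hasWeight_iff.2 ht
  obtain ⟨η, hη, hm⟩ := hc.le_head
  exact absurd (lt_of_mem_Gam hs η (List.mem_of_mem_head? (h ▸ hη))) (not_lt.2 (hm m hlt))

theorem eq_of_mem_Gam_of_head?_eq {ξ : Ordinal.{v}} {n m : ℕ} {t s : List Ordinal.{v}}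
    (ht : t ∈ Gam ξ n) (hs : s ∈ Gam ξ m) (h : s.head? = t.head?) : n = m :=
  le_antisymm (le_of_mem_Gam_of_head?_eq ht hs h) (le_of_mem_Gam_of_head?_eq hs ht h.symm)

theorem head?_eq_of_prefix {α : Type*} {s t : List α} (h : s <+: t) (hs : s ≠ []) :
    t.head? = s.head? := by
  obtain ⟨r, rfl⟩ := h
  rw [List.head?_append_of_ne_nil _ hs]

theorem le_of_opow_add_eq {α β η η' : Ordinal.{v}} (hη' : η' < ω ^ (β + 1))
    (h : ω ^ α + η = ω ^ β + η') : α ≤ β := by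
  by_contra! hlt
  have lt_opow : ω ^ β + η' < ω ^ (β + 1) := Ordinal.isPrincipal_add_omega0_opow _
    ((Ordinal.opow_lt_opow_iff_right Ordinal.one_lt_omega0).2 (by simp)) hη'
  have opow_le : ω ^ (β + 1) ≤ ω ^ α :=
    Ordinal.opow_le_opow_right Ordinal.omega0_pos (Order.add_one_le_of_lt hlt)
  exact absurd (h ▸ lt_opow) (not_lt.2 (opow_le.trans le_self_add))

theorem eq_of_opow_add_eq {α β η η' : Ordinal.{v}} (hη : η < ω ^ (α + 1))
    (hη' : η' < ω ^ (β + 1)) (h : ω ^ α + η = ω ^ β + η') : α = β :=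
  le_antisymm (le_of_opow_add_eq hη' h) (le_of_opow_add_eq hη h.symm)

theorem eq_of_mem_GammaOne_of_head?_eq {α β : Ordinal.{v}} {t s : List Ordinal.{v}}
    (ht : t ∈ GammaOne (α + 1)) (hs : s ∈ GammaOne (β + 1))
    (h : (shift (ω ^ β) s).head? = (shift (ω ^ α) t).head?) : α = β := by
  obtain ⟨η, l, rfl⟩ := List.exists_cons_of_ne_nil (ne_nil_of_mem_GammaOne ht)
  obtain ⟨η', l', rfl⟩ := List.exists_cons_of_ne_nil (ne_nil_of_mem_GammaOne hs)
  refine eq_of_opow_add_eq (GammaOne_lt _ _ ht η (by simp)) (GammaOne_lt _ _ hs η' (by simp)) ?_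
  simpa [shift] using h.symm

theorem maxNodes_GammaOne_zero : maxNodes (GammaOne (0 : Ordinal.{v})) = {[0]} := by
  rw [GammaOne_zero]
  ext t
  simp only [maxNodes, Set.mem_ofPred_eq, Set.mem_singleton_iff, forall_eq]
  exact ⟨fun h => h.1, fun h => ⟨h, fun _ => h.symm⟩⟩

theorem shift_append_mem_maxNodes {ξ : Ordinal.{v}} {n : ℕ} {t s : List Ordinal.{v}}
    (ht : t ∈ maxNodes (GammaOne ξ)) (hs : s ∈ maxNodes (Gam ξ n)) :
    shift (ω ^ ξ * (n : Ordinal.{v})) t ++ s ∈ maxNodes (Gam ξ (n + 1)) := by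
  refine ⟨mem_Gam_add_one.2 (Or.inr ⟨t, ht, s, hs.1, rfl⟩), fun r hr h => ?_⟩
  rcases mem_Gam_add_one.1 hr with ⟨t', -, rfl⟩ | ⟨t', ht', s', hs', rfl⟩
  · rw [← List.append_nil (shift _ t')] at h
    have := (prefix_of_shift_append_prefix (lt_of_mem_Gam hs.1) (by simp) h).2
    exact absurd (List.prefix_nil.1 this) (ne_nil_of_mem_Gam hs.1)
  · obtain ⟨htt', hss'⟩ := prefix_of_shift_append_prefix (lt_of_mem_Gam hs.1) (lt_of_mem_Gam hs') h
    rw [ht.2 t' ht'.1 htt', hs.2 s' hs' hss']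

theorem mem_maxNodes_GammaOne_add_one {ξ : Ordinal.{v}} {n : ℕ} {t : List Ordinal.{v}}
    (ht : t ∈ Gam ξ n) : t ∈ maxNodes (GammaOne (ξ + 1)) ↔ t ∈ maxNodes (Gam ξ n) := by
  rw [GammaOne_add_one]
  refine ⟨fun h => ⟨ht, fun s hs => h.2 s (Set.mem_iUnion.2 ⟨n, hs⟩)⟩,
    fun h => ⟨Set.mem_iUnion.2 ⟨n, ht⟩, fun s hs hp => ?_⟩⟩
  obtain ⟨m, hm⟩ := Set.mem_iUnion.1 hs
  obtain rfl := eq_of_mem_Gam_of_head?_eq ht hm (head?_eq_of_prefix hp (ne_nil_of_mem_Gam ht))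
  exact h.2 s hm hp

theorem shift_mem_maxNodes_limit {ξ ζ : Ordinal.{v}} (hξ : Order.IsSuccLimit ξ) (hζ : ζ < ξ)
    {t : List Ordinal.{v}} (ht : t ∈ GammaOne (ζ + 1)) :
    shift (ω ^ ζ) t ∈ maxNodes (GammaOne ξ) ↔ t ∈ maxNodes (GammaOne (ζ + 1)) := by
  rw [GammaOne_limit hξ]
  constructor
  · refine fun h => ⟨ht, fun s hs hp => ?_⟩
    exact shift_inj (h.2 _ ⟨ζ, hζ, s, hs, rfl⟩ (shift_prefix_iff.2 hp))
  · refine fun h => ⟨⟨ζ, hζ, t, ht, rfl⟩, ?_⟩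
    rintro _ ⟨ζ', hζ', s, hs, rfl⟩ hp
    obtain rfl := eq_of_mem_GammaOne_of_head?_eq ht hs (head?_eq_of_prefix hp (by
      simpa [shift] using ne_nil_of_mem_GammaOne ht))
    rw [h.2 s hs (shift_prefix_iff.1 hp)]

theorem exists_maxNodes_Gam_of_GammaOne {ξ : Ordinal.{v}} (hne : (GammaOne ξ).Nonempty)
    (exists_max : ∀ t ∈ GammaOne ξ, ∃ m ∈ maxNodes (GammaOne ξ), t <+: m) (n : ℕ) :
    (Gam ξ (n + 1)).Nonempty ∧
      ∀ t ∈ Gam ξ (n + 1), ∃ m ∈ maxNodes (Gam ξ (n + 1)), t <+: m := by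
  induction n with
  | zero =>
    rw [zero_add, Gam_one]
    exact ⟨hne, exists_max⟩
  | succ n ih =>
    obtain ⟨⟨s₀, hs₀⟩, ih⟩ := ih
    obtain ⟨m₀, hm₀, -⟩ := ih s₀ hs₀
    constructor
    · obtain ⟨t, ht⟩ := hne
      exact ⟨_, mem_Gam_add_one.2 (Or.inl ⟨t, ht, rfl⟩)⟩
    · intro r hr
      rcases mem_Gam_add_one.1 hr with ⟨t, ht, rfl⟩ | ⟨t, ht, s, hs, rfl⟩
      · obtain ⟨m, hm, htm⟩ := exists_max t ht
        exact ⟨_, shift_append_mem_maxNodes hm hm₀,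
          (shift_prefix_iff.2 htm).trans (List.prefix_append _ _)⟩
      · obtain ⟨m, hm, hsm⟩ := ih s hs
        exact ⟨_, shift_append_mem_maxNodes ht hm, (List.prefix_append_right_inj _).2 hsm⟩

theorem exists_maxNodes_GammaOne (ξ : Ordinal.{v}) : (GammaOne ξ).Nonempty ∧
    ∀ t ∈ GammaOne ξ, ∃ m ∈ maxNodes (GammaOne ξ), t <+: m := by
  induction ξ using Ordinal.limitRecOn with
  | zero =>
    rw [maxNodes_GammaOne_zero, GammaOne_zero]
    simp
  | add_one ξ ih =>
    constructor
    · rw [GammaOne_add_one]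
      obtain ⟨t, ht⟩ := ih.1
      exact ⟨t, Set.mem_iUnion.2 ⟨1, mem_Gam_one.2 ht⟩⟩
    · intro t ht
      rw [GammaOne_add_one] at ht
      obtain ⟨n, hn⟩ := Set.mem_iUnion.1 ht
      cases n with
      | zero => simp [Gam_zero] at hn
      | succ n =>
        obtain ⟨m, hm, h⟩ := (exists_maxNodes_Gam_of_GammaOne ih.1 ih.2 n).2 t hn
        exact ⟨m, (mem_maxNodes_GammaOne_add_one hm.1).2 hm, h⟩
  | limit ξ hξ ih =>
    constructor
    · rw [GammaOne_limit hξ]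
      obtain ⟨t, ht⟩ := (ih (0 + 1) (hξ.add_one_lt hξ.bot_lt)).1
      exact ⟨_, 0, hξ.bot_lt, t, ht, rfl⟩
    · intro t ht
      rw [GammaOne_limit hξ] at ht
      obtain ⟨ζ, hζ, s, hs, rfl⟩ := ht
      obtain ⟨m, hm, h⟩ := (ih _ (hξ.add_one_lt hζ)).2 s hs
      exact ⟨_, (shift_mem_maxNodes_limit hξ hζ hm.1).2 hm, shift_prefix_iff.2 h⟩

theorem maxNodes_Gam_nonempty (ξ : Ordinal.{v}) (n : ℕ) : (maxNodes (Gam ξ (n + 1))).Nonempty := by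
  obtain ⟨hne, exists_max⟩ := exists_maxNodes_GammaOne ξ
  obtain ⟨⟨t, ht⟩, exists_max_Gam⟩ := exists_maxNodes_Gam_of_GammaOne hne exists_max n
  obtain ⟨m, hm, -⟩ := exists_max_Gam t ht
  exact ⟨m, hm⟩

theorem exists_eq_shift_append_of_mem_maxNodes {ξ : Ordinal.{v}} {n : ℕ} {r : List Ordinal.{v}}
    (hr : r ∈ maxNodes (Gam ξ (n + 2))) : ∃ t ∈ maxNodes (GammaOne ξ),
      ∃ s ∈ maxNodes (Gam ξ (n + 1)), r = shift (ω ^ ξ * ((n + 1 : ℕ) : Ordinal.{v})) t ++ s := by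
  rcases mem_Gam_add_one.1 hr.1 with ⟨t, ht, rfl⟩ | ⟨t, ht, s, hs, rfl⟩
  · obtain ⟨m, hm, htm⟩ := (exists_maxNodes_GammaOne ξ).2 t ht
    obtain ⟨s, hs⟩ := maxNodes_Gam_nonempty ξ n
    have eq_shift := hr.2 _ (mem_Gam_add_one.2 (Or.inr ⟨m, hm, s, hs.1, rfl⟩))
      ((shift_prefix_iff.2 htm).trans (List.prefix_append _ _))
    rw [← List.append_nil (shift _ t)] at eq_shift
    exact absurd (shift_append_inj (lt_of_mem_Gam hs.1) (by simp) eq_shift).2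
      (ne_nil_of_mem_Gam hs.1)
  · refine ⟨t, ht, s, ⟨hs, fun s' hs' h => ?_⟩, rfl⟩
    exact List.append_cancel_left (hr.2 _ (mem_Gam_add_one.2 (Or.inr ⟨t, ht, s', hs', rfl⟩))
      ((List.prefix_append_right_inj _).2 h))

theorem mem_maxNodes_prodTree {T : Set (List Ordinal.{v})} {D : Type u} [Nonempty D]
    {t : List (Ordinal.{v} × D)} :
    t ∈ maxNodes (prodTree T D) ↔ t.map Prod.fst ∈ maxNodes T := by
  constructor
  · refine fun h => ⟨h.1, ?_⟩
    rintro _ hs ⟨r, rfl⟩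
    let d : D := Classical.arbitrary D
    have map_append : (t ++ r.map fun η => (η, d)).map Prod.fst = t.map Prod.fst ++ r := by
      simp [Function.comp_def]
    have append_eq := h.2 (t ++ r.map fun η => (η, d)) (by
      change List.map Prod.fst _ ∈ T
      rwa [map_append]) (List.prefix_append _ _)
    rw [← map_append, append_eq]
  · refine fun h => ⟨h.1, fun s hs hp => (hp.eq_of_length ?_).symm⟩
    rw [← List.length_map Prod.fst, ← h.2 _ hs (hp.map Prod.fst), List.length_map]

theorem weight_eq {ξ : Ordinal.{v}} {n : ℕ} {t : List Ordinal.{v}} {c : ℝ}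
    (h : HasWeight ξ n t c) : weight ξ n t = c := by
  have exists_weight : ∃ c, HasWeight ξ n t c := ⟨c, h⟩
  rw [weight, dif_pos exists_weight]
  exact exists_weight.choose_spec.unique h

theorem hasWeight_weight {ξ : Ordinal.{v}} {n : ℕ} {t : List Ordinal.{v}} (h : t ∈ Gam ξ n) :
    HasWeight ξ n t (weight ξ n t) := by
  obtain ⟨c, hc⟩ := exists_hasWeight_iff.2 h
  rwa [weight_eq hc]

theorem Lam_subset (ξ : Ordinal.{v}) (n i : ℕ) : Lam ξ n i ⊆ Gam ξ n :=
  fun _ h => Set.mem_iUnion.2 ⟨i, h⟩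

theorem shift_mem_Lam_one {ξ : Ordinal.{v}} {n : ℕ} {t : List Ordinal.{v}} :
    shift (ω ^ ξ * (n : Ordinal.{v})) t ∈ Lam ξ (n + 1) 1 ↔ t ∈ GammaOne ξ := by
  constructor
  · rintro ⟨t', ht', h_eq⟩
    rwa [shift_inj h_eq]
  · exact fun h => ⟨t, h, rfl⟩

theorem mem_Lam_one_one {ξ : Ordinal.{v}} {t : List Ordinal.{v}} :
    t ∈ Lam ξ 1 1 ↔ t ∈ GammaOne ξ := by
  simpa [shift] using shift_mem_Lam_one (ξ := ξ) (n := 0) (t := t)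

theorem shift_notMem_Lam {ξ : Ordinal.{v}} {n i : ℕ} {t : List Ordinal.{v}} :
    shift (ω ^ ξ * (n : Ordinal.{v})) t ∉ Lam ξ (n + 1) (i + 2) := by
  rintro ⟨t', _, s, hs, h_eq⟩
  rw [← List.append_nil (shift _ t)] at h_eq
  have hs' := Lam_subset _ _ _ hs
  exact ne_nil_of_mem_Gam hs' (shift_append_inj (by simp) (lt_of_mem_Gam hs') h_eq).2.symm

theorem shift_append_notMem_Lam {ξ : Ordinal.{v}} {n : ℕ} {t s : List Ordinal.{v}} (hs : s ≠ [])
    (hs' : ∀ η ∈ s, η < ω ^ ξ * (n : Ordinal.{v})) :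
    shift (ω ^ ξ * (n : Ordinal.{v})) t ++ s ∉ Lam ξ (n + 1) 1 := by
  rintro ⟨t', _, h_eq⟩
  rw [← List.append_nil (shift _ t')] at h_eq
  exact hs (shift_append_inj hs' (by simp) h_eq).2

theorem shift_append_mem_Lam {ξ : Ordinal.{v}} {n i : ℕ} {t s : List Ordinal.{v}}
    (ht : t ∈ maxNodes (GammaOne ξ)) (hs' : ∀ η ∈ s, η < ω ^ ξ * (n : Ordinal.{v})) :
    shift (ω ^ ξ * (n : Ordinal.{v})) t ++ s ∈ Lam ξ (n + 1) (i + 2) ↔ s ∈ Lam ξ n (i + 1) := by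
  constructor
  · rintro ⟨t', _, s', hs, h_eq⟩
    rwa [(shift_append_inj hs' (lt_of_mem_Gam (Lam_subset _ _ _ hs)) h_eq).2]
  · exact fun h => ⟨t, ht, s, h, rfl⟩

open Classical in
/-- The weight `ℙ_{ξ,n}` restricted to the level `Λ_{ξ,n,i}` and extended by `0`, so that `z_i^t` is
a sum over all non-empty initial segments of `t`. -/
def coef (ξ : Ordinal.{v}) (n i : ℕ) (s : List Ordinal.{v}) : ℝ :=
  if s ∈ Lam ξ n i then weight ξ n s else 0

theorem coef_one_one {ξ : Ordinal.{v}} {s : List Ordinal.{v}} :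
    coef ξ 1 1 s = weight ξ 1 s := by
  by_cases h : s ∈ Lam ξ 1 1
  · exact if_pos h
  · rw [coef, if_neg h, weight, dif_neg]
    rwa [exists_hasWeight_iff, mem_Gam_one, ← mem_Lam_one_one]

theorem coef_shift_one {ξ : Ordinal.{v}} {n : ℕ} {t : List Ordinal.{v}} :
    coef ξ (n + 1) 1 (shift (ω ^ ξ * (n : Ordinal.{v})) t) = coef ξ 1 1 t := by
  by_cases h : t ∈ GammaOne ξ
  · rw [coef, coef, if_pos (shift_mem_Lam_one.2 h), if_pos (mem_Lam_one_one.2 h)]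
    rcases Nat.eq_zero_or_pos n with rfl | hn
    · simp [shift]
    · exact weight_eq (.head hn (hasWeight_weight (mem_Gam_one.2 h)))
  · rw [coef, coef, if_neg (by rwa [shift_mem_Lam_one]), if_neg (by rwa [mem_Lam_one_one])]

theorem coef_shift_add_two {ξ : Ordinal.{v}} {n i : ℕ} {t : List Ordinal.{v}} :
    coef ξ (n + 1) (i + 2) (shift (ω ^ ξ * (n : Ordinal.{v})) t) = 0 :=
  if_neg shift_notMem_Lam

theorem coef_shift_append_one {ξ : Ordinal.{v}} {n : ℕ} {t s : List Ordinal.{v}} (hs : s ≠ [])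
    (hs' : ∀ η ∈ s, η < ω ^ ξ * (n : Ordinal.{v})) :
    coef ξ (n + 1) 1 (shift (ω ^ ξ * (n : Ordinal.{v})) t ++ s) = 0 :=
  if_neg (shift_append_notMem_Lam hs hs')

theorem coef_shift_append_add_two {ξ : Ordinal.{v}} {n i : ℕ} {t s : List Ordinal.{v}}
    (ht : t ∈ maxNodes (GammaOne ξ)) (hs' : ∀ η ∈ s, η < ω ^ ξ * (n : Ordinal.{v})) :
    coef ξ (n + 1) (i + 2) (shift (ω ^ ξ * (n : Ordinal.{v})) t ++ s) = coef ξ n (i + 1) s := by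
  by_cases h : s ∈ Lam ξ n (i + 1)
  · rw [coef, coef, if_pos ((shift_append_mem_Lam ht hs').2 h), if_pos h]
    have hw := hasWeight_weight (Lam_subset _ _ _ h)
    exact weight_eq (.tail hw.one_le ht hw)
  · rw [coef, coef, if_neg (by rwa [shift_append_mem_Lam ht hs']), if_neg h]

open Classical in
theorem sum_Lam_indicator {ξ : Ordinal.{v}} {n : ℕ} {s : List Ordinal.{v}} (hs : s ∈ Gam ξ n) :
    ∑ i : Fin n, (if s ∈ Lam ξ n (i + 1) then (1 : ℝ) else 0) = 1 := by
  induction n generalizing s with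
  | zero => simp [Gam_zero] at hs
  | succ n ih =>
    rw [Fin.sum_univ_succ]
    simp only [Fin.val_zero, zero_add, Fin.val_succ, add_assoc, one_add_one_eq_two]
    rcases mem_Gam_add_one.1 hs with ⟨t, ht, rfl⟩ | ⟨t, ht, s, hs', rfl⟩
    · simp only [shift_mem_Lam_one, shift_notMem_Lam]
      simp [ht]
    · simp only [shift_append_mem_Lam ht (lt_of_mem_Gam hs'),
        shift_append_notMem_Lam (ne_nil_of_mem_Gam hs') (lt_of_mem_Gam hs'), ih hs']
      simp

theorem coef_add_one {ξ : Ordinal.{v}} {n : ℕ} {t s : List Ordinal.{v}} (ht : t ∈ Gam ξ n)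
    (h : t.head? = s.head?) :
    coef (ξ + 1) 1 1 s = ∑ i : Fin n, (1 / n : ℝ) * coef ξ n (i + 1) s := by
  classical
  by_cases hs : s ∈ Gam ξ n
  · have coef_eq : ∀ i : Fin n, (1 / n : ℝ) * coef ξ n (i + 1) s =
        (weight ξ n s / n) * (if s ∈ Lam ξ n (i + 1) then (1 : ℝ) else 0) := by
      intro i
      rw [coef]
      split_ifs <;> ring
    rw [Finset.sum_congr rfl fun i _ => coef_eq i, ← Finset.mul_sum, sum_Lam_indicator hs, mul_one,
      coef_one_one, weight_eq (.succ (hasWeight_weight hs))]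
  · rw [Finset.sum_eq_zero, coef, if_neg]
    · rw [mem_Lam_one_one, GammaOne_add_one, Set.mem_iUnion]
      rintro ⟨m, hm⟩
      rw [eq_of_mem_Gam_of_head?_eq hm ht h] at hm
      exact hs hm
    · intro i _
      rw [coef, if_neg fun h => hs (Lam_subset _ _ _ h), mul_zero]

theorem coef_limit {ξ ζ : Ordinal.{v}} (hξ : Order.IsSuccLimit ξ) (hζ : ζ < ξ)
    {t s : List Ordinal.{v}} (ht : t ∈ GammaOne (ζ + 1)) (h : t.head? = s.head?) :
    coef ξ 1 1 (shift (ω ^ ζ) s) = coef (ζ + 1) 1 1 s := by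
  by_cases hs : s ∈ GammaOne (ζ + 1)
  · rw [coef_one_one, coef_one_one]
    exact weight_eq (.limit hξ hζ (hasWeight_weight (mem_Gam_one.2 hs)))
  · rw [coef, coef, if_neg, if_neg]
    · rwa [mem_Lam_one_one]
    · rw [mem_Lam_one_one, GammaOne_limit hξ]
      rintro ⟨ζ', hζ', s', hs', h_eq⟩
      obtain rfl := eq_of_mem_GammaOne_of_head?_eq ht hs' (by rw [← h_eq]; simp [shift, h])
      rw [shift_inj h_eq] at hs
      exact hs hs'

end Trees
/-! ### Sums along branches -/

section Paths

variable {D : Type*}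

/-- The sequence `β + t`, for a sequence `t` of pairs whose first entries are ordinals. -/
def shiftFst (β : Ordinal.{v}) (t : List (Ordinal.{v} × D)) : List (Ordinal.{v} × D) :=
  t.map fun p => (β + p.1, p.2)

theorem map_fst_shiftFst (β : Ordinal.{v}) (t : List (Ordinal.{v} × D)) :
    (shiftFst β t).map Prod.fst = shift β (t.map Prod.fst) := by
  simp [shiftFst, shift]

theorem exists_shiftFst_eq {β : Ordinal.{v}} {t : List (Ordinal.{v} × D)} {r : List Ordinal.{v}}
    (h : t.map Prod.fst = shift β r) : ∃ s : List (Ordinal.{v} × D),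
      s.map Prod.fst = r ∧ t = shiftFst β s := by
  induction t generalizing r with
  | nil => exact ⟨[], by simpa [shift] using h.symm, rfl⟩
  | cons p t ih =>
    cases r with
    | nil => simp [shift] at h
    | cons η r =>
      simp only [shift, List.map_cons, List.cons.injEq] at h
      obtain ⟨s, rfl, rfl⟩ := ih h.2
      exact ⟨(η, p.2) :: s, rfl, by simp [shiftFst, ← h.1]⟩

theorem exists_shiftFst_append_eq {β : Ordinal.{v}} {t : List (Ordinal.{v} × D)}
    {r r' : List Ordinal.{v}} (h : t.map Prod.fst = shift β r ++ r') :
    ∃ s s' : List (Ordinal.{v} × D), s.map Prod.fst = r ∧ s'.map Prod.fst = r' ∧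
      t = shiftFst β s ++ s' := by
  obtain ⟨l, s', rfl, hl, hs'⟩ := List.map_eq_append_iff.1 h
  obtain ⟨s, hs, rfl⟩ := exists_shiftFst_eq hl
  exact ⟨s, s', hs, hs', rfl⟩

/-- The sum of `F` over the non-empty initial segments of a sequence. -/
def pathSum {α X : Type*} [AddCommMonoid X] (F : List α → X) (t : List α) : X :=
  (t.inits.tail.map F).sum

section

variable {α X : Type*} [AddCommMonoid X]

theorem mem_inits_tail {s t : List α} (h : s ∈ t.inits.tail) : s ≠ [] ∧ s <+: t := by
  refine ⟨?_, (List.mem_inits _ _).1 (List.mem_of_mem_tail h)⟩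
  cases t with
  | nil => simp at h
  | cons a l =>
    rw [List.inits_cons, List.tail_cons] at h
    obtain ⟨r, -, rfl⟩ := List.mem_map.1 h
    simp

theorem nodup_inits (t : List α) : t.inits.Nodup := by
  induction t with
  | nil => simp
  | cons a t ih =>
    rw [List.inits_cons, List.nodup_cons]
    exact ⟨by simp, ih.map fun _ _ h => by simpa using h⟩

theorem pathSum_congr {F G : List α → X} {t : List α}
    (h : ∀ s, s ≠ [] → s <+: t → F s = G s) : pathSum F t = pathSum G t := by
  rw [pathSum, pathSum, List.map_congr_left fun s hs => ?_]
  obtain ⟨hne, hst⟩ := mem_inits_tail hs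
  exact h s hne hst

theorem pathSum_eq_zero {F : List α → X} {t : List α}
    (h : ∀ s, s ≠ [] → s <+: t → F s = 0) : pathSum F t = 0 := by
  rw [pathSum_congr h]
  simp [pathSum]

theorem pathSum_append (F : List α → X) (t s : List α) :
    pathSum F (t ++ s) = pathSum F t + pathSum (fun r => F (t ++ r)) s := by
  rw [pathSum, List.inits_append, List.tail_append_of_ne_nil (by cases t <;> simp),
    List.map_append, List.sum_append, List.map_map]
  rfl

theorem pathSum_shiftFst (β : Ordinal.{v}) (F : List (Ordinal.{v} × D) → X)
    (t : List (Ordinal.{v} × D)) :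
    pathSum F (shiftFst β t) = pathSum (fun r => F (shiftFst β r)) t := by
  rw [pathSum, shiftFst, List.map_inits, ← List.map_tail, List.map_map]
  rfl

theorem sum_pathSum {ι : Type*} (I : Finset ι) (F : ι → List α → X) (t : List α) :
    ∑ i ∈ I, pathSum (F i) t = pathSum (fun s => ∑ i ∈ I, F i s) t := by
  simp only [pathSum]
  induction t.inits.tail with
  | nil => simp
  | cons a l ih => simp [Finset.sum_add_distrib, ih]

theorem smul_pathSum {𝕜 : Type*} [DistribSMul 𝕜 X] (a : 𝕜) (F : List α → X) (t : List α) :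
    a • pathSum F t = pathSum (fun s => a • F s) t := by
  rw [pathSum, pathSum, List.smul_sum, List.map_map]
  rfl

end

end Paths

section Blocks

variable {𝕜 : Type w} [RCLike 𝕜] {X : Type u} [NormedAddCommGroup X] [NormedSpace 𝕜 X] {D : Type u}

theorem coef_nil (ξ : Ordinal.{v}) (n i : ℕ) : coef ξ n i [] = 0 :=
  if_neg fun h => ne_nil_of_mem_Gam (Lam_subset _ _ _ h) rfl

theorem blockSum_eq_pathSum (ξ : Ordinal.{v}) (n : ℕ) (x : List (Ordinal.{v} × D) → X)
    (t : List (Ordinal.{v} × D)) (i : ℕ) :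
    blockSum 𝕜 ξ n x t i =
      pathSum (fun s => ((coef ξ n i (s.map Prod.fst) : ℝ) : 𝕜) • x s) t := by
  classical
  have blockSum_eq_sum : blockSum 𝕜 ξ n x t i = ∑ s ∈ t.inits.toFinset,
      ((coef ξ n i (s.map Prod.fst) : ℝ) : 𝕜) • x s := by
    rw [blockSum, Finset.sum_filter]
    refine Finset.sum_congr (by congr) fun s _ => ?_
    by_cases h : s ∈ prodTree (Lam ξ n i) D
    · rw [if_pos h, coef, if_pos (show s.map Prod.fst ∈ Lam ξ n i from h)]
    · rw [if_neg h, coef, if_neg (show s.map Prod.fst ∉ Lam ξ n i from h)]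
      simp
  rw [blockSum_eq_sum, List.sum_toFinset _ (nodup_inits t), pathSum]
  cases t <;> simp [coef_nil]

theorem blockSum_congr {ξ : Ordinal.{v}} {n : ℕ} {x y : List (Ordinal.{v} × D) → X}
    {t : List (Ordinal.{v} × D)} (h : ∀ s, s.map Prod.fst ∈ Gam ξ n → s <+: t → x s = y s)
    (i : ℕ) : blockSum 𝕜 ξ n x t i = blockSum 𝕜 ξ n y t i := by
  rw [blockSum_eq_pathSum, blockSum_eq_pathSum]
  refine pathSum_congr fun s _ hst => ?_
  by_cases hs : s.map Prod.fst ∈ Gam ξ n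
  · rw [h s hs hst]
  · rw [coef, if_neg fun hLam => hs (Lam_subset _ _ _ hLam)]
    simp

theorem lt_of_prefix {β : Ordinal.{v}} {s r : List (Ordinal.{v} × D)}
    (hs : ∀ η ∈ s.map Prod.fst, η < β) (h : r <+: s) : ∀ η ∈ r.map Prod.fst, η < β :=
  fun η hη => hs η ((h.map Prod.fst).mem hη)

theorem blockSum_shiftFst_append_one {ξ : Ordinal.{v}} {n : ℕ} (x : List (Ordinal.{v} × D) → X)
    (t : List (Ordinal.{v} × D)) {s : List (Ordinal.{v} × D)} (hs : s.map Prod.fst ∈ Gam ξ n) :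
    blockSum 𝕜 ξ (n + 1) x (shiftFst (ω ^ ξ * (n : Ordinal.{v})) t ++ s) 1 =
      blockSum 𝕜 ξ 1 (fun r => x (shiftFst (ω ^ ξ * (n : Ordinal.{v})) r)) t 1 := by
  rw [blockSum_eq_pathSum, blockSum_eq_pathSum, pathSum_append, pathSum_shiftFst,
    pathSum_eq_zero (t := s), add_zero]
  · refine pathSum_congr fun r _ _ => ?_
    rw [map_fst_shiftFst, coef_shift_one]
  · intro r hr hrs
    rw [List.map_append, map_fst_shiftFst, coef_shift_append_one (by simpa using hr)
      (lt_of_prefix (lt_of_mem_Gam hs) hrs), RCLike.ofReal_zero, zero_smul]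

theorem blockSum_shiftFst_append_add_two {ξ : Ordinal.{v}} {n : ℕ}
    (x : List (Ordinal.{v} × D) → X) {t s : List (Ordinal.{v} × D)}
    (ht : t.map Prod.fst ∈ maxNodes (GammaOne ξ)) (hs : s.map Prod.fst ∈ Gam ξ n) (i : ℕ) :
    blockSum 𝕜 ξ (n + 1) x (shiftFst (ω ^ ξ * (n : Ordinal.{v})) t ++ s) (i + 2) =
      blockSum 𝕜 ξ n (fun r => x (shiftFst (ω ^ ξ * (n : Ordinal.{v})) t ++ r)) s (i + 1) := by
  rw [blockSum_eq_pathSum, blockSum_eq_pathSum, pathSum_append, pathSum_shiftFst,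
    pathSum_eq_zero (t := t), zero_add]
  · refine pathSum_congr fun r _ hrs => ?_
    rw [List.map_append, map_fst_shiftFst,
      coef_shift_append_add_two ht (lt_of_prefix (lt_of_mem_Gam hs) hrs)]
  · intro r _ _
    rw [map_fst_shiftFst, coef_shift_add_two, RCLike.ofReal_zero, zero_smul]

theorem blockSum_zero (x : List (Ordinal.{v} × D) → X) (d : D) :
    blockSum 𝕜 (0 : Ordinal.{v}) 1 x [(0, d)] 1 = x [(0, d)] := by
  rw [blockSum_eq_pathSum]
  simp [pathSum, coef_one_one, weight_eq HasWeight.zero]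

theorem blockSum_add_one {ξ : Ordinal.{v}} {n : ℕ} (x : List (Ordinal.{v} × D) → X)
    {t : List (Ordinal.{v} × D)} (ht : t.map Prod.fst ∈ Gam ξ n) :
    blockSum 𝕜 (ξ + 1) 1 x t 1 = ∑ i : Fin n, (1 / n : 𝕜) • blockSum 𝕜 ξ n x t (i + 1) := by
  simp only [blockSum_eq_pathSum, smul_pathSum, sum_pathSum]
  refine pathSum_congr fun s hs hst => ?_
  rw [coef_add_one ht (head?_eq_of_prefix (hst.map Prod.fst) (by simpa using hs))]
  simp [Finset.sum_smul, mul_smul]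

theorem blockSum_shiftFst_limit {ξ ζ : Ordinal.{v}} (hξ : Order.IsSuccLimit ξ) (hζ : ζ < ξ)
    (x : List (Ordinal.{v} × D) → X) {t : List (Ordinal.{v} × D)}
    (ht : t.map Prod.fst ∈ GammaOne (ζ + 1)) :
    blockSum 𝕜 ξ 1 x (shiftFst (ω ^ ζ) t) 1 =
      blockSum 𝕜 (ζ + 1) 1 (fun r => x (shiftFst (ω ^ ζ) r)) t 1 := by
  rw [blockSum_eq_pathSum, blockSum_eq_pathSum, pathSum_shiftFst]
  refine pathSum_congr fun s hs hst => ?_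
  rw [map_fst_shiftFst, coef_limit hξ hζ ht
    (head?_eq_of_prefix (hst.map Prod.fst) (by simpa using hs))]

/-- The vector `a₁ z₁^t + ⋯ + aₙ zₙ^t`. -/
def combo (ξ : Ordinal.{v}) (n : ℕ) (x : List (Ordinal.{v} × D) → X) (a : Fin n → 𝕜)
    (t : List (Ordinal.{v} × D)) : X :=
  ∑ i : Fin n, a i • blockSum 𝕜 ξ n x t (i + 1)

theorem combo_one {ξ : Ordinal.{v}} (x : List (Ordinal.{v} × D) → X) (a : Fin 1 → 𝕜)
    (t : List (Ordinal.{v} × D)) : combo ξ 1 x a t = a 0 • blockSum 𝕜 ξ 1 x t 1 := by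
  simp [combo]

theorem combo_shiftFst_append {ξ : Ordinal.{v}} {n : ℕ} (x : List (Ordinal.{v} × D) → X)
    (a : Fin (n + 1) → 𝕜) {t s : List (Ordinal.{v} × D)}
    (ht : t.map Prod.fst ∈ maxNodes (GammaOne ξ)) (hs : s.map Prod.fst ∈ Gam ξ n) :
    combo ξ (n + 1) x a (shiftFst (ω ^ ξ * (n : Ordinal.{v})) t ++ s) =
      a 0 • blockSum 𝕜 ξ 1 (fun r => x (shiftFst (ω ^ ξ * (n : Ordinal.{v})) r)) t 1 +
        combo ξ n (fun r => x (shiftFst (ω ^ ξ * (n : Ordinal.{v})) t ++ r))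
          (fun i => a i.succ) s := by
  rw [combo, Fin.sum_univ_succ, combo]
  simp only [Fin.val_zero, zero_add, Fin.val_succ, add_assoc, one_add_one_eq_two,
    blockSum_shiftFst_append_one x t hs, blockSum_shiftFst_append_add_two x ht hs]

theorem smul_blockSum_add_one {ξ : Ordinal.{v}} {n : ℕ} (x : List (Ordinal.{v} × D) → X) (a : 𝕜)
    {t : List (Ordinal.{v} × D)} (ht : t.map Prod.fst ∈ Gam ξ n) :
    a • blockSum 𝕜 (ξ + 1) 1 x t 1 = combo ξ n x (fun _ => a / n) t := by
  simp only [blockSum_add_one x ht, Finset.smul_sum, smul_smul, mul_one_div, combo]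

end Blocks

/-! ### The operators bound the infima over branches -/

section Upper

variable {𝕜 : Type w} [RCLike 𝕜] {X : Type u} [NormedAddCommGroup X] [NormedSpace 𝕜 X]
  {D : Type u} [Preorder D]

/-- A weakly null collection in the unit ball. -/
structure IsBallTree (𝕜 : Type w) [RCLike 𝕜] {X : Type u} [NormedAddCommGroup X] [NormedSpace 𝕜 X]
    {D : Type u} [Preorder D] (T : Set (List Ordinal.{v})) (x : List (Ordinal.{v} × D) → X) :
    Prop where
  norm_le : ∀ t ∈ prodTree T D, ‖x t‖ ≤ 1
  isWeaklyNull : IsWeaklyNull 𝕜 T x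

/-- The operator `op 𝕜 ξ` dominates the infimum over the branches of every collection on `Γ_{ξ,1}`,
for all payoff functions with Lipschitz constant `R`. -/
def OpDominatesTrees (𝕜 : Type w) [RCLike 𝕜] (X : Type u) [NormedAddCommGroup X] [NormedSpace 𝕜 X]
    (D : Type u) [Preorder D] (R : ℝ≥0) (ξ : Ordinal.{v}) : Prop :=
  ∀ x : List (Ordinal.{v} × D) → X, IsBallTree 𝕜 (GammaOne ξ) x → ∀ (a : 𝕜) (g : X → ℝ),
    LipschitzWith R g → ∀ (x₀ : X) (c : ℝ), op 𝕜 ξ ‖a‖₊ g x₀ < c →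
      ∃ t : List (Ordinal.{v} × D), t.map Prod.fst ∈ maxNodes (GammaOne ξ) ∧
        g (x₀ + a • blockSum 𝕜 ξ 1 x t 1) < c

theorem exists_norm_eq_one_and_norm_mul_eq (a : 𝕜) :
    ∃ σ : 𝕜, ‖σ‖ = 1 ∧ ((‖a‖ : ℝ) : 𝕜) * σ = a := by
  rcases eq_or_ne a 0 with rfl | ha
  · exact ⟨1, by simp, by simp⟩
  · have norm_ne : ((‖a‖ : ℝ) : 𝕜) ≠ 0 := by simpa using ha
    exact ⟨a / (‖a‖ : ℝ), by simp [ha], by field_simp⟩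

namespace IsBallTree

variable {T T' : Set (List Ordinal.{v})} {x : List (Ordinal.{v} × D) → X}

theorem subset (hx : IsBallTree 𝕜 T x) (hT : T' ⊆ T) : IsBallTree 𝕜 T' x :=
  ⟨fun t ht => hx.norm_le t (hT ht), fun t ζ ht => hx.isWeaklyNull t ζ (hT ht)⟩

theorem comp_shiftFst (hx : IsBallTree 𝕜 T x) (β : Ordinal.{v}) (hT : ∀ t ∈ T', shift β t ∈ T) :
    IsBallTree 𝕜 T' fun r => x (shiftFst β r) where
  norm_le t ht := hx.norm_le _ <| by
    simpa only [prodTree, Set.mem_ofPred_eq, map_fst_shiftFst] using hT _ ht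
  isWeaklyNull t ζ ht f := by
    simpa only [shiftFst, List.map_append, List.map_singleton] using
      hx.isWeaklyNull (shiftFst β t) (β + ζ) (by
        simpa only [map_fst_shiftFst, shift, List.map_append, List.map_singleton] using hT _ ht) f

theorem comp_append (hx : IsBallTree 𝕜 T x) (s : List (Ordinal.{v} × D))
    (hT : ∀ t ∈ T', s.map Prod.fst ++ t ∈ T) : IsBallTree 𝕜 T' fun r => x (s ++ r) where
  norm_le t ht := hx.norm_le _ <| by
    simpa only [prodTree, Set.mem_ofPred_eq, List.map_append] using hT _ ht
  isWeaklyNull t ζ ht f := by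
    simpa only [List.append_assoc] using hx.isWeaklyNull (s ++ t) ζ
      (by simpa only [List.map_append, List.append_assoc] using hT _ ht) f

end IsBallTree

variable {R : ℝ≥0}

theorem OpDominatesTrees.exists_combo_lt {ξ : Ordinal.{v}} (h : OpDominatesTrees 𝕜 X D R ξ) (n : ℕ)
    {x : List (Ordinal.{v} × D) → X} (hx : IsBallTree 𝕜 (Gam ξ (n + 1)) x) (a : Fin (n + 1) → 𝕜)
    {g : X → ℝ} (hg : LipschitzWith R g) (x₀ : X) {c : ℝ}
    (hc : (List.ofFn fun i => ‖a i‖₊).foldr (op 𝕜 ξ) g x₀ < c) :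
    ∃ t : List (Ordinal.{v} × D), t.map Prod.fst ∈ maxNodes (Gam ξ (n + 1)) ∧
      g (x₀ + combo ξ (n + 1) x a t) < c := by
  induction n generalizing x x₀ with
  | zero =>
    simp only [zero_add, Gam_one] at hx ⊢
    obtain ⟨t, ht, hlt⟩ := h x hx (a 0) g hg x₀ c (by simpa using hc)
    exact ⟨t, ht, by rwa [← combo_one] at hlt⟩
  | succ n ih =>
    rw [List.ofFn_succ, List.foldr_cons] at hc
    set β : Ordinal.{v} := ω ^ ξ * ((n + 1 : ℕ) : Ordinal.{v}) with hβ
    obtain ⟨t, ht, hlt⟩ := h _ (hx.comp_shiftFst β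
      fun t ht => mem_Gam_add_one.2 (.inl ⟨t, ht, rfl⟩)) (a 0) _
      ((isStepOperator_op 𝕜 ξ).lipschitz_foldr (List.ofFn fun i => ‖a (Fin.succ i)‖₊) hg) x₀ c hc
    have hx_above : IsBallTree 𝕜 (Gam ξ (n + 1)) fun r => x (shiftFst β t ++ r) :=
      hx.comp_append _ fun s hs =>
        mem_Gam_add_one.2 (.inr ⟨_, ht, s, hs, by rw [map_fst_shiftFst]⟩)
    obtain ⟨s, hs, hlt'⟩ := ih hx_above (fun i => a i.succ) _ hlt
    refine ⟨shiftFst β t ++ s, ?_, ?_⟩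
    · rw [List.map_append, map_fst_shiftFst]
      exact shift_append_mem_maxNodes ht hs
    · rwa [hβ, combo_shiftFst_append x a ht hs.1, ← add_assoc]

theorem opDominatesTrees_zero [IsDirectedOrder D] [Nonempty D] :
    OpDominatesTrees 𝕜 X D R (0 : Ordinal.{v}) := by
  intro x hx a g hg x₀ c hc
  rw [op_zero] at hc
  obtain ⟨σ, hσ, hσa⟩ := exists_norm_eq_one_and_norm_mul_eq a
  have tendsto_ball : Tendsto (fun d : D => σ • x [(0, d)]) atTop (ballFilter 𝕜 X) := by
    refine (tendsto_ballFilter 𝕜).2 ⟨fun f => ?_, .of_forall fun d => ?_⟩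
    · simpa using (hx.isWeaklyNull [] 0 (by simp [GammaOne_zero]) f).const_mul σ
    · rw [norm_smul, hσ, one_mul]
      exact hx.norm_le _ (by simp [prodTree, GammaOne_zero])
  obtain ⟨d, hd⟩ := (tendsto_ball.eventually (eventually_lt_of_baseOp_lt hg hc)).exists
  refine ⟨[(0, d)], by simp [maxNodes_GammaOne_zero], ?_⟩
  rwa [blockSum_zero, ← hσa, mul_smul]

theorem OpDominatesTrees.add_one {ξ : Ordinal.{v}} (h : OpDominatesTrees 𝕜 X D R ξ) :
    OpDominatesTrees 𝕜 X D R (ξ + 1) := by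
  intro x hx a g hg x₀ c hc
  rw [op_add_one] at hc
  obtain ⟨n, hn⟩ := exists_lt_of_ciInf_lt hc
  have hx_Gam : IsBallTree 𝕜 (Gam ξ (n + 1)) x := hx.subset <| by
    rw [GammaOne_add_one]
    exact Set.subset_iUnion (fun n => Gam ξ n) (n + 1)
  have nnnorm_div_eq : ‖a / ((n + 1 : ℕ) : 𝕜)‖₊ = ‖a‖₊ / (n + 1) := by
    rw [nnnorm_div, RCLike.nnnorm_natCast, Nat.cast_add_one]
  obtain ⟨t, ht, hlt⟩ := h.exists_combo_lt n hx_Gam (fun _ => a / ((n + 1 : ℕ) : 𝕜)) hg x₀ (c := c)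
    (by rwa [List.ofFn_const, nnnorm_div_eq])
  refine ⟨t, (mem_maxNodes_GammaOne_add_one ht.1).2 ht, ?_⟩
  rwa [smul_blockSum_add_one x a ht.1]

theorem OpDominatesTrees.limit {ξ : Ordinal.{v}} (hξ : Order.IsSuccLimit ξ)
    (h : ∀ ζ < ξ, OpDominatesTrees 𝕜 X D R (ζ + 1)) : OpDominatesTrees 𝕜 X D R ξ := by
  intro x hx a g hg x₀ c hc
  rw [op_limit 𝕜 hξ] at hc
  have : Nonempty (Set.Iio ξ) := ⟨⟨0, hξ.bot_lt⟩⟩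
  obtain ⟨⟨ζ, hζ⟩, hc'⟩ := exists_lt_of_ciInf_lt hc
  have hx_shift : IsBallTree 𝕜 (GammaOne (ζ + 1)) fun r => x (shiftFst (ω ^ ζ) r) :=
    hx.comp_shiftFst _ fun t ht => by
      rw [GammaOne_limit hξ]
      exact ⟨ζ, hζ, t, ht, rfl⟩
  obtain ⟨t, ht, hlt⟩ := h ζ hζ _ hx_shift a g hg x₀ c hc'
  refine ⟨shiftFst (ω ^ ζ) t, ?_, ?_⟩
  · rw [map_fst_shiftFst]
    exact (shift_mem_maxNodes_limit hξ hζ ht.1).2 ht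
  · rwa [blockSum_shiftFst_limit hξ hζ x ht.1]

theorem opDominatesTrees [IsDirectedOrder D] [Nonempty D] (ξ : Ordinal.{v}) :
    OpDominatesTrees 𝕜 X D R ξ := by
  induction ξ using Ordinal.limitRecOn with
  | zero => exact opDominatesTrees_zero
  | add_one ξ ih => exact ih.add_one
  | limit ξ hξ ih => exact .limit hξ fun ζ hζ => ih _ (hξ.add_one_lt hζ)

end Upper

/-! ### The operators are attained by collections on the trees -/

section Lower

variable (𝕜 : Type w) [RCLike 𝕜] (X : Type u) [NormedAddCommGroup X] [NormedSpace 𝕜 X]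

/-- The directed set of weak neighbourhoods of `0` in the unit ball. -/
abbrev NhdDir : Type u := {U : Set X // U ∈ ballFilter 𝕜 X}ᵒᵈ

instance : Nonempty (NhdDir 𝕜 X) := ⟨OrderDual.toDual ⟨Set.univ, univ_mem⟩⟩

instance : IsDirectedOrder (NhdDir 𝕜 X) :=
  ⟨fun U V => ⟨OrderDual.toDual ⟨U.ofDual.1 ∩ V.ofDual.1, inter_mem U.ofDual.2 V.ofDual.2⟩,
    Set.inter_subset_left, Set.inter_subset_right⟩⟩

variable {𝕜 X}

/-- The vectors of the collection lie in the unit ball and in the weak neighbourhoods that index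
them, so that the collection is weakly null on every tree. -/
def IsAdapted (x : List (Ordinal.{v} × NhdDir 𝕜 X) → X) : Prop :=
  ∀ t p, x (t ++ [p]) ∈ p.2.ofDual.1 ∧ ‖x (t ++ [p])‖ ≤ 1

/-- Almost optimal collections for the operator `op 𝕜 ξ` exist on `Γ_{ξ,1}`, for all payoff
functions with Lipschitz constant `R`. -/
def OpAttainedOnTrees (𝕜 : Type w) [RCLike 𝕜] (X : Type u) [NormedAddCommGroup X]
    [NormedSpace 𝕜 X] (R : ℝ≥0) (ξ : Ordinal.{v}) : Prop :=
  ∀ (a : ℝ≥0) (g : X → ℝ), LipschitzWith R g → ∀ (x₀ : X) (c : ℝ), c < op 𝕜 ξ a g x₀ →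
    ∃ x : List (Ordinal.{v} × NhdDir 𝕜 X) → X, IsAdapted x ∧
      ∀ t, t.map Prod.fst ∈ maxNodes (GammaOne ξ) →
        c < g (x₀ + ((a : ℝ) : 𝕜) • blockSum 𝕜 ξ 1 x t 1)

theorem IsAdapted.isBallTree {x : List (Ordinal.{v} × NhdDir 𝕜 X) → X} (hx : IsAdapted x)
    {T : Set (List Ordinal.{v})} (hT : [] ∉ T) : IsBallTree 𝕜 T x where
  norm_le t ht := by
    have ht_ne : t ≠ [] := by
      rintro rfl
      exact hT ht
    rw [← List.dropLast_append_getLast ht_ne]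
    exact (hx _ _).2
  isWeaklyNull t ζ _ f V hV := by
    have hU : f ⁻¹' V ∈ ballFilter 𝕜 X := tendsto_ballFilter_apply 𝕜 f hV
    exact mem_atTop_sets.2 ⟨OrderDual.toDual ⟨_, hU⟩, fun d hd => hd (hx t (ζ, d)).1⟩

theorem exists_isAdapted_of_frequently {P : X → Prop} (h : ∃ᶠ y in ballFilter 𝕜 X, P y) :
    ∃ x : List (Ordinal.{v} × NhdDir 𝕜 X) → X, IsAdapted x ∧ ∀ t p, P (x (t ++ [p])) := by
  have exists_in_nhd (d : NhdDir 𝕜 X) : ∃ y, P y ∧ y ∈ d.ofDual.1 ∧ ‖y‖ ≤ 1 :=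
    (h.and_eventually (Eventually.and (p := (· ∈ d.ofDual.1)) d.ofDual.2
      (eventually_ballFilter_norm_le 𝕜))).exists
  choose y hPy hy using exists_in_nhd
  exact ⟨fun t => (t.getLast?.map fun p => y p.2).getD 0, fun t p => by simpa using hy p.2,
    fun t p => by simpa using hPy p.2⟩

section Glue

variable {X D : Type*} {β : Ordinal.{v}}

/-- The left inverse `t ↦ t - β` of `shiftFst β`. -/
def unshiftFst (β : Ordinal.{v}) (t : List (Ordinal.{v} × D)) : List (Ordinal.{v} × D) :=
  t.map fun p => (p.1 - β, p.2)

@[simp]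
theorem unshiftFst_shiftFst (β : Ordinal.{v}) (t : List (Ordinal.{v} × D)) :
    unshiftFst β (shiftFst β t) = t := by
  simp [unshiftFst, shiftFst, Function.comp_def]

theorem le_of_mem_shiftFst {t : List (Ordinal.{v} × D)} {p : Ordinal.{v} × D}
    (hp : p ∈ shiftFst β t) : β ≤ p.1 := by
  obtain ⟨q, -, rfl⟩ := List.mem_map.1 hp
  exact le_self_add

open Classical in
/-- The collection equal to `x` on the level `β + T`, and to `y t` above the member `β + t` of this
level; the entries of the sequences above `β + t` are less than `β`. -/
def glue (β : Ordinal.{v}) (x : List (Ordinal.{v} × D) → X)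
    (y : List (Ordinal.{v} × D) → List (Ordinal.{v} × D) → X) (r : List (Ordinal.{v} × D)) : X :=
  if ∀ p ∈ r.getLast?, β ≤ p.1 then x (unshiftFst β r)
  else y (unshiftFst β (r.filter fun p => β ≤ p.1)) (r.filter fun p => ¬ β ≤ p.1)

theorem glue_shiftFst (x : List (Ordinal.{v} × D) → X)
    (y : List (Ordinal.{v} × D) → List (Ordinal.{v} × D) → X) (t : List (Ordinal.{v} × D)) :
    glue β x y (shiftFst β t) = x t := by
  have le_getLast : ∀ p ∈ (shiftFst β t).getLast?, β ≤ p.1 :=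
    fun p hp => le_of_mem_shiftFst (List.mem_of_mem_getLast? hp)
  rw [glue, if_pos le_getLast, unshiftFst_shiftFst]

theorem glue_shiftFst_append (x : List (Ordinal.{v} × D) → X)
    (y : List (Ordinal.{v} × D) → List (Ordinal.{v} × D) → X) (t : List (Ordinal.{v} × D))
    {s : List (Ordinal.{v} × D)} (hs_ne : s ≠ []) (hs : ∀ η ∈ s.map Prod.fst, η < β) :
    glue β x y (shiftFst β t ++ s) = y t s := by
  have lt_of_mem : ∀ p ∈ s, p.1 < β := fun p hp => hs _ (List.mem_map_of_mem hp)
  have getLast_lt : ¬ ∀ p ∈ (shiftFst β t ++ s).getLast?, β ≤ p.1 := by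
    rw [List.getLast?_append_of_ne_nil _ hs_ne, List.getLast?_eq_some_getLast hs_ne]
    simpa using lt_of_mem _ (List.getLast_mem hs_ne)
  rw [glue, if_neg getLast_lt, List.filter_append, List.filter_append,
    List.filter_eq_self.2 fun p hp => decide_eq_true (le_of_mem_shiftFst hp),
    List.filter_eq_nil_iff.2 (by simpa using lt_of_mem),
    List.filter_eq_nil_iff.2 fun p hp => by simpa using le_of_mem_shiftFst hp,
    List.filter_eq_self.2 (by simpa using lt_of_mem), List.append_nil, List.nil_append,
    unshiftFst_shiftFst]

end Glue

namespace IsAdapted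

theorem comp_unshiftFst {x : List (Ordinal.{v} × NhdDir 𝕜 X) → X} (hx : IsAdapted x)
    (β : Ordinal.{v}) : IsAdapted fun r => x (unshiftFst β r) := fun t p => by
  simpa [unshiftFst] using hx (unshiftFst β t) (p.1 - β, p.2)

theorem choice {ι : Type*} {y : ι → List (Ordinal.{v} × NhdDir 𝕜 X) → X}
    (hy : ∀ i, IsAdapted (y i)) (N : List (Ordinal.{v} × NhdDir 𝕜 X) → ι) :
    IsAdapted fun r => y (N r) r :=
  fun _ _ => hy _ _ _

theorem glue (β : Ordinal.{v}) {x : List (Ordinal.{v} × NhdDir 𝕜 X) → X} (hx : IsAdapted x)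
    {y : List (Ordinal.{v} × NhdDir 𝕜 X) → List (Ordinal.{v} × NhdDir 𝕜 X) → X}
    (hy : ∀ t, IsAdapted (y t)) : IsAdapted (glue β x y) := by
  intro r p
  by_cases hp : β ≤ p.1
  · simpa [SzlenkSum.glue, hp] using hx.comp_unshiftFst β r p
  · simpa [SzlenkSum.glue, hp, not_le.1 hp] using hy (unshiftFst β _) _ p

end IsAdapted

theorem combo_glue {ξ : Ordinal.{v}} {n : ℕ} {D : Type u} (x : List (Ordinal.{v} × D) → X)
    (y : List (Ordinal.{v} × D) → List (Ordinal.{v} × D) → X) (a : Fin (n + 1) → 𝕜)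
    {t s : List (Ordinal.{v} × D)} (ht : t.map Prod.fst ∈ maxNodes (GammaOne ξ))
    (hs : s.map Prod.fst ∈ Gam ξ n) :
    combo ξ (n + 1) (glue (ω ^ ξ * (n : Ordinal.{v})) x y) a
        (shiftFst (ω ^ ξ * (n : Ordinal.{v})) t ++ s) =
      a 0 • blockSum 𝕜 ξ 1 x t 1 + combo ξ n (y t) (fun i => a i.succ) s := by
  rw [combo_shiftFst_append _ a ht hs]
  simp only [glue_shiftFst]
  congr 1
  refine Finset.sum_congr rfl fun i _ => congrArg _ (blockSum_congr (fun r hr _ => ?_) _)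
  exact glue_shiftFst_append _ _ _ (by simpa using ne_nil_of_mem_Gam hr) (lt_of_mem_Gam hr)

variable {R : ℝ≥0} {ξ : Ordinal.{v}}

theorem OpAttainedOnTrees.exists_lt_combo (h : OpAttainedOnTrees 𝕜 X R ξ) (n : ℕ)
    (a : Fin (n + 1) → ℝ≥0) {g : X → ℝ} (hg : LipschitzWith R g) (x₀ : X) {c : ℝ}
    (hc : c < (List.ofFn a).foldr (op 𝕜 ξ) g x₀) :
    ∃ x : List (Ordinal.{v} × NhdDir 𝕜 X) → X, IsAdapted x ∧
      ∀ t, t.map Prod.fst ∈ maxNodes (Gam ξ (n + 1)) →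
        c < g (x₀ + combo ξ (n + 1) x (fun i => ((a i : ℝ) : 𝕜)) t) := by
  induction n generalizing x₀ with
  | zero =>
    simp only [zero_add, Gam_one]
    obtain ⟨x, hx, hxc⟩ := h (a 0) g hg x₀ c (by simpa using hc)
    exact ⟨x, hx, fun t ht => by rw [combo_one]; exact hxc t ht⟩
  | succ n ih =>
    rw [List.ofFn_succ, List.foldr_cons] at hc
    obtain ⟨x, hx, hxc⟩ := h (a 0) _
      ((isStepOperator_op 𝕜 ξ).lipschitz_foldr (List.ofFn fun i => a (Fin.succ i)) hg) x₀ c hc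
    have exists_above (t : List (Ordinal.{v} × NhdDir 𝕜 X)) :
        ∃ y : List (Ordinal.{v} × NhdDir 𝕜 X) → X, IsAdapted y ∧
          (t.map Prod.fst ∈ maxNodes (GammaOne ξ) →
            ∀ s, s.map Prod.fst ∈ maxNodes (Gam ξ (n + 1)) →
              c < g (x₀ + ((a 0 : ℝ) : 𝕜) • blockSum 𝕜 ξ 1 x t 1 +
                combo ξ (n + 1) y (fun i => ((a i.succ : ℝ) : 𝕜)) s)) := by
      by_cases ht : t.map Prod.fst ∈ maxNodes (GammaOne ξ)
      · obtain ⟨y, hy, hyc⟩ := ih (fun i => a i.succ) _ (hxc t ht)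
        exact ⟨y, hy, fun _ => hyc⟩
      · exact ⟨x, hx, fun h => absurd h ht⟩
    choose y hy hyc using exists_above
    refine ⟨_, hx.glue (ω ^ ξ * ((n + 1 : ℕ) : Ordinal.{v})) hy, fun r hr => ?_⟩
    obtain ⟨_, ht, _, hs, hr_eq⟩ := exists_eq_shift_append_of_mem_maxNodes hr
    obtain ⟨t, s, rfl, rfl, rfl⟩ := exists_shiftFst_append_eq hr_eq
    rw [combo_glue x y _ ht hs.1, ← add_assoc]
    exact hyc t ht s hs

theorem opAttainedOnTrees_zero : OpAttainedOnTrees 𝕜 X R (0 : Ordinal.{v}) := by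
  intro a g hg x₀ c hc
  rw [op_zero] at hc
  obtain ⟨x, hx, hxc⟩ := exists_isAdapted_of_frequently.{u, v, w} (frequently_lt_of_lt_baseOp hg hc)
  refine ⟨x, hx, fun t ht => ?_⟩
  rw [maxNodes_GammaOne_zero, Set.mem_singleton_iff] at ht
  obtain ⟨⟨_, d⟩, rfl, rfl⟩ := List.map_eq_singleton_iff.1 ht
  rw [blockSum_zero]
  exact hxc [] _

theorem exists_index_of_disjoint {α ι : Type*} [Nonempty ι] {T : ι → Set α}
    (hT : ∀ i j t, t ∈ T i → t ∈ T j → i = j) : ∃ N : α → ι, ∀ i, ∀ t ∈ T i, N t = i :=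
  ⟨fun t => Classical.epsilon fun i => t ∈ T i, fun i t ht =>
    hT _ _ t (Classical.epsilon_spec (p := fun i => t ∈ T i) ⟨i, ht⟩) ht⟩

theorem OpAttainedOnTrees.add_one (h : OpAttainedOnTrees 𝕜 X R ξ) :
    OpAttainedOnTrees 𝕜 X R (ξ + 1) := by
  intro a g hg x₀ c hc
  rw [op_add_one] at hc
  have exists_on_Gam (n : ℕ) : ∃ x : List (Ordinal.{v} × NhdDir 𝕜 X) → X, IsAdapted x ∧
      ∀ t, t.map Prod.fst ∈ maxNodes (Gam ξ (n + 1)) →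
        c < g (x₀ + combo ξ (n + 1) x (fun _ => (((a / (n + 1) : ℝ≥0) : ℝ) : 𝕜)) t) := by
    refine h.exists_lt_combo n (fun _ => a / (n + 1)) hg x₀ ?_
    rw [List.ofFn_const]
    exact hc.trans_le ((isStepOperator_op 𝕜 ξ).succOp_le_subdivide n a hg x₀)
  choose y hy hyc using exists_on_Gam
  obtain ⟨N, hN⟩ := exists_index_of_disjoint (T := fun n : ℕ => Gam ξ (n + 1))
    fun i j t hi hj => Nat.succ_injective (eq_of_mem_Gam_of_head?_eq hi hj rfl)
  refine ⟨_, IsAdapted.choice hy fun r => N (r.map Prod.fst), fun t ht => ?_⟩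
  obtain ⟨n, hn⟩ : ∃ n, t.map Prod.fst ∈ Gam ξ (n + 1) := by
    obtain ⟨m, hm⟩ := Set.mem_iUnion.1 (GammaOne_add_one ξ ▸ ht.1)
    cases m with
    | zero => simp [Gam_zero] at hm
    | succ m => exact ⟨m, hm⟩
  rw [smul_blockSum_add_one _ _ hn]
  convert hyc n t ((mem_maxNodes_GammaOne_add_one hn).1 ht) using 3
  refine Finset.sum_congr rfl fun i _ => congrArg₂ _ (by simp) ?_
  exact blockSum_congr (fun s hs _ => by rw [hN n _ hs]) _

theorem OpAttainedOnTrees.limit (hξ : Order.IsSuccLimit ξ)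
    (h : ∀ ζ < ξ, OpAttainedOnTrees 𝕜 X R (ζ + 1)) : OpAttainedOnTrees 𝕜 X R ξ := by
  intro a g hg x₀ c hc
  choose y hy hyc using fun ζ : Set.Iio ξ =>
    h ζ ζ.2 a g hg x₀ c (hc.trans_le (op_limit_le 𝕜 hξ ζ.2 a hg x₀))
  have : Nonempty (Set.Iio ξ) := ⟨⟨0, hξ.bot_lt⟩⟩
  obtain ⟨N, hN⟩ := exists_index_of_disjoint
    (T := fun ζ : Set.Iio ξ => shift (ω ^ ζ.1) '' GammaOne (ζ.1 + 1)) <| by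
      rintro ζ ζ' _ ⟨t, ht, rfl⟩ ⟨s, hs, hst⟩
      exact Subtype.ext (eq_of_mem_GammaOne_of_head?_eq ht hs (by rw [hst]))
  refine ⟨_, IsAdapted.choice (fun ζ => (hy ζ).comp_unshiftFst (ω ^ ζ.1))
    fun r => N (r.map Prod.fst), fun r hr => ?_⟩
  obtain ⟨ζ, hζ, s, hs, hr_eq⟩ : ∃ ζ < ξ, ∃ s ∈ GammaOne (ζ + 1),
      r.map Prod.fst = shift (ω ^ ζ) s := by
    have hr_mem := hr.1
    rwa [GammaOne_limit hξ] at hr_mem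
  obtain ⟨t, rfl, rfl⟩ := exists_shiftFst_eq hr_eq
  rw [map_fst_shiftFst, shift_mem_maxNodes_limit hξ hζ hs] at hr
  rw [blockSum_shiftFst_limit hξ hζ _ hs]
  convert hyc ⟨ζ, hζ⟩ t hr using 4
  refine blockSum_congr (fun q hq _ => ?_) _
  rw [map_fst_shiftFst, hN ⟨ζ, hζ⟩ _ ⟨_, mem_Gam_one.1 hq, rfl⟩, unshiftFst_shiftFst]

theorem opAttainedOnTrees (ξ : Ordinal.{v}) : OpAttainedOnTrees 𝕜 X R ξ := by
  induction ξ using Ordinal.limitRecOn with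
  | zero => exact opAttainedOnTrees_zero
  | add_one ξ ih => exact ih.add_one
  | limit ξ hξ ih => exact .limit hξ fun ζ hζ => ih _ (hξ.add_one_lt hζ)

end Lower

/-! ### The quantities `θ` and `α` -/

section Quantities

variable {𝕜 : Type w} [RCLike 𝕜] {X : Type u} [NormedAddCommGroup X] [NormedSpace 𝕜 X]
  {K : Set (WeakDual 𝕜 X)} {R : ℝ≥0}

theorem treeInf_le (hK : DualBdd R K) {ξ : Ordinal.{v}} {n : ℕ} {D : Type u} [Preorder D]
    [IsDirectedOrder D] [Nonempty D] {x : List (Ordinal.{v} × D) → X}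
    (hx : IsBallTree 𝕜 (Gam ξ (n + 1)) x) (a : Fin (n + 1) → 𝕜) {M : ℝ} (hM : 0 ≤ M)
    (h : (List.ofFn fun i => ‖a i‖₊).foldr (op 𝕜 ξ) (supportFun K) 0 ≤ M) :
    treeInf K ξ (n + 1) x a ≤ M := by
  refine le_of_forall_gt_imp_ge_of_dense fun c hc => ?_
  obtain ⟨t, ht, supportFun_lt⟩ := (opDominatesTrees ξ).exists_combo_lt n hx a
    hK.lipschitzWith_supportFun 0 (h.trans_lt hc)
  rw [zero_add] at supportFun_lt
  let value : maxNodes (prodTree (Gam ξ (n + 1)) D) → ℝ := fun t =>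
    supportFun K (combo ξ (n + 1) x a t.1)
  change iInf value ≤ c
  by_cases hb : BddBelow (Set.range value)
  · exact (ciInf_le hb ⟨t, mem_maxNodes_prodTree.2 ht⟩).trans supportFun_lt.le
  · rw [Real.iInf_of_not_bddBelow hb]
    exact hM.trans hc.le

theorem DualBdd.foldr_op_supportFun_nonneg (hK : DualBdd R K) (ξ : Ordinal.{v}) (l : List ℝ≥0) :
    0 ≤ l.foldr (op 𝕜 ξ) (supportFun K) 0 :=
  (supportFun_zero K).symm.trans_le
    ((isStepOperator_op 𝕜 ξ).self_le_foldr l hK.lipschitzWith_supportFun 0)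

/-- The set whose infimum is `θ_{ξ,n}(K)`. -/
def thetaSet (ξ : Ordinal.{v}) (n : ℕ) (K : Set (WeakDual 𝕜 X)) : Set ℝ :=
  {θ : ℝ | 0 < θ ∧
    ∀ (D : Type u) [Preorder D] [IsDirectedOrder D] [Nonempty D]
      (x : List (Ordinal.{v} × D) → X),
      (∀ t ∈ prodTree (Gam ξ n) D, ‖x t‖ ≤ 1) → IsWeaklyNull 𝕜 (Gam ξ n) x →
        treeInf K ξ n x (fun _ => (1 / n : 𝕜)) ≤ θ}

theorem bddBelow_thetaSet (ξ : Ordinal.{v}) (n : ℕ) (K : Set (WeakDual 𝕜 X)) :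
    BddBelow (thetaSet ξ n K) :=
  ⟨0, fun _ h => h.1.le⟩

theorem theta_nonneg (ξ : Ordinal.{v}) (n : ℕ) (K : Set (WeakDual 𝕜 X)) : 0 ≤ theta ξ n K :=
  Real.sInf_nonneg fun _ h => h.1.le

theorem mem_thetaSet (hK : DualBdd R K) {ξ : Ordinal.{v}} {n : ℕ} {c : ℝ} (hc : 0 < c)
    (h : subdivide (op 𝕜 ξ) n 1 (supportFun K) 0 ≤ c) : c ∈ thetaSet ξ (n + 1) K := by
  refine ⟨hc, fun D _ _ _ x hx hx' => treeInf_le hK ⟨hx, hx'⟩ _ hc.le ?_⟩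
  have nnnorm_eq : ‖(1 / ((n + 1 : ℕ) : 𝕜))‖₊ = 1 / ((n : ℝ≥0) + 1) := by
    rw [nnnorm_div, RCLike.nnnorm_natCast, nnnorm_one, Nat.cast_succ]
  rwa [List.ofFn_const, nnnorm_eq]

theorem theta_le_subdivide (hK : DualBdd R K) (ξ : Ordinal.{v}) (n : ℕ) :
    theta ξ (n + 1) K ≤ subdivide (op 𝕜 ξ) n 1 (supportFun K) 0 :=
  le_of_forall_gt_imp_ge_of_dense fun _ hc => csInf_le (bddBelow_thetaSet ξ (n + 1) K)
    (mem_thetaSet hK ((hK.foldr_op_supportFun_nonneg ξ _).trans_lt hc) hc.le)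

theorem combo_mul_left {D : Type u} (ξ : Ordinal.{v}) (n : ℕ) (x : List (Ordinal.{v} × D) → X)
    (c : 𝕜) (a : Fin n → 𝕜) (t : List (Ordinal.{v} × D)) :
    combo ξ n x (fun i => c * a i) t = c • combo ξ n x a t := by
  simp only [combo, mul_smul, Finset.smul_sum]

instance (ξ : Ordinal.{v}) (n : ℕ) (D : Type u) [Nonempty D] :
    Nonempty (maxNodes (prodTree (Gam ξ (n + 1)) D)) := by
  obtain ⟨t, ht⟩ := maxNodes_Gam_nonempty ξ n
  exact ⟨⟨t.map fun η => (η, Classical.arbitrary D), mem_maxNodes_prodTree.2 (by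
    simpa [Function.comp_def] using ht)⟩⟩

theorem subdivide_le_mul_of_mem_thetaSet (hK : DualBdd R K) {ξ : Ordinal.{v}} {n : ℕ} (b : ℝ≥0)
    {θ : ℝ} (hθ : θ ∈ thetaSet ξ (n + 1) K) :
    subdivide (op 𝕜 ξ) n b (supportFun K) 0 ≤ b * θ := by
  refine le_of_forall_lt_imp_le_of_dense fun c hc => ?_
  obtain ⟨x, hx, lt_supportFun⟩ := (opAttainedOnTrees (𝕜 := 𝕜) ξ).exists_lt_combo n
    (fun _ => b / (n + 1)) hK.lipschitzWith_supportFun 0 (c := c) (by rwa [List.ofFn_const])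
  have hx_ball := hx.isBallTree (T := Gam ξ (n + 1)) fun h => ne_nil_of_mem_Gam h rfl
  have coeff_eq : (((b / (n + 1) : ℝ≥0) : ℝ) : 𝕜) = ((b : ℝ) : 𝕜) * (1 / ((n + 1 : ℕ) : 𝕜)) := by
    push_cast
    ring
  calc c ≤ ⨅ t : maxNodes (prodTree (Gam ξ (n + 1)) (NhdDir 𝕜 X)),
        (b : ℝ) * supportFun K (combo ξ (n + 1) x (fun _ => 1 / ((n + 1 : ℕ) : 𝕜)) t.1) := by
        refine le_ciInf fun t => ?_
        rw [← supportFun_nnreal_smul, ← combo_mul_left, ← coeff_eq]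
        simpa only [zero_add] using (lt_supportFun t.1 (mem_maxNodes_prodTree.1 t.2)).le
    _ = b * treeInf K ξ (n + 1) x fun _ => (1 / ((n + 1 : ℕ) : 𝕜)) :=
        (Real.mul_iInf_of_nonneg b.coe_nonneg _).symm
    _ ≤ b * θ := by
        gcongr
        exact hθ.2 (NhdDir 𝕜 X) x hx_ball.1 hx_ball.2

theorem subdivide_le_mul_theta (hK : DualBdd R K) (ξ : Ordinal.{v}) (n : ℕ) (b : ℝ≥0) :
    subdivide (op 𝕜 ξ) n b (supportFun K) 0 ≤ b * theta ξ (n + 1) K := by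
  have nonempty : (thetaSet ξ (n + 1) K).Nonempty :=
    ⟨_, mem_thetaSet hK ((hK.foldr_op_supportFun_nonneg ξ _).trans_lt (lt_add_one _))
      (le_add_of_nonneg_right zero_le_one)⟩
  change _ ≤ (b : ℝ) • sInf (thetaSet ξ (n + 1) K)
  rw [← Real.sInf_smul_of_nonneg b.coe_nonneg]
  refine le_csInf nonempty.smul_set ?_
  rintro _ ⟨θ, hθ, rfl⟩
  exact subdivide_le_mul_of_mem_thetaSet hK b hθ

section HolderConjugate

variable (p q : ℝ≥0∞) [p.HolderConjugate q]

theorem toReal_one_div_add_toReal_one_div : (1 / p).toReal + (1 / q).toReal = 1 := by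
  rw [one_div, one_div, ← ENNReal.toReal_add, ENNReal.HolderConjugate.inv_add_inv_eq_one,
    ENNReal.toReal_one]
  · exact ENNReal.inv_ne_top.2 (ENNReal.HolderConjugate.ne_zero p q)
  · exact ENNReal.inv_ne_top.2 (ENNReal.HolderConjugate.ne_zero q p)

variable {p} in
theorem toReal_one_div_pos (hp : 1 < p) : 0 < (1 / q).toReal := by
  have lt_one : (1 / p).toReal < 1 := by
    rw [← ENNReal.toReal_one, one_div]
    exact ENNReal.toReal_strict_mono ENNReal.one_ne_top (ENNReal.inv_lt_one.2 hp)
  linarith [toReal_one_div_add_toReal_one_div p q]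

theorem sum_norm_le_rpow_mul_norm_toLp [Fact (1 ≤ p)] {n : ℕ} (a : Fin n → 𝕜) :
    ∑ i, ‖a i‖ ≤ (n : ℝ) ^ (1 / q).toReal * ‖(WithLp.toLp p a : PiLp p fun _ : Fin n => 𝕜)‖ := by
  have conj := toReal_one_div_add_toReal_one_div p q
  rcases eq_or_ne p ⊤ with rfl | hp_top
  · rw [ENNReal.div_top, ENNReal.toReal_zero, zero_add] at conj
    rw [conj, Real.rpow_one]
    calc ∑ i, ‖a i‖ ≤ ∑ _i : Fin n, ‖(WithLp.toLp ⊤ a : PiLp ⊤ fun _ : Fin n => 𝕜)‖ :=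
          Finset.sum_le_sum fun i _ => PiLp.norm_apply_le (WithLp.toLp ⊤ a) i
      _ = _ := by simp
  rcases eq_or_ne p 1 with rfl | hp_one
  · rw [div_one, ENNReal.toReal_one, add_eq_left] at conj
    rw [conj, Real.rpow_zero, one_mul, PiLp.norm_eq_of_L1]
  · have hp : 1 < p.toReal := by
      rw [← ENNReal.toReal_one]
      exact ENNReal.toReal_strict_mono hp_top (lt_of_le_of_ne Fact.out hp_one.symm)
    rw [PiLp.norm_eq_sum (zero_lt_one.trans hp)]
    simpa using Real.inner_le_Lp_mul_Lq Finset.univ (fun _ : Fin n => (1 : ℝ)) (fun i => ‖a i‖)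
      (ENNReal.HolderConjugate.toReal hp).symm

/-- The set whose infimum is `α_{ξ,p,n}(K)`. -/
def alphaSet (ξ : Ordinal.{v}) (p : ℝ≥0∞) (n : ℕ) (K : Set (WeakDual 𝕜 X)) : Set ℝ :=
  {α : ℝ | 0 < α ∧
    ∀ (D : Type u) [Preorder D] [IsDirectedOrder D] [Nonempty D] (a : Fin n → 𝕜)
      (x : List (Ordinal.{v} × D) → X),
      (∀ t ∈ prodTree (Gam ξ n) D, ‖x t‖ ≤ 1) → IsWeaklyNull 𝕜 (Gam ξ n) x →
        treeInf K ξ n x a ≤ α * ‖(WithLp.toLp p a : PiLp p fun _ : Fin n => 𝕜)‖}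

theorem mem_alphaSet (hR : 0 < R) (hK : DualBdd R K) (ξ : Ordinal.{v}) (n m : ℕ) :
    ((n + 1 : ℕ) : ℝ) ^ (1 / q).toReal * theta ξ (m + 1) K + 2 * R * (m + 1) ∈
      alphaSet ξ p (n + 1) K := by
  have : Fact (1 ≤ p) := ⟨ENNReal.HolderConjugate.one_le p q⟩
  have hθ := theta_nonneg ξ (m + 1) K
  refine ⟨by positivity, fun D _ _ _ a x hx hx' =>
    treeInf_le hK ⟨hx, hx'⟩ a (by positivity) ?_⟩
  set N := ‖(WithLp.toLp p a : PiLp p fun _ : Fin (n + 1) => 𝕜)‖₊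
  have le_subdivide := (isSubadditiveStepOperator_op 𝕜 ξ).foldr_le_subdivide_add
    hK.lipschitzWith_supportFun (l := List.ofFn fun i => ‖a i‖₊) (η := N)
    ((List.forall_mem_ofFn_iff).2 fun i => PiLp.nnnorm_apply_le (WithLp.toLp p a) i) m 0
  rw [List.sum_ofFn] at le_subdivide
  calc (List.ofFn fun i => ‖a i‖₊).foldr (op 𝕜 ξ) (supportFun K) 0
      ≤ (∑ i, ‖a i‖) * theta ξ (m + 1) K + 2 * R * N * m := by
        refine le_subdivide.trans ?_
        gcongr
        simpa using subdivide_le_mul_theta hK ξ m (∑ i, ‖a i‖₊)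
    _ ≤ ((n + 1 : ℕ) : ℝ) ^ (1 / q).toReal * N * theta ξ (m + 1) K + 2 * R * N * (m + 1) := by
        gcongr
        · exact sum_norm_le_rpow_mul_norm_toLp p q a
        · exact le_add_of_nonneg_right zero_le_one
    _ = (((n + 1 : ℕ) : ℝ) ^ (1 / q).toReal * theta ξ (m + 1) K + 2 * R * (m + 1)) * N := by
        ring

theorem alpha_le (hR : 0 < R) (hK : DualBdd R K) (ξ : Ordinal.{v}) (n m : ℕ) :
    alpha ξ p (n + 1) K ≤
      ((n + 1 : ℕ) : ℝ) ^ (1 / q).toReal * theta ξ (m + 1) K + 2 * R * (m + 1) :=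
  csInf_le ⟨0, fun _ h => h.1.le⟩ (mem_alphaSet p q hR hK ξ n m)

theorem theta_le_alpha_div (hR : 0 < R) (hK : DualBdd R K) (ξ : Ordinal.{v}) (n : ℕ) :
    theta ξ (n + 1) K ≤ alpha ξ p (n + 1) K / ((n + 1 : ℕ) : ℝ) ^ (1 / q).toReal := by
  have : Fact (1 ≤ p) := ⟨ENNReal.HolderConjugate.one_le p q⟩
  set N : ℝ := ((n + 1 : ℕ) : ℝ) with hN
  have hN_pos : 0 < N := by positivity
  have hNq_pos : 0 < N ^ (1 / q).toReal := by positivity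
  have norm_eq :
      ‖(WithLp.toLp p (fun _ => 1 / ((n + 1 : ℕ) : 𝕜)) : PiLp p fun _ : Fin (n + 1) => 𝕜)‖ =
        (N ^ (1 / q).toReal)⁻¹ := by
    have norm_const := PiLp.norm_toLp_const' (p := p) (ι := Fin (n + 1)) (1 / ((n + 1 : ℕ) : 𝕜))
    rw [norm_div, norm_one, RCLike.norm_natCast, Fintype.card_fin, ← hN] at norm_const
    refine norm_const.trans ?_
    rw [NNReal.coe_natCast, ← hN, one_div N, ← div_eq_mul_inv, div_eq_iff hN_pos.ne',
      ← div_eq_inv_mul, eq_div_iff hNq_pos.ne', ← Real.rpow_add hN_pos,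
      toReal_one_div_add_toReal_one_div, Real.rpow_one]
  rw [le_div_iff₀ hNq_pos]
  refine le_csInf ⟨_, mem_alphaSet p q hR hK ξ n n⟩ fun α hα => ?_
  rw [← le_div_iff₀ hNq_pos]
  refine csInf_le (bddBelow_thetaSet ξ (n + 1) K)
    ⟨div_pos hα.1 hNq_pos, fun D _ _ _ x hx hx' => ?_⟩
  rw [div_eq_mul_inv α, ← norm_eq]
  exact hα.2 D (fun _ => 1 / ((n + 1 : ℕ) : 𝕜)) x hx hx'

theorem iInf_theta_nonneg (ξ : Ordinal.{v}) (K : Set (WeakDual 𝕜 X)) :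
    0 ≤ ⨅ n : ℕ+, theta ξ n K :=
  Real.iInf_nonneg fun n => theta_nonneg ξ n K

theorem iInf_theta_le (ξ : Ordinal.{v}) (K : Set (WeakDual 𝕜 X)) (n : ℕ) :
    ⨅ n : ℕ+, theta ξ n K ≤ theta ξ (n + 1) K :=
  ciInf_le ⟨0, Set.forall_mem_range.2 fun n : ℕ+ => theta_nonneg ξ n K⟩ n.succPNat

variable {p} in
theorem tendsto_alpha_div (hp : 1 < p) (hR : 0 < R) (hK : DualBdd R K) (ξ : Ordinal.{v}) :
    Tendsto (fun n : ℕ => alpha ξ p n K / (n : ℝ) ^ (1 / q).toReal) atTop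
      (𝓝 (⨅ n : ℕ+, theta ξ n K)) := by
  refine (tendsto_add_atTop_iff_nat 1).1 (tendsto_order.2 ⟨fun c hc => ?_, fun c hc => ?_⟩)
  · exact .of_forall fun n => hc.trans_le
      ((iInf_theta_le ξ K n).trans (theta_le_alpha_div p q hR hK ξ n))
  · obtain ⟨m, hm⟩ := exists_lt_of_ciInf_lt hc
    rw [← m.natPred_add_one] at hm
    have tendsto_rpow : Tendsto (fun n : ℕ => ((n + 1 : ℕ) : ℝ) ^ (1 / q).toReal) atTop atTop :=
      ((tendsto_rpow_atTop (toReal_one_div_pos q hp)).comp tendsto_natCast_atTop_atTop).comp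
        (tendsto_add_atTop_nat 1)
    have tendsto_bound :=
      (tendsto_rpow.const_div_atTop (2 * R * (m.natPred + 1))).const_add
        (theta ξ (m.natPred + 1) K)
    rw [add_zero] at tendsto_bound
    filter_upwards [tendsto_bound.eventually_lt_const hm] with n hn
    refine lt_of_le_of_lt ?_ hn
    have pow_pos : (0 : ℝ) < ((n + 1 : ℕ) : ℝ) ^ (1 / q).toReal := by positivity
    rw [div_le_iff₀ pow_pos, add_mul, div_mul_cancel₀ _ pow_pos.ne', mul_comm (theta _ _ _)]
    exact alpha_le p q hR hK ξ n m.natPred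

end HolderConjugate

/-! ### The Szlenk index -/

theorem szEps_le_iff {ε : ℝ} {η : Ordinal.{v}} :
    szEps K ε ≤ (η : WithTop Ordinal.{v}) ↔ szDerivIter ε K η = ∅ := by
  rw [szEps]
  split_ifs with h
  · rw [WithTop.coe_le_coe]
    exact ⟨fun hη => Set.subset_eq_empty (szDerivIter_anti ε K hη) (csInf_mem h),
      fun h => csInf_le' h⟩
  · simp only [top_le_iff, WithTop.coe_ne_top, false_iff]
    exact fun h' => h ⟨η, h'⟩

theorem Sz_le_iff {η : Ordinal.{v}} :
    Sz K ≤ (η : WithTop Ordinal.{v}) ↔ ∀ ε : ℝ, 0 < ε → szDerivIter ε K η = ∅ := by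
  rw [Sz, iSup₂_le_iff]
  exact forall₂_congr fun ε _ => szEps_le_iff

theorem iInf_theta_empty (ξ : Ordinal.{v}) :
    ⨅ n : ℕ+, theta ξ n (∅ : Set (WeakDual 𝕜 X)) = 0 := by
  refine le_antisymm (le_of_forall_pos_le_add fun c hc => ?_) (iInf_theta_nonneg ξ _)
  rw [zero_add]
  refine (iInf_theta_le ξ _ 0).trans (csInf_le (bddBelow_thetaSet ξ (0 + 1) _) ⟨hc, ?_⟩)
  intro D _ _ _ x _ _
  simp only [treeInf, supportFun_empty, Real.iInf_const_zero, hc.le]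

theorem iInf_theta_le_of_szDerivIter_eq_empty (hK : IsCompact K) (hKR : DualBdd R K)
    {ξ : Ordinal.{v}} {ε : ℝ≥0} (h : szDerivIter ε K (ω ^ (ξ + 1)) = ∅) :
    ⨅ n : ℕ+, theta ξ n K ≤ ε := by
  rcases K.eq_empty_or_nonempty with rfl | hne
  · rw [iInf_theta_empty]
    exact ε.coe_nonneg
  obtain ⟨η, hη, eq_empty⟩ := exists_lt_szDerivIter_eq_empty hK (isSuccLimit_opow_add_one ξ) h
  obtain ⟨n, hn⟩ := exists_nat_of_lt_opow_add_one hη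
  have hK_max : DualBdd (max R ε) K := fun f hf => (hKR f hf).trans (le_max_left R ε)
  have bound (N : ℕ) : ⨅ n : ℕ+, theta ξ n K ≤ ε + n * (max R ε : ℝ≥0) / (N + 1) :=
    calc ⨅ n : ℕ+, theta ξ n K ≤ theta ξ (N + 1) K := iInf_theta_le ξ K N
      _ ≤ subdivide (op 𝕜 ξ) N 1 (supportFun K) 0 := theta_le_subdivide hK_max ξ N
      _ ≤ ε + n * (max R ε : ℝ≥0) / (N + 1) :=
        subdivide_op_supportFun_le ε.coe_nonneg (le_max_right R ε) ξ hK hK_max hne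
          (Set.subset_eq_empty (szDerivIter_anti _ K hn.le) eq_empty) N
  refine ge_of_tendsto' (?_ : Tendsto _ atTop (𝓝 (ε : ℝ))) bound
  have tendsto_zero := (tendsto_add_atTop_iff_nat 1).2
    (tendsto_const_div_atTop_nhds_zero_nat (n * (max R ε : ℝ≥0) : ℝ))
  simpa using tendsto_zero.const_add (ε : ℝ)

theorem div_four_le_iInf_theta (hK : DualBdd R K) {ξ : Ordinal.{v}} {ε : ℝ}
    (h : (szDerivIter ε K (ω ^ (ξ + 1))).Nonempty) : ε / 4 ≤ ⨅ n : ℕ+, theta ξ n K := by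
  obtain ⟨f, hf⟩ := h
  refine le_ciInf fun n => ?_
  rw [← n.natPred_add_one]
  set k := n.natPred
  have hfk := szDerivIter_anti ε K (opow_mul_natCast_le ξ (k + 1)) hf
  have le_foldr := DualBdd.re_add_le_foldr_supportFun (isStepOperator_op 𝕜 ξ)
    (b := 1 / (k + 1)) (fun L hL f hf x => hL.re_add_le_op_supportFun ξ hf _ x) (k + 1) hK hfk 0
  have le_theta := subdivide_le_mul_theta hK ξ k 1
  rw [NNReal.coe_one, one_mul] at le_theta
  refine le_trans (le_of_eq ?_) (le_foldr.trans le_theta)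
  push_cast
  rw [map_zero, map_zero]
  field_simp
  ring

theorem Sz_le_iff_iInf_theta (hK : IsCompact K) (hKR : DualBdd R K) (ξ : Ordinal.{v}) :
    Sz K ≤ ((ω ^ (ξ + 1) : Ordinal.{v}) : WithTop Ordinal.{v}) ↔ ⨅ n : ℕ+, theta ξ n K = 0 := by
  rw [Sz_le_iff]
  refine ⟨fun h => le_antisymm ?_ (iInf_theta_nonneg ξ K), fun h ε hε => ?_⟩
  · refine le_of_forall_pos_le_add fun ε hε => ?_
    lift ε to ℝ≥0 using hε.le
    rw [zero_add]
    exact iInf_theta_le_of_szDerivIter_eq_empty hK hKR (h ε hε)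
  · by_contra hne
    linarith [div_four_le_iInf_theta hKR (Set.nonempty_iff_ne_empty.2 hne)]

end Quantities

end SzlenkSum

end

theorem mainTheorem3 {𝕜 : Type w} [RCLike 𝕜] {X : Type u} [NormedAddCommGroup X]
    [NormedSpace 𝕜 X] [CompleteSpace X] (K : Set (WeakDual 𝕜 X)) (hK : IsCompact K)
    (ξ : Ordinal.{v}) (p q : ℝ≥0∞) (hp : 1 < p) (hq : 1 ≤ q) (hpq : 1 / p + 1 / q = 1) :
    (⨅ n : ℕ+, SzlenkSum.theta ξ n K) =
        Filter.limsup (fun n : ℕ => SzlenkSum.alpha ξ p n K / (n : ℝ) ^ (1 / q).toReal)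
          Filter.atTop ∧
      (SzlenkSum.Sz K ≤ ((ω ^ (ξ + 1) : Ordinal.{v}) : WithTop Ordinal.{v}) ↔
        (⨅ n : ℕ+, SzlenkSum.theta ξ n K) = 0) ∧
      ((⨅ n : ℕ+, SzlenkSum.theta ξ n K) = 0 ↔
        Filter.limsup (fun n : ℕ => SzlenkSum.alpha ξ p n K / (n : ℝ) ^ (1 / q).toReal)
          Filter.atTop = 0) := by
  obtain ⟨R, hR, hKR⟩ := SzlenkSum.exists_pos_dualBdd hK
  have : p.HolderConjugate q := ENNReal.holderConjugate_iff.2 (by simpa using hpq)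
  have limsup_eq := (SzlenkSum.tendsto_alpha_div q hp hR hKR ξ).limsup_eq
  exact ⟨limsup_eq.symm, SzlenkSum.Sz_le_iff_iInf_theta hK hKR ξ, by rw [limsup_eq]⟩
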